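/- A finite abstract simplicial complex $X$ is a finite collection of nonempty finite vertex sets closed under passing to nonempty subsets; $S_k(X)$ is the set of its $k$-simplexes (faces with $k+1$ vertices). $X$ is a simplicial $m$-complex if $S_m(X)\neq\emptyset$ and $S_{m+1}(X)=\emptyset$, and a simplicial $m$-ball if moreover its geometric realization is homeomorphic to the closed unit ball of $\mathbb{R}^m$. Let $\delta$ denote the (unreduced) simplicial coboundary maps $C^{k}(X;F)\to C^{k+1}(X;F)$, the transposes of the simplicial boundary maps. Put $$\lambda^k(X)=\min_{\substack{0\neq f\in C^k(X;\mathbb{R})\\ f\perp \operatorname{im}\delta}}\frac{\|\delta f\|_2^2}{\|f\|_2^2},\qquad h^k(X)=\min_{\substack{\phi\in C^k(X;\mathbb{Z}_2)\\ \phi\notin \operatorname{im}\delta}}\frac{\|\delta\phi\|}{\min_{\psi\in\operatorname{im}\delta}\|\phi+\psi\|},$$ where $\|\cdot\|_2$ is the Euclidean norm with respect to the basis of oriented $k$-simplexes and $\|\cdot\|$ is the Hamming norm. Let $m>1$ and let $\Sigma^m$ be the complex of all faces of a single $m$-simplex. Define $X_1=\Sigma^m$, and let $X_{k+1}$ arise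 from $X_k$ by choosing, for every boundary face $s$ of $X_k$ (an $(m-1)$-simplex contained in exactly one $m$-simplex), a new vertex $v_s$, and adding the $m$-simplex $s\cup\{v_s\}$ with all its faces. The stellar subdivision of a simplicial $m$-complex along an $m$-simplex $\sigma$ replaces $\sigma$ by the $m$-simplexes $(\sigma\setminus\{u\})\cup\{w\}$, $u\in\sigma$, where $w$ is a new vertex, together with their faces. Let $Y_1$ be the stellar subdivision of $\Sigma^m$ along its $m$-simplex, with new vertex $c$ (the central vertex), and let $Y_{k+1}$ arise from $Y_k$ by successive stellar subdivision along all $m$-simplexes of $Y_k$ that contain $c$. Then: 1. For all $k\ge 1$, $X_k$ is a simplicial $m$-ball, $\lambda^{m-1}(X_k)\ge \frac{(m-1)^2}{2(m+1)}$ and $h^{m-1}(X_k)=\frac1k$; in particular $h^{m-1}(X_k)\to 0$ as $k\to\infty$. 2. For all $k\ge 1$, $Y_k$ is a simplicial $m$-ball, $\lambda^{m-1}(Y_k)\le \frac{1}{m^{k-1}}$ and $h^{m-1}(Y_k)\ge\frac1k$. 3. Consequently neither side of a coboundary Cheeger inequality holds, even for simplicial $m$-balls (whose homology is torsion-free): there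 are no real constants $p>0$ and $C$ such that $\lambda^{m-1}(X)\le C\,h^{m-1}(X)^{p}$ for all simplicial $m$-balls $X$, and there are no real constants $p$ and $C>0$ such that $\lambda^{m-1}(X)\ge \dfrac{C\,h^{m-1}(X)^{p}}{\max_{s\in S_{m-1}(X)}d_s}$ for all simplicial $m$-balls $X$, where $d_s$ is the number of $m$-simplexes containing $s$. -/

import Mathlib

open Filter Topology
open scoped Matrix

/-- A finite abstract simplicial complex with vertices in `V`: a finite collection of nonempty
finite subsets of `V` that is closed under passing to nonempty subsets. -/
structure FiniteComplex (V : Type*) extends PreAbstractSimplicialComplex V where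
  finite_faces : faces.Finite

namespace FiniteComplex

section General

variable {V : Type*}

/-- `S_k(X)`: the `k`-simplexes of `X`, that is, the faces with `k + 1` vertices. -/
def Simplex (X : FiniteComplex V) (k : ℕ) : Type _ :=
  {s : Finset V // s ∈ X.faces ∧ s.card = k + 1}

instance (X : FiniteComplex V) (k : ℕ) : Finite (X.Simplex k) :=
  (X.finite_faces.subset (fun _ hs => hs.1) :
    {s : Finset V | s ∈ X.faces ∧ s.card = k + 1}.Finite).to_subtype

noncomputable instance (X : FiniteComplex V) (k : ℕ) : Fintype (X.Simplex k) :=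
  Fintype.ofFinite _

/-- `X` is a simplicial `m`-complex: it has `m`-simplexes, but no `(m+1)`-simplexes. -/
def HasDim (X : FiniteComplex V) (m : ℕ) : Prop :=
  Nonempty (X.Simplex m) ∧ IsEmpty (X.Simplex (m + 1))

/-- The geometric realization `|X|`, in barycentric coordinates: the union over the faces `s` of the
geometric simplexes spanned by the unit vectors of the vertices of `s`. The topology is
the subspace topology of the product topology on `V → ℝ`; as `X` is finite, this is the Euclidean
topology on the coordinates that belong to vertices of `X`. -/
def realization (X : FiniteComplex V) : Set (V → ℝ) :=
  {x | ∃ s ∈ X.faces, (∀ v, 0 ≤ x v) ∧ (∀ v, v ∉ s → x v = 0) ∧ ∑ v ∈ s, x v = 1}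

/-- `X` is a simplicial `m`-ball: a simplicial `m`-complex whose geometric realization is
homeomorphic to the closed unit ball of Euclidean `m`-space. -/
def IsBall (X : FiniteComplex V) (m : ℕ) : Prop :=
  X.HasDim m ∧
    Nonempty (X.realization ≃ₜ Metric.closedBall (0 : EuclideanSpace ℝ (Fin m)) 1)

/-- `d_s` for a `k`-simplex `s`: the number of `(k+1)`-simplexes containing `s`. -/
noncomputable def codegree (X : FiniteComplex V) (k : ℕ) (s : X.Simplex k) : ℕ :=
  {t : X.Simplex (k + 1) | s.1 ⊆ t.1}.ncard

/-- The maximum of `d_s` over all `k`-simplexes `s`. -/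
noncomputable def maxCodegree (X : FiniteComplex V) (k : ℕ) : ℕ :=
  Finset.univ.sup (X.codegree k)

/-- `s` is a boundary face of the simplicial `m`-complex `X`: an `(m-1)`-simplex that is contained
in exactly one `m`-simplex. -/
def IsBoundaryFace (X : FiniteComplex V) (m : ℕ) (s : Finset V) : Prop :=
  s ∈ X.faces ∧ s.card = m ∧ ∃! t, t ∈ X.faces ∧ t.card = m + 1 ∧ s ⊆ t

end General

section Cochains

variable {V : Type*} [LinearOrder V]

/-- The matrix of the boundary map `∂ : C_{k+1}(X; F) → C_k(X; F)`. The simplexes, oriented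
by increasing order of their vertices, are the bases of the two spaces, and
`∂ [v_0, …, v_{k+1}] = ∑ i, (-1)^i [v_0, …, v_{i-1}, v_{i+1}, …, v_{k+1}]` for
`v_0 < ⋯ < v_{k+1}`. -/
def boundaryMatrix (F : Type*) [CommRing F] (X : FiniteComplex V) (k : ℕ) :
    Matrix (X.Simplex k) (X.Simplex (k + 1)) F :=
  fun s t => ∑ v ∈ t.1, if t.1.erase v = s.1 then (-1) ^ (t.1.filter (· < v)).card else 0

/-- The coboundary map `δ : C^k(X; F) → C^{k+1}(X; F)`, the transpose of the boundary map. -/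
noncomputable def coboundary (F : Type*) [CommRing F] (X : FiniteComplex V) (k : ℕ) :
    (X.Simplex k → F) →ₗ[F] (X.Simplex (k + 1) → F) :=
  (X.boundaryMatrix F k)ᵀ.mulVecLin

/-- The image of `δ` in `C^k(X; F)`; for `k = 0` it is zero, since `C^{-1}(X; F) = 0`. -/
noncomputable def coboundaries (F : Type*) [CommRing F] (X : FiniteComplex V) :
    (k : ℕ) → Submodule F (X.Simplex k → F)
  | 0 => ⊥
  | k + 1 => LinearMap.range (X.coboundary F k)

/-- `λ^k(X)`: the minimum of `‖δ f‖₂² / ‖f‖₂²` over the nonzero `f ∈ C^k(X; ℝ)` that are orthogonal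
to the image of `δ`. -/
noncomputable def spectralGap (X : FiniteComplex V) (k : ℕ) : ℝ :=
  sInf {r | ∃ f : X.Simplex k → ℝ, f ≠ 0 ∧ (∀ g ∈ X.coboundaries ℝ k, ∑ s, f s * g s = 0) ∧
    r = (∑ t, X.coboundary ℝ k f t ^ 2) / ∑ s, f s ^ 2}

/-- The minimum of the Hamming norm `‖φ + ψ‖` over all `ψ` in the image of `δ`. -/
noncomputable def cosetNorm (X : FiniteComplex V) (k : ℕ) (φ : X.Simplex k → ZMod 2) : ℕ :=
  sInf {n | ∃ ψ ∈ X.coboundaries (ZMod 2) k, n = hammingNorm (φ + ψ)}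

/-- `h^k(X)`, the `k`-th coboundary Cheeger number: the minimum of `‖δ φ‖ / min_ψ ‖φ + ψ‖` over all
`φ ∈ C^k(X; ℤ/2)` outside the image of `δ`, where `ψ` runs over the image of `δ`. -/
noncomputable def cheeger (X : FiniteComplex V) (k : ℕ) : ℝ :=
  sInf {r | ∃ φ : X.Simplex k → ZMod 2, φ ∉ X.coboundaries (ZMod 2) k ∧
    r = (hammingNorm (X.coboundary (ZMod 2) k φ) : ℝ) / (X.cosetNorm k φ : ℝ)}

end Cochains

/-! Constructions on complexes whose vertices are natural numbers. -/

/-- `Σ^m`: the simplex with vertices `0, …, m` and all its faces. -/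
def fullSimplex (m : ℕ) : FiniteComplex ℕ where
  faces := {t | t.Nonempty ∧ t ⊆ Finset.range (m + 1)}
  isRelLowerSet_faces := fun _ ht => ⟨ht.1, fun _ hu hne => ⟨hne, hu.trans ht.2⟩⟩
  finite_faces := ((Finset.range (m + 1)).powerset.finite_toSet).subset
    (fun _ ht => Finset.mem_coe.2 (Finset.mem_powerset.2 ht.2))

/-- A natural number that is larger than all vertices of `X`. -/
noncomputable def fresh (X : FiniteComplex ℕ) : ℕ :=
  (X.finite_faces.toFinset.sup fun s => s.sup id) + 1

/-- Every boundary face `s` gets its own new vertex, which is not a vertex of `X`. -/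
noncomputable def apex (X : FiniteComplex ℕ) (s : Finset ℕ) : ℕ :=
  X.fresh + Encodable.encode s

/-- For every boundary face `s` of the simplicial `m`-complex `X`, glue the `m`-simplex
`s ∪ {v}` to `X`, where `v` is a new vertex belonging to `s`. -/
noncomputable def glueAll (X : FiniteComplex ℕ) (m : ℕ) : FiniteComplex ℕ where
  faces := X.faces ∪
    {t | t.Nonempty ∧ ∃ s, X.IsBoundaryFace m s ∧ t ⊆ insert (X.apex s) s}
  isRelLowerSet_faces := by
    rintro t (ht | ⟨hne, s, hs, hts⟩)
    · exact ⟨(X.isRelLowerSet_faces ht).1,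
        fun u hu hune => Or.inl ((X.isRelLowerSet_faces ht).2 hu hune)⟩
    · exact ⟨hne, fun u hu hune => Or.inr ⟨hune, s, hs, hu.trans hts⟩⟩
  finite_faces := by
    refine X.finite_faces.union ?_
    refine (X.finite_faces.biUnion
      (fun s _ => (insert (X.apex s) s).powerset.finite_toSet)).subset ?_
    rintro t ⟨-, s, hs, hts⟩
    exact Set.mem_biUnion hs.1 (Finset.mem_coe.2 (Finset.mem_powerset.2 hts))

/-- The stellar subdivision of `X` along the top-dimensional simplex `σ`, with new vertex `w`: `σ`
is replaced by the simplexes `(σ \ {v}) ∪ {w}`, `v ∈ σ`, and their faces. -/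
def stellarAt (X : FiniteComplex ℕ) (σ : Finset ℕ) (w : ℕ) : FiniteComplex ℕ where
  faces := {t | t ∈ X.faces ∧ ¬ σ ⊆ t} ∪
    {t | t.Nonempty ∧ ∃ v ∈ σ, t ⊆ insert w (σ.erase v)}
  isRelLowerSet_faces := by
    rintro t (⟨ht, hσ⟩ | ⟨hne, v, hv, htv⟩)
    · exact ⟨(X.isRelLowerSet_faces ht).1, fun u hu hune =>
        Or.inl ⟨(X.isRelLowerSet_faces ht).2 hu hune, fun h => hσ (h.trans hu)⟩⟩
    · exact ⟨hne, fun u hu hune => Or.inr ⟨hune, v, hv, hu.trans htv⟩⟩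
  finite_faces := by
    refine (X.finite_faces.subset fun _ ht => ht.1).union ?_
    refine ((insert w σ).powerset.finite_toSet).subset ?_
    rintro t ⟨-, v, hv, htv⟩
    exact Finset.mem_coe.2 (Finset.mem_powerset.2
      (htv.trans (Finset.insert_subset_insert w (Finset.erase_subset v σ))))

/-- The stellar subdivision `sd_σ X`, with a new vertex that is not a vertex of `X`. -/
noncomputable def stellar (X : FiniteComplex ℕ) (σ : Finset ℕ) : FiniteComplex ℕ :=
  X.stellarAt σ X.fresh

/-- `sd_{σ_1, …, σ_n} X = sd_{σ_1} (sd_{σ_2} (⋯ (sd_{σ_n} X)))`. -/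
noncomputable def stellarList (X : FiniteComplex ℕ) (l : List (Finset ℕ)) : FiniteComplex ℕ :=
  l.foldr (fun σ Z => Z.stellar σ) X

/-- The `m`-simplexes of `X` that contain the vertex `v`. -/
noncomputable def innerSimplexes (X : FiniteComplex ℕ) (m v : ℕ) : Finset (Finset ℕ) :=
  X.finite_faces.toFinset.filter fun s => s.card = m + 1 ∧ v ∈ s

/-- The family `X_1, X_2, …`: `X_1 = Σ^m`, and `X_{k+1}` arises from `X_k` by gluing a new
`m`-simplex to every boundary face. (The index starts at `1`; the value at `0` plays no role.) -/
noncomputable def familyX (m : ℕ) : ℕ → FiniteComplex ℕ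
  | 0 => fullSimplex m
  | 1 => fullSimplex m
  | k + 2 => (familyX m (k + 1)).glueAll m

/-- The central vertex: the new vertex of the first stellar subdivision of `Σ^m`. -/
noncomputable def centralVertex (m : ℕ) : ℕ := (fullSimplex m).fresh

/-- The family `Y_1, Y_2, …`: `Y_1` is the stellar subdivision of `Σ^m` along its `m`-simplex, and
`Y_{k+1}` is the stellar subdivision of `Y_k` along all `m`-simplexes that contain the central
vertex. (The index starts at `1`; the value at `0` plays no role.) -/
noncomputable def familyY (m : ℕ) : ℕ → FiniteComplex ℕ
  | 0 => fullSimplex m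
  | 1 => (fullSimplex m).stellar (Finset.range (m + 1))
  | k + 2 => (familyY m (k + 1)).stellarList
      ((familyY m (k + 1)).innerSimplexes m (centralVertex m)).toList

end FiniteComplex

/-!
All complexes here are `m`-balls with `m ≥ 2`, so the last two coboundary maps behave as in an
acyclic complex: `δ : C^{m-1} → C^m` is onto, and its kernel is the image of `C^{m-2}`. Both invariants
then only depend on how the `m`-simplexes meet along `(m-1)`-simplexes.

For the Cheeger number, write `K` for the largest number of nonzero values that is needed by
a cochain whose coboundary is a single `m`-simplex (a *filling* of this simplex). Filling the
simplexes in the support of `δ φ` one by one gives `h ≥ 1 / K`, and a simplex that needs `K` values gives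
equality (`one_div_le_cheeger`, `cheeger_le_one_div`). For the spectral gap, a cochain that is
orthogonal to the coboundaries is a boundary `∂ g`, so `‖∂ g‖² ≥ c ‖g‖²` for all `g` implies `λ ≥ c`
(`le_spectralGap`); conversely a chain `z` with values `± 1` gives `λ ≤ ‖∂ z‖² / ‖z‖²`
(`spectralGap_le`).

The complex `X_k` is a tree of simplexes. Every simplex has a filling along a path to the boundary,
of length at most `k` (`Gluable.fills_glue`), while a filling of the initial simplex has to cross
the disjoint boundaries of `X_1, …, X_k` (`familyX_spec`); hence `h = 1 / k`. The form `‖∂ g‖²` is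
a Dirichlet form on a ball in the regular tree of degree `m + 1`, up to signs that the estimate
`2 |x y| ≤ x² / √m + √m y²` does not see, and it is at least `(√m - 1)² ‖g‖²`
(`Gluable.energy_glue`).

In `Y_k`, every simplex has a filling of size at most `k` by faces without the central vertex
(`Subdividable.fills_stellarAt`), whereas the fundamental chain has `m + 1` boundary faces and at
least `(m + 1) m^{k-1}` simplexes (`Subdividable.exists_chain`,
`Subdividable.card_innerSimplexes_stellarAt`). So `h ≥ 1 / k` while `λ ≤ 1 / m^{k-1}`.

Both constructions are iterations of an elementary step, gluing one simplex to a boundary face or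
subdividing one simplex (`glueAll_induction`, `stellarList_induction`). The steps preserve the
vanishing of cohomology, and they preserve the realization up to explicit piecewise linear homeomorphisms
(`Gluable.nonempty_homeomorph`, `Subdividable.nonempty_homeomorph`).

If `C h^p / d ≤ λ` held for all balls, with `d` the maximal codegree, the complexes `Y_k`, for which
`1 / k ≤ h ≤ 1` and `1 ≤ d ≤ 2`, would contradict the exponential decay of `λ`, whatever
the sign of `p`.
-/

namespace FiniteComplex

/-! ### Signed coboundaries of functions on all finite sets -/

section Cochains

variable {V : Type*} [LinearOrder V] {F : Type*} [CommRing F]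

/-- The incidence sign of the facet `t \ {v}` of the ordered simplex `t`. -/
def faceSign (F : Type*) [CommRing F] (v : V) (t : Finset V) : F :=
  (-1) ^ (t.filter (· < v)).card

/-- The coboundary of a function on all finite subsets of `V`. Cochains of a complex are treated as
restrictions of such functions, so that they need not be transported when the complex changes. -/
def cobd (φ : Finset V → F) (t : Finset V) : F :=
  ∑ v ∈ t, faceSign F v t * φ (t.erase v)

@[simp]
theorem faceSign_mul_self (v : V) (t : Finset V) : faceSign F v t * faceSign F v t = 1 := by
  rw [faceSign, ← mul_pow]; simp

theorem faceSign_sq (v : V) (t : Finset V) : faceSign F v t ^ 2 = 1 := by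
  rw [sq, faceSign_mul_self]

theorem faceSign_zmod_two (v : V) (t : Finset V) : faceSign (ZMod 2) v t = 1 := by
  rw [faceSign, show (-1 : ZMod 2) = 1 by decide, one_pow]

theorem cobd_zmod_two (φ : Finset V → ZMod 2) (t : Finset V) :
    cobd φ t = ∑ v ∈ t, φ (t.erase v) := by
  simp [cobd, faceSign_zmod_two]

theorem faceSign_mul_faceSign_of_lt {t : Finset V} {u v : V} (hu : u ∈ t) (huv : u < v) :
    faceSign F v t * faceSign F u (t.erase v) = -(faceSign F u t * faceSign F v (t.erase u)) := by
  have h1 : (t.erase v).filter (· < u) = t.filter (· < u) := by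
    ext x
    simp only [Finset.mem_filter, Finset.mem_erase]
    constructor
    · rintro ⟨⟨_, h⟩, h'⟩; exact ⟨h, h'⟩
    · rintro ⟨h, h'⟩; exact ⟨⟨(h'.trans huv).ne, h⟩, h'⟩
  have h2 : (t.erase u).filter (· < v) = (t.filter (· < v)).erase u := by
    ext x
    simp only [Finset.mem_filter, Finset.mem_erase]
    tauto
  have h3 : (t.filter (· < v)).card = ((t.filter (· < v)).erase u).card + 1 :=
    (Finset.card_erase_add_one (Finset.mem_filter.2 ⟨hu, huv⟩)).symm
  simp only [faceSign, h1, h2, h3, pow_succ]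
  ring

theorem faceSign_mul_faceSign {t : Finset V} {u v : V} (hu : u ∈ t) (hv : v ∈ t) (huv : u ≠ v) :
    faceSign F v t * faceSign F u (t.erase v) = -(faceSign F u t * faceSign F v (t.erase u)) := by
  rcases lt_or_gt_of_ne huv with h | h
  · exact faceSign_mul_faceSign_of_lt hu h
  · rw [faceSign_mul_faceSign_of_lt hv h, neg_neg]

theorem cobd_cobd (φ : Finset V → F) (t : Finset V) : cobd (cobd φ) t = 0 := by
  simp only [cobd, Finset.mul_sum]
  rw [Finset.sum_sigma']
  refine Finset.sum_involution (fun p _ => ⟨p.2, p.1⟩) ?_ ?_ ?_ ?_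
  · rintro ⟨v, u⟩ h
    simp only [Finset.mem_sigma, Finset.mem_erase] at h
    simp only [← mul_assoc]
    rw [faceSign_mul_faceSign h.2.2 h.1 h.2.1, Finset.erase_right_comm]
    ring
  · rintro ⟨v, u⟩ h - heq
    simp only [Finset.mem_sigma, Finset.mem_erase] at h
    simp only [Sigma.mk.injEq, heq_eq_eq] at heq
    exact h.2.1 heq.1
  · rintro ⟨v, u⟩ h
    simp only [Finset.mem_sigma, Finset.mem_erase] at h ⊢
    exact ⟨h.2.2, fun e => h.2.1 e.symm, h.1⟩
  · rintro ⟨v, u⟩ _; rfl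

theorem cobd_add (φ ψ : Finset V → F) (t : Finset V) :
    cobd (fun s => φ s + ψ s) t = cobd φ t + cobd ψ t := by
  simp [cobd, mul_add, Finset.sum_add_distrib]

theorem cobd_sub (φ ψ : Finset V → F) (t : Finset V) :
    cobd (fun s => φ s - ψ s) t = cobd φ t - cobd ψ t := by
  simp [cobd, mul_sub, Finset.sum_sub_distrib]

theorem cobd_mul_left (a : F) (φ : Finset V → F) (t : Finset V) :
    cobd (fun s => a * φ s) t = a * cobd φ t := by
  simp only [cobd, Finset.mul_sum]
  exact Finset.sum_congr rfl fun _ _ => by ring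

theorem cobd_congr {φ ψ : Finset V → F} {t : Finset V}
    (h : ∀ v ∈ t, φ (t.erase v) = ψ (t.erase v)) :
    cobd φ t = cobd ψ t :=
  Finset.sum_congr rfl fun v hv => by rw [h v hv]

theorem cobd_eq_zero {φ : Finset V → F} {t : Finset V} (h : ∀ v ∈ t, φ (t.erase v) = 0) :
    cobd φ t = 0 :=
  Finset.sum_eq_zero fun v hv => by rw [h v hv, mul_zero]

/-- A coboundary with a single nonzero term. -/
theorem cobd_eq_single {φ : Finset V → F} {t : Finset V} {v : V} (hv : v ∈ t)
    (h : ∀ u ∈ t, u ≠ v → φ (t.erase u) = 0) : cobd φ t = faceSign F v t * φ (t.erase v) :=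
  Finset.sum_eq_single_of_mem v hv fun u hu huv => by rw [h u hu huv, mul_zero]

theorem cobd_insert (φ : Finset V → F) {s : Finset V} {v : V} (hv : v ∉ s) :
    cobd φ (insert v s) = faceSign F v (insert v s) * φ s +
      ∑ u ∈ s, faceSign F u (insert v s) * φ (insert v (s.erase u)) := by
  rw [cobd, Finset.sum_insert hv, Finset.erase_insert hv]
  congr 1
  refine Finset.sum_congr rfl fun u hu => ?_
  rw [Finset.erase_insert_of_ne (by rintro rfl; exact hv hu)]

/-- The incidence number of `s` and `t`: `± 1` if `s` is a facet of `t`, and `0` otherwise. -/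
def incidence (F : Type*) [CommRing F] (s t : Finset V) : F :=
  cobd (fun r => if r = s then 1 else 0) t

theorem incidence_eq_sum (s t : Finset V) :
    incidence F s t = ∑ v ∈ t, if t.erase v = s then (-1) ^ (t.filter (· < v)).card else 0 := by
  simp [incidence, cobd, faceSign]

theorem incidence_erase {t : Finset V} {v : V} (hv : v ∈ t) :
    incidence F (t.erase v) t = faceSign F v t := by
  rw [incidence, cobd_eq_single hv, if_pos rfl, mul_one]
  intro u hu huv
  rw [if_neg]
  intro h
  have : u ∈ t.erase v := Finset.mem_erase.2 ⟨huv, hu⟩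
  rw [← h] at this
  exact Finset.notMem_erase u t this

theorem incidence_eq_zero {s t : Finset V} (h : ∀ v ∈ t, t.erase v ≠ s) : incidence F s t = 0 :=
  cobd_eq_zero fun v hv => if_neg (h v hv)

theorem incidence_eq_zero_of_not_subset {s t : Finset V} (h : ¬ s ⊆ t) : incidence F s t = 0 :=
  incidence_eq_zero fun v _ e => h (e ▸ Finset.erase_subset v t)

theorem incidence_insert_sq {s : Finset V} {v : V} (hv : v ∉ s) :
    incidence F s (insert v s) ^ 2 = 1 := by
  have := incidence_erase (F := F) (Finset.mem_insert_self v s)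
  rw [Finset.erase_insert hv] at this
  rw [this, faceSign_sq]

theorem incidence_erase_sq {t : Finset V} {v : V} (hv : v ∈ t) :
    incidence F (t.erase v) t ^ 2 = 1 := by
  rw [incidence_erase hv, faceSign_sq]

/-- The cone operator with apex `a` contracts a full simplex: a function whose coboundary vanishes
on `T` is a coboundary on all facets of `T`, with a primitive that lives on the sets `q` for which
`q ∪ {a}` is a facet of `T` where `φ` does not vanish. -/
theorem exists_cobd_eq_on_facets {φ : Finset V → F} {T : Finset V} {a : V} (ha : a ∈ T)
    (hφ : cobd φ T = 0) :
    ∃ χ : Finset V → F, (∀ v ∈ T, cobd χ (T.erase v) = φ (T.erase v)) ∧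
      ∀ q, χ q ≠ 0 → a ∉ q ∧ insert a q ⊆ T ∧ φ (insert a q) ≠ 0 := by
  classical
  let χ : Finset V → F := fun q =>
    if a ∉ q ∧ insert a q ⊆ T then faceSign F a (insert a q) * φ (insert a q) else 0
  have key : ∀ v ∈ T, v ≠ a → cobd χ (T.erase v) = φ (T.erase v) := by
    intro v hv hva
    have haT : a ∈ T.erase v := Finset.mem_erase.2 ⟨hva.symm, ha⟩
    rw [cobd_eq_single haT]
    · have : χ ((T.erase v).erase a) = faceSign F a (T.erase v) * φ (T.erase v) := by
        simp only [χ]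
        rw [if_pos, Finset.insert_erase haT]
        rw [Finset.insert_erase haT]
        exact ⟨Finset.notMem_erase _ _, Finset.erase_subset _ _⟩
      rw [this, ← mul_assoc, faceSign_mul_self, one_mul]
    · intro u hu hua
      simp only [χ]
      rw [if_neg]
      rintro ⟨h, -⟩
      exact h (Finset.mem_erase.2 ⟨hua.symm, haT⟩)
  refine ⟨χ, ?_, ?_⟩
  · intro v hv
    by_cases hva : v = a
    · subst hva
      have h1 : cobd (fun s => φ s - cobd χ s) T = 0 := by
        rw [cobd_sub, hφ, cobd_cobd, sub_zero]
      rw [cobd_eq_single hv (fun u hu huv => by rw [key u hu huv, sub_self])] at h1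
      have h2 := congrArg (faceSign F v T * ·) h1
      simp only [← mul_assoc, faceSign_mul_self, one_mul, mul_zero] at h2
      exact (sub_eq_zero.1 h2).symm
    · exact key v hv hva
  · intro q hq
    simp only [χ] at hq
    split_ifs at hq with h
    · exact ⟨h.1, h.2, fun h0 => hq (by rw [h0, mul_zero])⟩
    · exact absurd rfl hq

end Cochains

/-! ### Simplexes of a complex as a finite set of finite sets -/

section Cells

variable {V : Type*}

theorem ext_faces {X Y : FiniteComplex V} (h : X.faces = Y.faces) : X = Y := by
  rcases X with ⟨⟨_, _⟩, _⟩
  rcases Y with ⟨⟨_, _⟩, _⟩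
  cases h
  rfl

/-- The faces of `X` with `j` vertices. -/
noncomputable def cells (X : FiniteComplex V) (j : ℕ) : Finset (Finset V) := by
  classical exact X.finite_faces.toFinset.filter fun s => s.card = j

@[simp]
theorem mem_cells {X : FiniteComplex V} {j : ℕ} {s : Finset V} :
    s ∈ X.cells j ↔ s ∈ X.faces ∧ s.card = j := by
  simp [cells]

theorem face_nonempty {X : FiniteComplex V} {s : Finset V} (hs : s ∈ X.faces) : s.Nonempty :=
  (X.isRelLowerSet_faces hs).1

theorem face_subset {X : FiniteComplex V} {s t : Finset V} (ht : t ∈ X.faces) (hst : s ⊆ t)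
    (hs : s.Nonempty) : s ∈ X.faces :=
  (X.isRelLowerSet_faces ht).2 hst hs

theorem erase_mem_cells [DecidableEq V] {X : FiniteComplex V} {j : ℕ} (hj : 0 < j) {t : Finset V}
    (ht : t ∈ X.cells (j + 1)) {v : V} (hv : v ∈ t) : t.erase v ∈ X.cells j := by
  rw [mem_cells] at ht ⊢
  have hc : (t.erase v).card = j := by rw [Finset.card_erase_of_mem hv, ht.2]; rfl
  exact ⟨face_subset ht.1 (Finset.erase_subset v t) (Finset.card_pos.1 (hc ▸ hj)), hc⟩

theorem sum_simplex {M : Type*} [AddCommMonoid M] (X : FiniteComplex V) (k : ℕ)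
    (f : Finset V → M) : ∑ s : X.Simplex k, f s.1 = ∑ s ∈ X.cells (k + 1), f s :=
  (Finset.sum_subtype (X.cells (k + 1)) (fun _ => mem_cells) f).symm

theorem exists_extension {F : Type*} [Zero F] (X : FiniteComplex V) (k : ℕ) (f : X.Simplex k → F) :
    ∃ φ : Finset V → F, ∀ s, f s = φ s.1 := by
  classical
  exact ⟨fun s => if h : s ∈ X.faces ∧ s.card = k + 1 then f ⟨s, h⟩ else 0, fun s =>
    (dif_pos (t := fun h => f ⟨s.1, h⟩) (e := fun _ => 0) s.2).symm⟩

variable [LinearOrder V] {F : Type*} [CommRing F]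

theorem boundaryMatrix_apply (X : FiniteComplex V) (k : ℕ) (s : X.Simplex k)
    (t : X.Simplex (k + 1)) : X.boundaryMatrix F k s t = incidence F s.1 t.1 := by
  rw [incidence_eq_sum]; rfl

theorem cobd_eq_sum_incidence (X : FiniteComplex V) {j : ℕ} (hj : 0 < j) (φ : Finset V → F)
    {t : Finset V} (ht : t ∈ X.cells (j + 1)) :
    cobd φ t = ∑ s ∈ X.cells j, incidence F s t * φ s := by
  simp only [incidence, cobd, Finset.sum_mul]
  rw [Finset.sum_comm]
  refine Finset.sum_congr rfl fun v hv => ?_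
  rw [Finset.sum_eq_single_of_mem _ (erase_mem_cells hj ht hv)]
  · simp
  · intro s _ hs
    rw [if_neg (Ne.symm hs)]
    simp

theorem coboundary_apply (X : FiniteComplex V) (k : ℕ) (φ : Finset V → F)
    (t : X.Simplex (k + 1)) : X.coboundary F k (fun s => φ s.1) t = cobd φ t.1 := by
  rw [cobd_eq_sum_incidence X (Nat.succ_pos k) φ (mem_cells.2 t.2)]
  rw [← sum_simplex X k (fun s => incidence F s t.1 * φ s)]
  simp only [coboundary, Matrix.mulVecLin_apply, Matrix.mulVec, dotProduct, Matrix.transpose_apply,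
    boundaryMatrix_apply]

theorem mem_coboundaries_succ (X : FiniteComplex V) (k : ℕ) (φ : Finset V → F) :
    (fun s : X.Simplex (k + 1) => φ s.1) ∈ X.coboundaries F (k + 1) ↔
      ∃ ψ : Finset V → F, ∀ s ∈ X.cells (k + 2), cobd ψ s = φ s := by
  simp only [coboundaries, LinearMap.mem_range]
  constructor
  · rintro ⟨f, hf⟩
    obtain ⟨ψ, hψ⟩ := X.exists_extension k f
    refine ⟨ψ, fun s hs => ?_⟩
    have := congrFun hf ⟨s, mem_cells.1 hs⟩
    rw [show f = fun s => ψ s.1 from funext hψ] at this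
    exact (X.coboundary_apply k ψ ⟨s, mem_cells.1 hs⟩).symm.trans this
  · rintro ⟨ψ, hψ⟩
    refine ⟨fun s => ψ s.1, funext fun s => ?_⟩
    rw [coboundary_apply]
    exact hψ s.1 (mem_cells.2 s.2)

/-- The boundary chain of the top-dimensional chain `g`, where `j` is the number of vertices of its
simplexes. -/
noncomputable def bd (X : FiniteComplex V) (j : ℕ) (g : Finset V → F) (s : Finset V) : F :=
  ∑ t ∈ X.cells j, incidence F s t * g t

theorem sum_cobd_mul (X : FiniteComplex V) {j : ℕ} (hj : 0 < j) (φ g : Finset V → F) :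
    ∑ t ∈ X.cells (j + 1), cobd φ t * g t = ∑ s ∈ X.cells j, φ s * X.bd (j + 1) g s := by
  simp only [bd, Finset.mul_sum]
  rw [Finset.sum_comm]
  refine Finset.sum_congr rfl fun t ht => ?_
  rw [cobd_eq_sum_incidence X hj φ ht, Finset.sum_mul]
  exact Finset.sum_congr rfl fun s _ => by ring

end Cells

/-! ### Bounds on Cheeger number and spectral gap from chains and cochains -/

section Bounds

variable {V : Type*}

/-- The faces with `j` vertices on which `φ` does not vanish. -/
noncomputable def supp {F : Type*} [CommRing F] (X : FiniteComplex V) (j : ℕ) (φ : Finset V → F) :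
    Finset (Finset V) := by
  classical exact (X.cells j).filter fun s => φ s ≠ 0

@[simp]
theorem mem_supp {F : Type*} [CommRing F] {X : FiniteComplex V} {j : ℕ} {φ : Finset V → F}
    {s : Finset V} : s ∈ X.supp j φ ↔ s ∈ X.cells j ∧ φ s ≠ 0 := by
  simp only [supp, Finset.mem_filter]

theorem hammingNorm_eq_card_supp (X : FiniteComplex V) (k : ℕ) (φ : Finset V → ZMod 2) :
    hammingNorm (fun s : X.Simplex k => φ s.1) = (X.supp (k + 1) φ).card := by
  classical
  rw [hammingNorm, supp, Finset.card_filter, Finset.card_filter]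
  convert X.sum_simplex k fun s => if φ s ≠ 0 then 1 else 0

theorem zmod_two_eq_one_of_ne_zero : ∀ {x : ZMod 2}, x ≠ 0 → x = 1 := by decide

theorem zmod_two_eq_one_of_sq : ∀ {x : ZMod 2}, x ^ 2 = 1 → x = 1 := by decide

variable [LinearOrder V]

/-- Every cocycle on the faces of `X` with `j` vertices is a coboundary. -/
def Acyclic (F : Type*) [CommRing F] (X : FiniteComplex V) (j : ℕ) : Prop :=
  ∀ φ : Finset V → F, (∀ t ∈ X.cells (j + 1), cobd φ t = 0) →
    ∃ ψ : Finset V → F, ∀ s ∈ X.cells j, cobd ψ s = φ s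

/-- The coboundary of `φ` is supported on the single face `t`, where its value has square `1`. -/
def Fills {F : Type*} [CommRing F] (X : FiniteComplex V) (j : ℕ) (φ : Finset V → F)
    (t : Finset V) : Prop :=
  cobd φ t ^ 2 = 1 ∧ ∀ τ ∈ X.cells (j + 1), τ ≠ t → cobd φ τ = 0

theorem cobd_sum {F ι : Type*} [CommRing F] (T : Finset ι) (Φ : ι → Finset V → F) (t : Finset V) :
    cobd (fun s => ∑ i ∈ T, Φ i s) t = ∑ i ∈ T, cobd (Φ i) t := by
  simp only [cobd, Finset.mul_sum]
  exact Finset.sum_comm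

variable {X : FiniteComplex V} {n : ℕ}

theorem cosetNorm_mem (X : FiniteComplex V) (k : ℕ) (f : X.Simplex k → ZMod 2) :
    ∃ ψ ∈ X.coboundaries (ZMod 2) k, X.cosetNorm k f = hammingNorm (f + ψ) :=
  Nat.sInf_mem (s := {N | ∃ ψ ∈ X.coboundaries (ZMod 2) k, N = hammingNorm (f + ψ)})
    ⟨_, 0, Submodule.zero_mem _, rfl⟩

theorem cosetNorm_pos {k : ℕ} {f : X.Simplex k → ZMod 2} (hf : f ∉ X.coboundaries (ZMod 2) k) :
    0 < X.cosetNorm k f := by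
  obtain ⟨ψ, hψ, h⟩ := X.cosetNorm_mem k f
  rw [Nat.pos_iff_ne_zero, h]
  intro h0
  rw [hammingNorm_eq_zero] at h0
  exact hf (by rw [eq_neg_of_add_eq_zero_left h0]; exact Submodule.neg_mem _ hψ)

theorem coboundary_eq_zero_of_mem {F : Type*} [CommRing F] {f : X.Simplex (n + 1) → F}
    (hf : f ∈ X.coboundaries F (n + 1)) : X.coboundary F (n + 1) f = 0 := by
  obtain ⟨φ, hφ⟩ := X.exists_extension (n + 1) f
  obtain rfl : f = fun s => φ s.1 := funext hφ
  obtain ⟨ψ, hψ⟩ := (X.mem_coboundaries_succ n φ).1 hf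
  funext t
  rw [coboundary_apply, Pi.zero_apply, ← cobd_cobd ψ t.1]
  exact cobd_congr fun v hv => (hψ _ (erase_mem_cells (Nat.succ_pos _) (mem_cells.2 t.2) hv)).symm

theorem Fills.notMem_coboundaries {F : Type*} [CommRing F] [Nontrivial F] {φ : Finset V → F}
    {t : Finset V} (ht : t ∈ X.cells (n + 3)) (h : X.Fills (n + 2) φ t) :
    (fun s : X.Simplex (n + 1) => φ s.1) ∉ X.coboundaries F (n + 1) := by
  intro hφ
  have h0 := congrFun (coboundary_eq_zero_of_mem hφ) ⟨t, mem_cells.1 ht⟩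
  have h1 : cobd φ t = 0 := (X.coboundary_apply (n + 1) φ ⟨t, mem_cells.1 ht⟩).symm.trans h0
  have := h.1
  rw [h1] at this
  simp at this

/-- If every top-dimensional simplex is, up to a sign, the coboundary of a cochain with at most `K`
nonzero values, then so is every cochain `c`, with `K ‖c‖` nonzero values. -/
theorem one_div_le_cheeger {K : ℕ} (hK : 0 < K) (hne : (X.cells (n + 3)).Nonempty)
    (hac : X.Acyclic (ZMod 2) (n + 2))
    (hfill : ∀ t ∈ X.cells (n + 3), ∃ φ : Finset V → ZMod 2,
      X.Fills (n + 2) φ t ∧ (X.supp (n + 2) φ).card ≤ K) :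
    1 / (K : ℝ) ≤ X.cheeger (n + 1) := by
  classical
  refine le_csInf ?_ ?_
  · obtain ⟨t, ht⟩ := hne
    obtain ⟨φ, hφ, -⟩ := hfill t ht
    exact ⟨_, _, hφ.notMem_coboundaries ht, rfl⟩
  rintro r ⟨f, hf, rfl⟩
  have hpos := cosetNorm_pos hf
  obtain ⟨φ, hφ⟩ := X.exists_extension (n + 1) f
  obtain rfl : f = fun s => φ s.1 := funext hφ
  choose! Φ hΦ hcard using hfill
  have hle : X.cosetNorm (n + 1) (fun s => φ s.1) ≤
      hammingNorm (X.coboundary (ZMod 2) (n + 1) fun s => φ s.1) * K := by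
    set T := X.supp (n + 3) (cobd φ) with hT
    have hc : hammingNorm (X.coboundary (ZMod 2) (n + 1) fun s => φ s.1) = T.card := by
      rw [hT, ← hammingNorm_eq_card_supp X (n + 2) (cobd φ)]
      congr 1
      funext t
      exact X.coboundary_apply (n + 1) φ t
    let θ : Finset V → ZMod 2 := fun s => (∑ t ∈ T, Φ t s) - φ s
    have hθ : ∀ τ ∈ X.cells (n + 3), cobd θ τ = 0 := by
      intro τ hτ
      rw [cobd_sub, cobd_sum, sub_eq_zero]
      by_cases hmem : τ ∈ T
      · rw [Finset.sum_eq_single_of_mem τ hmem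
          (fun t ht htτ => (hΦ t (mem_supp.1 ht).1).2 τ hτ htτ.symm),
          zmod_two_eq_one_of_sq (hΦ τ hτ).1,
          zmod_two_eq_one_of_ne_zero (mem_supp.1 hmem).2]
      · rw [Finset.sum_eq_zero fun t ht => (hΦ t (mem_supp.1 ht).1).2 τ hτ fun e => hmem (e ▸ ht)]
        by_contra h
        exact hmem (mem_supp.2 ⟨hτ, Ne.symm h⟩)
    have hmem := (X.mem_coboundaries_succ n θ).2 (hac θ hθ)
    have hinf : X.cosetNorm (n + 1) (fun s => φ s.1) ≤
        hammingNorm ((fun s => φ s.1) + fun s => θ s.1 : X.Simplex (n + 1) → ZMod 2) :=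
      Nat.sInf_le ⟨_, hmem, rfl⟩
    refine hinf.trans ?_
    have hsum : ((fun s => φ s.1) + fun s => θ s.1 : X.Simplex (n + 1) → ZMod 2) =
        fun s => (fun r => ∑ t ∈ T, Φ t r) s.1 := by
      funext s
      simp only [θ, Pi.add_apply]
      ring
    rw [hsum, X.hammingNorm_eq_card_supp (n + 1) fun r => ∑ t ∈ T, Φ t r, hc]
    refine (Finset.card_le_card (t := T.biUnion fun t => X.supp (n + 2) (Φ t)) ?_).trans
      (Finset.card_biUnion_le_card_mul _ _ _ fun t ht => hcard t (mem_supp.1 ht).1)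
    intro s hs
    rw [mem_supp] at hs
    obtain ⟨t, ht, h0⟩ := Finset.exists_ne_zero_of_sum_ne_zero hs.2
    exact Finset.mem_biUnion.2 ⟨t, ht, mem_supp.2 ⟨hs.1, h0⟩⟩
  rw [div_le_div_iff₀ (by exact_mod_cast hK) (by exact_mod_cast hpos), one_mul]
  exact_mod_cast hle

/-- A top-dimensional simplex that is the coboundary of some cochain, but of none with fewer than
`K` nonzero values, bounds the Cheeger number by `1 / K`. -/
theorem cheeger_le_one_div {K : ℕ} (hK : 0 < K) {t : Finset V} (ht : t ∈ X.cells (n + 3))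
    (hex : ∃ φ : Finset V → ZMod 2, X.Fills (n + 2) φ t)
    (hall : ∀ φ : Finset V → ZMod 2, X.Fills (n + 2) φ t → K ≤ (X.supp (n + 2) φ).card) :
    X.cheeger (n + 1) ≤ 1 / (K : ℝ) := by
  obtain ⟨φ, hφ⟩ := hex
  have hbdd : BddBelow {r : ℝ | ∃ φ : X.Simplex (n + 1) → ZMod 2,
      φ ∉ X.coboundaries (ZMod 2) (n + 1) ∧ r =
        (hammingNorm (X.coboundary (ZMod 2) (n + 1) φ) : ℝ) / (X.cosetNorm (n + 1) φ : ℝ)} := by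
    refine ⟨0, ?_⟩
    rintro r ⟨f, -, rfl⟩
    positivity
  refine (csInf_le hbdd ⟨_, hφ.notMem_coboundaries ht, rfl⟩).trans ?_
  have hnorm : hammingNorm (X.coboundary (ZMod 2) (n + 1) fun s => φ s.1) = 1 := by
    have : (X.coboundary (ZMod 2) (n + 1) fun s => φ s.1) = fun s => cobd φ s.1 :=
      funext fun t => X.coboundary_apply (n + 1) φ t
    rw [this, hammingNorm_eq_card_supp X (n + 2) (cobd φ), Finset.card_eq_one]
    refine ⟨t, Finset.ext fun τ => ?_⟩
    rw [mem_supp, Finset.mem_singleton]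
    constructor
    · rintro ⟨hτ, h⟩
      by_contra hne
      exact h (hφ.2 τ hτ hne)
    · rintro rfl
      refine ⟨ht, ?_⟩
      rw [zmod_two_eq_one_of_sq hφ.1]
      exact one_ne_zero
  have hle : K ≤ X.cosetNorm (n + 1) fun s => φ s.1 := by
    obtain ⟨f, hf, h⟩ := X.cosetNorm_mem (n + 1) fun s => φ s.1
    rw [h]
    obtain ⟨θ, hθ⟩ := X.exists_extension (n + 1) f
    obtain rfl : f = fun s => θ s.1 := funext hθ
    have h0 : ∀ τ ∈ X.cells (n + 3), cobd θ τ = 0 := fun τ hτ =>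
      (X.coboundary_apply (n + 1) θ ⟨τ, mem_cells.1 hτ⟩).symm.trans
        (congrFun (coboundary_eq_zero_of_mem hf) ⟨τ, mem_cells.1 hτ⟩)
    refine (hall (fun s => φ s + θ s) ⟨?_, ?_⟩).trans
      (X.hammingNorm_eq_card_supp (n + 1) fun s => φ s + θ s).ge
    · rw [cobd_add, h0 t ht, add_zero, hφ.1]
    · intro τ hτ hne
      rw [cobd_add, h0 τ hτ, hφ.2 τ hτ hne, add_zero]
  rw [hnorm, Nat.cast_one]
  exact one_div_le_one_div_of_le (by exact_mod_cast hK) (by exact_mod_cast hle)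

/-- Orthogonal projection of real families, with respect to the standard dot product. -/
theorem exists_orthogonal_projection {ι : Type*} [Fintype ι] (K : Submodule ℝ (ι → ℝ))
    (f : ι → ℝ) : ∃ p ∈ K, ∀ g ∈ K, ∑ i, (f i - p i) * g i = 0 := by
  let e := (WithLp.linearEquiv 2 ℝ (ι → ℝ))
  let K' : Submodule ℝ (EuclideanSpace ℝ ι) := K.comap e.toLinearMap
  obtain ⟨y, hy, z, hz, h⟩ := K'.exists_add_mem_mem_orthogonal (WithLp.toLp 2 f)
  refine ⟨e y, hy, fun g hg => ?_⟩
  have := (Submodule.mem_orthogonal K' z).1 hz (WithLp.toLp 2 g) hg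
  rw [PiLp.inner_apply] at this
  rw [← this]
  refine Finset.sum_congr rfl fun i _ => ?_
  have hi : f i = y i + z i := congrArg (fun w : EuclideanSpace ℝ ι => w i) h
  have he : e y i = y i := rfl
  rw [hi, he]
  simp

theorem coboundary_eq_cobd {F : Type*} [CommRing F] (X : FiniteComplex V) (k : ℕ)
    (φ : Finset V → F) :
    (X.coboundary F k fun s => φ s.1) = fun t => cobd φ t.1 :=
  funext fun t => X.coboundary_apply k φ t

/-- If the cohomology vanishes, then a cochain that is orthogonal to the coboundaries is the
boundary of a chain `g`. Hence a lower bound for `‖∂ g‖²` in terms of `‖g‖²` bounds the spectral gap. -/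
theorem le_spectralGap {c : ℝ} (hc : 0 < c) (hne : (X.cells (n + 3)).Nonempty)
    (hac : X.Acyclic ℝ (n + 2))
    (henergy : ∀ g : Finset V → ℝ, c * ∑ t ∈ X.cells (n + 3), g t ^ 2 ≤
      ∑ s ∈ X.cells (n + 2), X.bd (n + 3) g s ^ 2) :
    c ≤ X.spectralGap (n + 1) := by
  classical
  refine le_csInf ?_ ?_
  · obtain ⟨t, ht⟩ := hne
    let g : Finset V → ℝ := fun τ => if τ = t then 1 else 0
    refine ⟨_, fun s => X.bd (n + 3) g s.1, ?_, ?_, rfl⟩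
    · intro h0
      have h1 : ∑ s ∈ X.cells (n + 2), X.bd (n + 3) g s ^ 2 = 0 :=
        Finset.sum_eq_zero fun s hs => by
          have : X.bd (n + 3) g s = 0 := congrFun h0 ⟨s, mem_cells.1 hs⟩
          rw [this]; norm_num
      have h2 : ∑ t ∈ X.cells (n + 3), g t ^ 2 = 1 := by
        rw [Finset.sum_eq_single_of_mem t ht]
        · simp [g]
        · intro τ _ h
          simp [g, h]
      have := henergy g
      rw [h1, h2] at this
      linarith
    · intro f hf
      obtain ⟨φ, hφ⟩ := X.exists_extension (n + 1) f
      obtain rfl : f = fun s => φ s.1 := funext hφ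
      have h := coboundary_eq_zero_of_mem hf
      rw [coboundary_eq_cobd] at h
      refine (X.sum_simplex (n + 1) fun s => X.bd (n + 3) g s * φ s).trans ?_
      have h2 := X.sum_cobd_mul (Nat.succ_pos (n + 1)) φ g
      rw [Finset.sum_congr rfl (fun s _ => mul_comm (X.bd (n + 3) g s) (φ s)), ← h2]
      exact Finset.sum_eq_zero fun t ht => by
        rw [show cobd φ t = 0 from congrFun h ⟨t, mem_cells.1 ht⟩, zero_mul]
  rintro r ⟨f, hf0, hf, rfl⟩
  obtain ⟨φ, hφ⟩ := X.exists_extension (n + 1) f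
  obtain rfl : f = fun s => φ s.1 := funext hφ
  -- The projection of `φ` to the boundaries differs from `φ` by a cocycle, to which `φ` is
  -- orthogonal by assumption.
  have hbd : ∃ g : Finset V → ℝ, ∀ s ∈ X.cells (n + 2), φ s = X.bd (n + 3) g s := by
    let L : (Finset V → ℝ) →ₗ[ℝ] (X.Simplex (n + 1) → ℝ) :=
      { toFun := fun g s => X.bd (n + 3) g s.1
        map_add' := fun g h => by
          funext s; simp [bd, mul_add, Finset.sum_add_distrib]
        map_smul' := fun a g => by
          funext s
          simp only [bd, Pi.smul_apply, smul_eq_mul, RingHom.id_apply, Finset.mul_sum]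
          exact Finset.sum_congr rfl fun _ _ => by ring }
    obtain ⟨p, ⟨g, rfl⟩, hg⟩ := exists_orthogonal_projection L.range fun s => φ s.1
    refine ⟨g, ?_⟩
    let θ : Finset V → ℝ := fun s => φ s - X.bd (n + 3) g s
    have hθg : ∀ g', ∑ s ∈ X.cells (n + 2), θ s * X.bd (n + 3) g' s = 0 := fun g' =>
      (X.sum_simplex (n + 1) fun s => θ s * X.bd (n + 3) g' s).symm.trans (hg _ ⟨g', rfl⟩)
    have hθ : ∀ t ∈ X.cells (n + 3), cobd θ t = 0 := by
      intro t ht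
      have := hθg fun τ => if τ = t then 1 else 0
      rw [← sum_cobd_mul X (Nat.succ_pos (n + 1)), Finset.sum_eq_single_of_mem t ht] at this
      · simpa using this
      · intro τ _ h
        simp [h]
    have hφθ : ∑ s ∈ X.cells (n + 2), φ s * θ s = 0 :=
      (X.sum_simplex (n + 1) fun s => φ s * θ s).symm.trans
        (hf _ ((X.mem_coboundaries_succ n θ).2 (hac θ hθ)))
    have hsq : ∑ s ∈ X.cells (n + 2), θ s ^ 2 = 0 := by
      have : ∀ s ∈ X.cells (n + 2), θ s ^ 2 = φ s * θ s - θ s * X.bd (n + 3) g s := by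
        intro s _; simp only [θ]; ring
      rw [Finset.sum_congr rfl this, Finset.sum_sub_distrib, hφθ, hθg, sub_zero]
    intro s hs
    have := (Finset.sum_eq_zero_iff_of_nonneg fun s _ => sq_nonneg (θ s)).1 hsq s hs
    exact sub_eq_zero.1 (pow_eq_zero_iff two_ne_zero |>.1 this)
  obtain ⟨g, hg⟩ := hbd
  rw [coboundary_eq_cobd]
  have h1 : ∑ s : X.Simplex (n + 1), φ s.1 ^ 2 = ∑ s ∈ X.cells (n + 2), φ s ^ 2 :=
    X.sum_simplex (n + 1) fun s => φ s ^ 2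
  have h2 : ∑ t : X.Simplex (n + 2), cobd φ t.1 ^ 2 = ∑ t ∈ X.cells (n + 3), cobd φ t ^ 2 :=
    X.sum_simplex (n + 2) fun t => cobd φ t ^ 2
  rw [h1]
  refine le_of_le_of_eq ?_ (congrArg (· / _) h2.symm)
  have hA : 0 < ∑ s ∈ X.cells (n + 2), φ s ^ 2 := by
    refine lt_of_le_of_ne (Finset.sum_nonneg fun s _ => sq_nonneg _) fun h => hf0 ?_
    funext s
    have := (Finset.sum_eq_zero_iff_of_nonneg fun s _ => sq_nonneg (φ s)).1 h.symm s.1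
      (mem_cells.2 s.2)
    exact pow_eq_zero_iff two_ne_zero |>.1 this
  rw [le_div_iff₀ hA]
  set A := ∑ s ∈ X.cells (n + 2), φ s ^ 2 with hAdef
  have hE := henergy g
  rw [← Finset.sum_congr rfl (fun s hs => by rw [hg s hs] :
    ∀ s ∈ X.cells (n + 2), φ s ^ 2 = X.bd (n + 3) g s ^ 2), ← hAdef] at hE
  have hA' : A = ∑ t ∈ X.cells (n + 3), cobd φ t * g t := by
    rw [X.sum_cobd_mul (Nat.succ_pos (n + 1)), hAdef]
    exact Finset.sum_congr rfl fun s hs => by rw [sq]; nth_rewrite 2 [hg s hs]; rfl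
  have hCS := Finset.sum_mul_sq_le_sq_mul_sq (X.cells (n + 3)) (cobd φ) g
  rw [← hA'] at hCS
  set D := ∑ t ∈ X.cells (n + 3), cobd φ t ^ 2
  set G := ∑ t ∈ X.cells (n + 3), g t ^ 2
  have hD : 0 ≤ D := Finset.sum_nonneg fun s _ => sq_nonneg _
  have h3 : c * A ^ 2 ≤ D * A := by nlinarith [mul_le_mul_of_nonneg_left hE hD]
  nlinarith

/-- A chain `z` with values `± 1` and small boundary bounds the spectral gap: the cochain `f` with
`δ f = z` that is orthogonal to the cocycles satisfies `⟨∂ z, f⟩ = ‖z‖²`, so it is large. -/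
theorem spectralGap_le {D : ℝ} (hne : (X.cells (n + 3)).Nonempty)
    (hfill : ∀ t ∈ X.cells (n + 3), ∃ φ : Finset V → ℝ, X.Fills (n + 2) φ t)
    {z : Finset V → ℝ} (hz : ∀ t ∈ X.cells (n + 3), z t ^ 2 = 1)
    (hD : ∑ s ∈ X.cells (n + 2), X.bd (n + 3) z s ^ 2 ≤ D) :
    X.spectralGap (n + 1) ≤ D / (X.cells (n + 3)).card := by
  classical
  have hbdd : BddBelow {r : ℝ | ∃ f : X.Simplex (n + 1) → ℝ, f ≠ 0 ∧
      (∀ g ∈ X.coboundaries ℝ (n + 1), ∑ s, f s * g s = 0) ∧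
      r = (∑ t, X.coboundary ℝ (n + 1) f t ^ 2) / ∑ s, f s ^ 2} := by
    refine ⟨0, ?_⟩
    rintro r ⟨f, -, -, rfl⟩
    positivity
  choose! Φ hΦ using hfill
  let φ₀ : Finset V → ℝ := fun s => ∑ t ∈ X.cells (n + 3), (z t * cobd (Φ t) t) * Φ t s
  have hφ₀ : ∀ τ ∈ X.cells (n + 3), cobd φ₀ τ = z τ := by
    intro τ hτ
    have h1 : cobd φ₀ τ = _ :=
      cobd_sum (X.cells (n + 3)) (fun t s => (z t * cobd (Φ t) t) * Φ t s) τ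
    rw [h1, Finset.sum_eq_single_of_mem τ hτ]
    · rw [cobd_mul_left, mul_assoc, ← sq, (hΦ τ hτ).1, mul_one]
    · intro t ht hne
      rw [cobd_mul_left, (hΦ t ht).2 τ hτ hne.symm, mul_zero]
  obtain ⟨p, hp, hperp⟩ :=
    exists_orthogonal_projection (X.coboundaries ℝ (n + 1)) fun s => φ₀ s.1
  have hcob := coboundary_eq_zero_of_mem hp
  obtain ⟨ρ, hρ⟩ := X.exists_extension (n + 1) p
  obtain rfl : p = fun s => ρ s.1 := funext hρ
  rw [coboundary_eq_cobd] at hcob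
  let f : Finset V → ℝ := fun s => φ₀ s - ρ s
  have hf : ∀ t ∈ X.cells (n + 3), cobd f t = z t := by
    intro t ht
    rw [cobd_sub, hφ₀ t ht, show cobd ρ t = 0 from congrFun hcob ⟨t, mem_cells.1 ht⟩, sub_zero]
  set N : ℝ := ((X.cells (n + 3)).card : ℝ)
  have hN : 0 < N := Nat.cast_pos.2 (Finset.card_pos.2 hne)
  have hzz : ∑ t ∈ X.cells (n + 3), z t ^ 2 = N := by
    rw [Finset.sum_congr rfl hz, Finset.sum_const, nsmul_eq_mul, mul_one]
  have hpair : ∑ s ∈ X.cells (n + 2), f s * X.bd (n + 3) z s = N := by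
    rw [← X.sum_cobd_mul (Nat.succ_pos (n + 1)), ← hzz]
    exact Finset.sum_congr rfl fun t ht => by rw [hf t ht, sq]
  have hCS := Finset.sum_mul_sq_le_sq_mul_sq (X.cells (n + 2)) f (X.bd (n + 3) z)
  rw [hpair] at hCS
  set A := ∑ s ∈ X.cells (n + 2), f s ^ 2 with hA
  have hA0 : 0 ≤ A := Finset.sum_nonneg fun s _ => sq_nonneg _
  have hAD : N ^ 2 ≤ A * D := hCS.trans (mul_le_mul_of_nonneg_left hD hA0)
  have hApos : 0 < A := by
    refine lt_of_le_of_ne hA0 fun h => ?_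
    rw [← h, zero_mul] at hAD
    nlinarith
  have h1 : ∑ s : X.Simplex (n + 1), f s.1 ^ 2 = ∑ s ∈ X.cells (n + 2), f s ^ 2 :=
    X.sum_simplex (n + 1) fun s => f s ^ 2
  have h2 : ∑ t : X.Simplex (n + 2), cobd f t.1 ^ 2 = ∑ t ∈ X.cells (n + 3), cobd f t ^ 2 :=
    X.sum_simplex (n + 2) fun t => cobd f t ^ 2
  refine (csInf_le hbdd ⟨fun s => f s.1, ?_, hperp, rfl⟩).trans ?_
  · intro h0
    refine hApos.ne' ?_
    rw [hA, ← h1]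
    exact Finset.sum_eq_zero fun s _ => by
      rw [show f s.1 = 0 from congrFun h0 s]; norm_num
  · rw [coboundary_eq_cobd, h1, h2, ← hA,
      Finset.sum_congr rfl (fun t ht => by rw [hf t ht] : ∀ t ∈ X.cells (n + 3),
        cobd f t ^ 2 = z t ^ 2), hzz, div_le_div_iff₀ hApos hN]
    linarith [sq N]

end Bounds

/-! ### Gluing a simplex to a boundary face -/

section Glue

variable {V : Type*}

/-- `Z` has dimension at most `m`, `s` is a boundary face of `Z` and `v` is not a vertex of `Z`. -/
structure Gluable (Z : FiniteComplex V) (m : ℕ) (s : Finset V) (v : V) : Prop where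
  card_le : ∀ t ∈ Z.faces, t.card ≤ m + 1
  boundary : Z.IsBoundaryFace m s
  fresh : ∀ t ∈ Z.faces, v ∉ t

/-- The boundary faces of `Z`, as a finite set. -/
noncomputable def bdry (Z : FiniteComplex V) (m : ℕ) : Finset (Finset V) := by
  classical exact (Z.cells m).filter (Z.IsBoundaryFace m)

@[simp]
theorem mem_bdry {Z : FiniteComplex V} {m : ℕ} {s : Finset V} :
    s ∈ Z.bdry m ↔ Z.IsBoundaryFace m s := by
  simp only [bdry, Finset.mem_filter, mem_cells, and_iff_right_iff_imp]
  exact fun h => ⟨h.1, h.2.1⟩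

namespace Gluable

variable {Z : FiniteComplex V} {m : ℕ} {s : Finset V} {v : V} (h : Z.Gluable m s v)
include h

theorem notMem : v ∉ s := h.fresh s h.boundary.1

theorem card_eq : s.card = m := h.boundary.2.1

theorem pos : 0 < m := h.card_eq ▸ Finset.card_pos.2 (face_nonempty h.boundary.1)

end Gluable

variable [LinearOrder V]

/-- Add to `Z` the simplex `s ∪ {v}` with all its faces. -/
def glue (Z : FiniteComplex V) (s : Finset V) (v : V) : FiniteComplex V where
  faces := Z.faces ∪ {t | t.Nonempty ∧ t ⊆ insert v s}
  isRelLowerSet_faces := by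
    rintro t (ht | ⟨hne, hts⟩)
    · exact ⟨(Z.isRelLowerSet_faces ht).1,
        fun u hu hune => Or.inl ((Z.isRelLowerSet_faces ht).2 hu hune)⟩
    · exact ⟨hne, fun u hu hune => Or.inr ⟨hune, hu.trans hts⟩⟩
  finite_faces := Z.finite_faces.union
    ((insert v s).powerset.finite_toSet.subset fun _ ht =>
      Finset.mem_coe.2 (Finset.mem_powerset.2 ht.2))

/-- The facets of `s ∪ {v}` other than `s`. -/
def newFacets (s : Finset V) (v : V) : Finset (Finset V) :=
  s.image fun u => (insert v s).erase u

theorem sum_newFacets {M : Type*} [AddCommMonoid M] {s : Finset V} {v : V}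
    (f : Finset V → M) : ∑ r ∈ newFacets s v, f r = ∑ u ∈ s, f ((insert v s).erase u) := by
  refine Finset.sum_image fun u hu u' hu' h => ?_
  by_contra hne
  have h1 : u' ∈ (insert v s).erase u :=
    Finset.mem_erase.2 ⟨Ne.symm hne, Finset.mem_insert_of_mem hu'⟩
  rw [h] at h1
  exact Finset.notMem_erase _ _ h1

namespace Gluable

variable {Z : FiniteComplex V} {m : ℕ} {s : Finset V} {v : V} (h : Z.Gluable m s v)
include h

theorem card_insert : (insert v s).card = m + 1 := by
  rw [Finset.card_insert_of_notMem h.notMem, h.card_eq]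

theorem mem_of_mem_newFacets {r : Finset V} (hr : r ∈ newFacets s v) : v ∈ r := by
  obtain ⟨u, hu, rfl⟩ := Finset.mem_image.1 hr
  exact Finset.mem_erase.2 ⟨fun e => h.notMem (e ▸ hu), Finset.mem_insert_self _ _⟩

theorem mem_glue_of_notMem {t : Finset V} (hvt : v ∉ t) :
    t ∈ (Z.glue s v).faces ↔ t ∈ Z.faces := by
  refine ⟨?_, Or.inl⟩
  rintro (ht | ⟨hne, hts⟩)
  · exact ht
  · exact face_subset h.boundary.1 ((Finset.subset_insert_iff_of_notMem hvt).1 hts) hne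

theorem cells_top : (Z.glue s v).cells (m + 1) = insert (insert v s) (Z.cells (m + 1)) := by
  ext t
  simp only [Finset.mem_insert, mem_cells]
  constructor
  · rintro ⟨ht | ⟨-, hts⟩, hc⟩
    · exact Or.inr ⟨ht, hc⟩
    · exact Or.inl (Finset.eq_of_subset_of_card_le hts (by rw [h.card_insert, hc]))
  · rintro (rfl | ⟨ht, hc⟩)
    · exact ⟨Or.inr ⟨Finset.insert_nonempty _ _, subset_rfl⟩, h.card_insert⟩
    · exact ⟨Or.inl ht, hc⟩

theorem insert_notMem_cells (j : ℕ) : insert v s ∉ Z.cells j := fun hc =>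
  h.fresh _ (mem_cells.1 hc).1 (Finset.mem_insert_self _ _)

theorem cells_facets : (Z.glue s v).cells m = Z.cells m ∪ newFacets s v := by
  ext t
  rw [Finset.mem_union]
  simp only [mem_cells]
  constructor
  · rintro ⟨ht, hc⟩
    by_cases hv : v ∈ t
    · right
      rcases ht with ht | ⟨-, hts⟩
      · exact absurd hv (h.fresh t ht)
      · obtain ⟨u, hu, hut⟩ : ∃ u ∈ insert v s, u ∉ t := by
          by_contra! hcon
          have := Finset.card_le_card (show insert v s ⊆ t from hcon)
          rw [h.card_insert, hc] at this
          omega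
        refine Finset.mem_image.2 ⟨u, ?_, ?_⟩
        · exact (Finset.mem_insert.1 hu).resolve_left fun e => hut (e ▸ hv)
        · refine (Finset.eq_of_subset_of_card_le (fun x hx => ?_) ?_).symm
          · exact Finset.mem_erase.2 ⟨fun e => hut (e ▸ hx), hts hx⟩
          · rw [Finset.card_erase_of_mem hu, h.card_insert, hc]; rfl
    · exact Or.inl ⟨(h.mem_glue_of_notMem hv).1 ht, hc⟩
  · rintro (⟨ht, hc⟩ | ht)
    · exact ⟨Or.inl ht, hc⟩
    · have hvt := h.mem_of_mem_newFacets ht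
      obtain ⟨u, hu, rfl⟩ := Finset.mem_image.1 ht
      refine ⟨Or.inr ⟨⟨v, hvt⟩, Finset.erase_subset _ _⟩, ?_⟩
      rw [Finset.card_erase_of_mem (Finset.mem_insert_of_mem hu), h.card_insert]; rfl

theorem disjoint_newFacets {C : Finset (Finset V)} (hC : ∀ t ∈ C, t ∈ Z.faces) :
    Disjoint C (newFacets s v) :=
  Finset.disjoint_left.2 fun t ht ht' => h.fresh t (hC t ht) (h.mem_of_mem_newFacets ht')

theorem isBoundaryFace_iff (r : Finset V) : (Z.glue s v).IsBoundaryFace m r ↔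
    (Z.IsBoundaryFace m r ∧ r ≠ s) ∨ r ∈ newFacets s v := by
  have htop : ∀ t, (t ∈ (Z.glue s v).faces ∧ t.card = m + 1) ↔
      t = insert v s ∨ (t ∈ Z.faces ∧ t.card = m + 1) := fun t => by
    rw [← mem_cells, h.cells_top, Finset.mem_insert, mem_cells]
  have hfac : (r ∈ (Z.glue s v).faces ∧ r.card = m) ↔
      (r ∈ Z.faces ∧ r.card = m) ∨ r ∈ newFacets s v := by
    rw [← mem_cells, h.cells_facets, Finset.mem_union, mem_cells]
  have hnew : ∀ {r : Finset V}, r ∈ Z.faces → r.card = m → r ⊆ insert v s → r = s := by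
    intro r hr hc hrs
    exact Finset.eq_of_subset_of_card_le
      ((Finset.subset_insert_iff_of_notMem (h.fresh r hr)).1 hrs) (by rw [hc, h.card_eq])
  constructor
  · rintro ⟨hr, hc, t, ⟨ht, htc, hrt⟩, huniq⟩
    rcases hfac.1 ⟨hr, hc⟩ with ⟨hr', -⟩ | hr'
    · left
      have hrs : r ≠ s := by
        rintro rfl
        obtain ⟨t₀, ⟨ht₀, hc₀, hst₀⟩, -⟩ := h.boundary.2.2
        have h1 := huniq t₀ ⟨Or.inl ht₀, hc₀, hst₀⟩
        have h2 := huniq (insert v r) ⟨((htop _).2 (Or.inl rfl)).1, h.card_insert,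
          Finset.subset_insert _ _⟩
        exact h.fresh t₀ ht₀ (by rw [h1, ← h2]; exact Finset.mem_insert_self _ _)
      refine ⟨⟨hr', hc, t, ⟨?_, htc, hrt⟩, ?_⟩, hrs⟩
      · rcases (htop t).1 ⟨ht, htc⟩ with rfl | ht'
        · exact absurd (hnew hr' hc hrt) hrs
        · exact ht'.1
      · rintro t' ⟨ht', hc', hrt'⟩
        exact huniq t' ⟨Or.inl ht', hc', hrt'⟩
    · exact Or.inr hr'
  · rintro (⟨⟨hr, hc, t, ⟨ht, htc, hrt⟩, huniq⟩, hrs⟩ | hr)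
    · refine ⟨Or.inl hr, hc, t, ⟨Or.inl ht, htc, hrt⟩, ?_⟩
      rintro t' ⟨ht', hc', hrt'⟩
      rcases (htop t').1 ⟨ht', hc'⟩ with rfl | ht''
      · exact absurd (hnew hr hc hrt') hrs
      · exact huniq t' ⟨ht''.1, hc', hrt'⟩
    · obtain ⟨hr1, hr2⟩ := hfac.2 (Or.inr hr)
      have hvr := h.mem_of_mem_newFacets hr
      refine ⟨hr1, hr2, insert v s, ⟨((htop _).2 (Or.inl rfl)).1, h.card_insert, ?_⟩, ?_⟩
      · obtain ⟨u, -, rfl⟩ := Finset.mem_image.1 hr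
        exact Finset.erase_subset _ _
      · rintro t' ⟨ht', hc', hrt'⟩
        rcases (htop t').1 ⟨ht', hc'⟩ with rfl | ht''
        · rfl
        · exact absurd (hrt' hvr) (h.fresh t' ht''.1)

theorem bdry_glue : (Z.glue s v).bdry m = (Z.bdry m).erase s ∪ newFacets s v := by
  ext r
  rw [mem_bdry, h.isBoundaryFace_iff, Finset.mem_union, Finset.mem_erase, mem_bdry, and_comm]

theorem card_le_glue : ∀ t ∈ (Z.glue s v).faces, t.card ≤ m + 1 := by
  rintro t (ht | ⟨-, ht⟩)
  · exact h.card_le t ht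
  · exact (Finset.card_le_card ht).trans h.card_insert.le

variable {F : Type*} [CommRing F]

theorem sum_cells_top {M : Type*} [AddCommMonoid M] (f : Finset V → M) :
    ∑ t ∈ (Z.glue s v).cells (m + 1), f t = f (insert v s) + ∑ t ∈ Z.cells (m + 1), f t := by
  rw [h.cells_top, Finset.sum_insert (h.insert_notMem_cells _)]

theorem sum_cells_facets {M : Type*} [AddCommMonoid M] (f : Finset V → M) :
    ∑ r ∈ (Z.glue s v).cells m, f r =
      ∑ r ∈ Z.cells m, f r + ∑ u ∈ s, f ((insert v s).erase u) := by
  rw [h.cells_facets, Finset.sum_union (h.disjoint_newFacets fun t ht => (mem_cells.1 ht).1),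
    sum_newFacets]

theorem sum_bdry_glue {M : Type*} [AddCommGroup M] (f : Finset V → M) :
    ∑ r ∈ (Z.glue s v).bdry m, f r =
      ∑ r ∈ Z.bdry m, f r - f s + ∑ u ∈ s, f ((insert v s).erase u) := by
  rw [h.bdry_glue, Finset.sum_union (h.disjoint_newFacets fun t ht =>
    (mem_bdry.1 (Finset.mem_of_mem_erase ht)).1), sum_newFacets,
    Finset.sum_erase_eq_sub (mem_bdry.2 h.boundary)]

theorem acyclic_glue (hac : Z.Acyclic F m) : (Z.glue s v).Acyclic F m := by
  classical
  intro φ hφ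
  obtain ⟨ψ, hψ⟩ := hac φ fun t ht => hφ t (by rw [h.cells_top]; exact Finset.mem_insert_of_mem ht)
  obtain ⟨a, ha⟩ := face_nonempty h.boundary.1
  let θ : Finset V → F := fun r => φ r - cobd ψ r
  have hθZ : ∀ r ∈ Z.cells m, θ r = 0 := fun r hr => by simp only [θ]; rw [hψ r hr, sub_self]
  have hT : cobd θ (insert v s) = 0 := by
    rw [cobd_sub, cobd_cobd, hφ _ (by rw [h.cells_top]; exact Finset.mem_insert_self _ _), sub_zero]
  obtain ⟨χ, hχ, hχ0⟩ := exists_cobd_eq_on_facets (Finset.mem_insert_of_mem ha) hT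
  -- `χ` vanishes on the sets without `v`, because `θ` vanishes on the facet `s`.
  have hχv : ∀ q, v ∉ q → χ q = 0 ∨ q.card + 1 ≠ m := by
    intro q hvq
    by_contra! hcon
    obtain ⟨haq, hsub, hne⟩ := hχ0 q hcon.1
    have hva : v ≠ a := fun e => h.notMem (e ▸ ha)
    have hv' : v ∉ insert a q := by simp [hva, hvq]
    have : insert a q = s := Finset.eq_of_subset_of_card_le
      ((Finset.subset_insert_iff_of_notMem hv').1 hsub)
      (by rw [h.card_eq, Finset.card_insert_of_notMem haq, hcon.2])
    exact hne (by rw [this]; exact hθZ s (mem_cells.2 ⟨h.boundary.1, h.card_eq⟩))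
  refine ⟨fun q => ψ q + χ q, fun r hr => ?_⟩
  rw [cobd_add]
  rw [h.cells_facets, Finset.mem_union] at hr
  rcases hr with hr | hr
  · rw [hψ r hr, cobd_eq_zero, add_zero]
    intro u hu
    have hr' := mem_cells.1 hr
    refine (hχv _ fun hv => h.fresh r hr'.1 (Finset.mem_of_mem_erase hv)).resolve_right ?_
    rw [not_not, Finset.card_erase_add_one hu, hr'.2]
  · obtain ⟨u, hu, rfl⟩ := Finset.mem_image.1 hr
    rw [hχ u (Finset.mem_insert_of_mem hu)]
    simp only [θ]
    ring

theorem bd_glue (g : Finset V → F) (r : Finset V) : (Z.glue s v).bd (m + 1) g r =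
    incidence F r (insert v s) * g (insert v s) + Z.bd (m + 1) g r := by
  rw [bd, h.sum_cells_top]; rfl

/-- Gluing a simplex preserves the estimate `‖∂ g‖² ≥ c ‖g‖² + ‖∂ g|_{boundary}‖² / a`, where
`a² = m` and `c = (a - 1)²`: by `2 |x y| ≤ x² / a + a y²`, the boundary term at `s` pays
for the interaction of the new simplex with its neighbour. -/
theorem energy_glue {a : ℝ} (ha : 0 < a) (ham : a ^ 2 = m)
    (hE : ∀ g : Finset V → ℝ, (a - 1) ^ 2 * ∑ t ∈ Z.cells (m + 1), g t ^ 2 +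
      a⁻¹ * ∑ r ∈ Z.bdry m, Z.bd (m + 1) g r ^ 2 ≤ ∑ r ∈ Z.cells m, Z.bd (m + 1) g r ^ 2)
    (g : Finset V → ℝ) :
    (a - 1) ^ 2 * ∑ t ∈ (Z.glue s v).cells (m + 1), g t ^ 2 +
      a⁻¹ * ∑ r ∈ (Z.glue s v).bdry m, (Z.glue s v).bd (m + 1) g r ^ 2 ≤
      ∑ r ∈ (Z.glue s v).cells m, (Z.glue s v).bd (m + 1) g r ^ 2 := by
  set y := g (insert v s) with hy
  have hold : ∀ r ∈ Z.cells m, r ≠ s → (Z.glue s v).bd (m + 1) g r = Z.bd (m + 1) g r := by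
    intro r hr hrs
    rw [h.bd_glue, incidence_eq_zero_of_not_subset, zero_mul, zero_add]
    intro hsub
    have hr' := mem_cells.1 hr
    exact hrs (Finset.eq_of_subset_of_card_le
      ((Finset.subset_insert_iff_of_notMem (h.fresh r hr'.1)).1 hsub) (by rw [hr'.2, h.card_eq]))
  have hnew : ∀ u ∈ s, (Z.glue s v).bd (m + 1) g ((insert v s).erase u) ^ 2 = y ^ 2 := by
    intro u hu
    have h0 : Z.bd (m + 1) g ((insert v s).erase u) = 0 := Finset.sum_eq_zero fun t ht => by
      rw [incidence_eq_zero_of_not_subset, zero_mul]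
      exact fun hsub => h.fresh t (mem_cells.1 ht).1
        (hsub (h.mem_of_mem_newFacets (Finset.mem_image_of_mem _ hu)))
    rw [h.bd_glue, h0, add_zero, mul_pow, incidence_erase_sq (Finset.mem_insert_of_mem hu), one_mul]
  have hs : s ∈ Z.cells m := mem_cells.2 ⟨h.boundary.1, h.card_eq⟩
  set ε := incidence ℝ s (insert v s)
  have hε : ε ^ 2 = 1 := incidence_insert_sq h.notMem
  set x := Z.bd (m + 1) g s with hx
  have hsnew : (Z.glue s v).bd (m + 1) g s = ε * y + x := h.bd_glue g s
  have hsumnew : ∑ u ∈ s, (Z.glue s v).bd (m + 1) g ((insert v s).erase u) ^ 2 = m * y ^ 2 := by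
    rw [Finset.sum_congr rfl hnew, Finset.sum_const, h.card_eq, nsmul_eq_mul]
  have hcells : ∑ r ∈ Z.cells m, (Z.glue s v).bd (m + 1) g r ^ 2 =
      ∑ r ∈ Z.cells m, Z.bd (m + 1) g r ^ 2 - x ^ 2 + (ε * y + x) ^ 2 := by
    rw [← Finset.sum_erase_add _ _ hs, ← Finset.sum_erase_add (Z.cells m) _ hs, hsnew, ← hx,
      Finset.sum_congr rfl fun r hr => by
        rw [hold r (Finset.mem_of_mem_erase hr) (Finset.ne_of_mem_erase hr)]]
    ring
  have hb : ∑ r ∈ Z.bdry m, (Z.glue s v).bd (m + 1) g r ^ 2 =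
      ∑ r ∈ Z.bdry m, Z.bd (m + 1) g r ^ 2 - x ^ 2 + (ε * y + x) ^ 2 := by
    have hs' : s ∈ Z.bdry m := mem_bdry.2 h.boundary
    rw [← Finset.sum_erase_add _ _ hs', ← Finset.sum_erase_add (Z.bdry m) _ hs', hsnew, ← hx,
      Finset.sum_congr rfl fun r hr => by
        have hr' := mem_bdry.1 (Finset.mem_of_mem_erase hr)
        rw [hold r (mem_cells.2 ⟨hr'.1, hr'.2.1⟩) (Finset.ne_of_mem_erase hr)]]
    ring
  rw [h.sum_cells_top, h.sum_cells_facets, h.sum_bdry_glue, hsumnew, hcells, hb, hsnew, ← hy]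
  have hEg := hE g
  set A := ∑ t ∈ Z.cells (m + 1), g t ^ 2
  set B := ∑ r ∈ Z.bdry m, Z.bd (m + 1) g r ^ 2
  set C := ∑ r ∈ Z.cells m, Z.bd (m + 1) g r ^ 2
  have hai : a⁻¹ * a = 1 := inv_mul_cancel₀ ha.ne'
  have hsq : 0 ≤ a⁻¹ * (x + a * (ε * y)) ^ 2 := by positivity
  have e1 : a⁻¹ * (x + a * (ε * y)) ^ 2 = a⁻¹ * x ^ 2 + 2 * (ε * y) * x + a * y ^ 2 := by
    linear_combination (2 * ε * y * x + a * y ^ 2 * ε ^ 2) * hai + a * y ^ 2 * hε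
  have e2 : (ε * y + x) ^ 2 = y ^ 2 + 2 * (ε * y) * x + x ^ 2 := by
    linear_combination y ^ 2 * hε
  have e3 : a⁻¹ * (B - x ^ 2 + (ε * y + x) ^ 2 - (ε * y + x) ^ 2 + m * y ^ 2) =
      a⁻¹ * B - a⁻¹ * x ^ 2 + a * y ^ 2 := by
    linear_combination a * y ^ 2 * hai - a⁻¹ * y ^ 2 * ham
  rw [e3, e2, ← ham]
  linarith

theorem parity_glue
    (hP : ∀ φ : Finset V → ZMod 2, ∑ t ∈ Z.cells (m + 1), cobd φ t = ∑ r ∈ Z.bdry m, φ r)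
    (φ : Finset V → ZMod 2) : ∑ t ∈ (Z.glue s v).cells (m + 1), cobd φ t =
      ∑ r ∈ (Z.glue s v).bdry m, φ r := by
  rw [h.sum_cells_top, h.sum_bdry_glue, hP, cobd_zmod_two, Finset.sum_insert h.notMem,
    Finset.erase_insert h.notMem, CharTwo.sub_eq_add]
  ring

/-- Suppose that every `m`-simplex of `Z` has a filling that touches the boundary of `Z` in at most
one face `r`, of size at most `k` if `r` is a face of `X` and at most `k + 1` otherwise. Then this also
holds after gluing a simplex to a face of `X`: the fillings with `r = s` are continued through
the new simplex to one of its other facets, which is not a face of `X`. -/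
theorem fills_glue {X : FiniteComplex V} {k : ℕ} (hXv : ∀ t ∈ X.faces, v ∉ t) (hsX : s ∈ X.faces)
    (hfill : ∀ t ∈ Z.cells (m + 1), ∃ (φ : Finset V → F) (r : Finset V), Z.Fills m φ t ∧
      Z.IsBoundaryFace m r ∧ (∀ r', Z.IsBoundaryFace m r' → φ r' ≠ 0 → r' = r) ∧
      (r ∈ X.faces → (Z.supp m φ).card ≤ k) ∧ (Z.supp m φ).card ≤ k + 1) :
    ∀ t ∈ (Z.glue s v).cells (m + 1), ∃ (φ : Finset V → F) (r : Finset V),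
      (Z.glue s v).Fills m φ t ∧ (Z.glue s v).IsBoundaryFace m r ∧
      (∀ r', (Z.glue s v).IsBoundaryFace m r' → φ r' ≠ 0 → r' = r) ∧
      (r ∈ X.faces → ((Z.glue s v).supp m φ).card ≤ k) ∧
      ((Z.glue s v).supp m φ).card ≤ k + 1 := by
  classical
  obtain ⟨u, hu⟩ := face_nonempty h.boundary.1
  set T := insert v s with hT
  have huT : u ∈ T := Finset.mem_insert_of_mem hu
  have hnew : T.erase u ∈ newFacets s v := Finset.mem_image_of_mem _ hu
  have hvnew := h.mem_of_mem_newFacets hnew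
  have hnewX : T.erase u ∉ X.faces := fun hX => hXv _ hX hvnew
  intro t ht
  rw [h.cells_top, Finset.mem_insert] at ht
  rcases ht with rfl | ht
  · refine ⟨fun r => if r = T.erase u then 1 else 0, T.erase u, ⟨?_, ?_⟩,
      (h.isBoundaryFace_iff _).2 (Or.inr hnew), ?_, fun hX => absurd hX hnewX, ?_⟩
    · exact incidence_erase_sq huT
    · intro τ hτ hne
      rw [h.cells_top, Finset.mem_insert] at hτ
      exact incidence_eq_zero_of_not_subset fun hsub =>
        h.fresh τ (mem_cells.1 (hτ.resolve_left hne)).1 (hsub hvnew)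
    · intro r' _ hr'
      by_contra hne
      exact hr' (if_neg hne)
    · refine (Finset.card_le_one.2 fun a ha b hb => ?_).trans (Nat.le_add_left 1 k)
      simp only [mem_supp, ne_eq, ite_eq_right_iff, not_forall] at ha hb
      rw [ha.2.choose, hb.2.choose]
  · obtain ⟨φ, r, hφ, hr, huniq, hk, hk1⟩ := hfill t ht
    let b : F := -(faceSign F u T * faceSign F v T * φ s)
    let φ' : Finset V → F := fun q => if v ∉ q then φ q else if q = T.erase u then b else 0
    have hold : ∀ q, v ∉ q → φ' q = φ q := fun q hq => if_pos hq
    have hφ'u : φ' (T.erase u) = b := (if_neg (not_not.2 hvnew)).trans (if_pos rfl)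
    have hcobd : ∀ τ ∈ Z.cells (m + 1), cobd φ' τ = cobd φ τ := fun τ hτ =>
      cobd_congr fun w _ => hold _ fun hv =>
        h.fresh τ (mem_cells.1 hτ).1 (Finset.mem_of_mem_erase hv)
    have hcobdT : cobd φ' T = 0 := by
      rw [hT, cobd_insert _ h.notMem, hold s h.notMem, Finset.sum_eq_single_of_mem u hu]
      · have : insert v (s.erase u) = T.erase u := by
          rw [hT, Finset.erase_insert_of_ne (by rintro rfl; exact h.notMem hu)]
        rw [this, hφ'u, ← hT]
        linear_combination -(faceSign F v T * φ s) * faceSign_mul_self (F := F) u T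
      · intro w hw hwu
        have : insert v (s.erase w) = T.erase w := by
          rw [hT, Finset.erase_insert_of_ne (by rintro rfl; exact h.notMem hw)]
        have h0 : φ' (T.erase w) = 0 := by
          simp only [φ']
          rw [if_neg (not_not.2 (h.mem_of_mem_newFacets (Finset.mem_image_of_mem _ hw))), if_neg]
          intro e
          have : w ∈ T.erase u := Finset.mem_erase.2 ⟨hwu, Finset.mem_insert_of_mem hw⟩
          rw [← e] at this
          exact Finset.notMem_erase _ _ this
        rw [this, h0, mul_zero]
    have htT : T ≠ t := fun e => h.insert_notMem_cells _ (by rw [← hT, e]; exact ht)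
    have hfills : (Z.glue s v).Fills m φ' t := by
      refine ⟨by rw [hcobd t ht, hφ.1], fun τ hτ hne => ?_⟩
      rw [h.cells_top, Finset.mem_insert] at hτ
      rcases hτ with rfl | hτ
      · exact hcobdT
      · rw [hcobd τ hτ, hφ.2 τ hτ hne]
    have hsupp : ∀ q ∈ (Z.glue s v).supp m φ', q ∈ Z.supp m φ ∨ (q = T.erase u ∧ b ≠ 0) := by
      intro q hq
      rw [mem_supp, h.cells_facets, Finset.mem_union] at hq
      obtain ⟨hq | hq, hne⟩ := hq
      · left
        rw [hold q (h.fresh q (mem_cells.1 hq).1)] at hne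
        exact mem_supp.2 ⟨hq, hne⟩
      · right
        simp only [φ'] at hne
        rw [if_neg (not_not.2 (h.mem_of_mem_newFacets hq))] at hne
        split_ifs at hne with hqu
        · exact ⟨hqu, hne⟩
        · exact absurd rfl hne
    by_cases hrs : r = s
    · subst hrs
      have hcard : ((Z.glue r v).supp m φ').card ≤ k + 1 := by
        refine (Finset.card_le_card (t := insert (T.erase u) (Z.supp m φ)) fun q hq => ?_).trans
          ((Finset.card_insert_le _ _).trans (Nat.succ_le_succ (hk hsX)))
        rcases hsupp q hq with hq | hq
        · exact Finset.mem_insert_of_mem hq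
        · exact Finset.mem_insert.2 (Or.inl hq.1)
      refine ⟨φ', T.erase u, hfills, (h.isBoundaryFace_iff _).2 (Or.inr hnew), ?_,
        fun hX => absurd hX hnewX, hcard⟩
      intro r' hr' hne
      have hmem : r' ∈ (Z.glue r v).supp m φ' := mem_supp.2 ⟨mem_cells.2 ⟨hr'.1, hr'.2.1⟩, hne⟩
      rcases hsupp r' hmem with hmem' | hmem'
      · rcases (h.isBoundaryFace_iff _).1 hr' with hold' | hnew'
        · exact absurd (huniq r' hold'.1 (mem_supp.1 hmem').2) hold'.2
        · exact absurd (h.mem_of_mem_newFacets hnew')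
            (h.fresh r' (mem_cells.1 (mem_supp.1 hmem').1).1)
      · exact hmem'.1
    · have hφs : φ s = 0 := by
        by_contra hne
        exact hrs (huniq s h.boundary hne).symm
      have hb : b = 0 := by simp only [b, hφs, mul_zero, neg_zero]
      have hsub : (Z.glue s v).supp m φ' ⊆ Z.supp m φ := fun q hq =>
        (hsupp q hq).resolve_right fun hq' => hq'.2 hb
      refine ⟨φ', r, hfills, (h.isBoundaryFace_iff _).2 (Or.inl ⟨hr, hrs⟩), ?_,
        fun hX => (Finset.card_le_card hsub).trans (hk hX), (Finset.card_le_card hsub).trans hk1⟩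
      intro r' hr' hne
      have hmem := hsub (mem_supp.2 ⟨mem_cells.2 ⟨hr'.1, hr'.2.1⟩, hne⟩)
      refine huniq r' ?_ (mem_supp.1 hmem).2
      rcases (h.isBoundaryFace_iff _).1 hr' with hold' | hnew'
      · exact hold'.1
      · exact absurd (h.mem_of_mem_newFacets hnew')
          (h.fresh r' (mem_cells.1 (mem_supp.1 hmem).1).1)

end Gluable

end Glue

/-! ### Gluing simplexes to all boundary faces -/

theorem lt_fresh {X : FiniteComplex ℕ} {s : Finset ℕ} (hs : s ∈ X.faces) {v : ℕ} (hv : v ∈ s) :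
    v < X.fresh :=
  Nat.lt_succ_of_le ((Finset.le_sup (f := id) hv).trans
    (Finset.le_sup (f := fun s : Finset ℕ => s.sup id) (X.finite_faces.mem_toFinset.2 hs)))

theorem fresh_notMem {X : FiniteComplex ℕ} {s : Finset ℕ} (hs : s ∈ X.faces) : X.fresh ∉ s :=
  fun h => (lt_fresh hs h).false

theorem apex_notMem {X : FiniteComplex ℕ} {s t : Finset ℕ} (ht : t ∈ X.faces) : X.apex s ∉ t :=
  fun h => absurd (lt_fresh ht h) (not_lt.2 (Nat.le_add_right _ _))

theorem apex_injective (X : FiniteComplex ℕ) : Function.Injective X.apex := fun _ _ h =>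
  Encodable.encode_injective (Nat.add_left_cancel h)

/-- `glueAll` is an iteration of `glue`: a property that is preserved by gluing a simplex to
a boundary face of `X`, with a new vertex, passes from `X` to `X.glueAll m`. Moreover, no face of
`X` is a boundary face of `X.glueAll m`. -/
theorem glueAll_induction {X : FiniteComplex ℕ} {m : ℕ} (hdim : ∀ t ∈ X.faces, t.card ≤ m + 1)
    {P : FiniteComplex ℕ → Prop} (h0 : P X)
    (hstep : ∀ (Z : FiniteComplex ℕ) (s : Finset ℕ) (v : ℕ), Z.Gluable m s v → s ∈ X.faces →
      (∀ t ∈ X.faces, v ∉ t) → P Z → P (Z.glue s v)) :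
    P (X.glueAll m) ∧ (∀ t ∈ (X.glueAll m).faces, t.card ≤ m + 1) ∧
      ∀ s ∈ X.faces, ¬ (X.glueAll m).IsBoundaryFace m s := by
  have main : ∀ S : Finset (Finset ℕ), S ⊆ X.bdry m → ∃ Z : FiniteComplex ℕ,
      Z.faces = X.faces ∪ {t | t.Nonempty ∧ ∃ s ∈ S, t ⊆ insert (X.apex s) s} ∧ P Z ∧
      (∀ t ∈ Z.faces, t.card ≤ m + 1) ∧
      ∀ s ∈ X.faces, (Z.IsBoundaryFace m s ↔ X.IsBoundaryFace m s ∧ s ∉ S) := by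
    intro S
    induction S using Finset.induction_on with
    | empty => exact fun _ => ⟨X, by simp, h0, hdim, by simp⟩
    | insert s S hsS ih =>
      intro hS
      obtain ⟨Z, hZ, hP, hZdim, hZb⟩ := ih fun r hr => hS (Finset.mem_insert_of_mem hr)
      have hs : X.IsBoundaryFace m s := mem_bdry.1 (hS (Finset.mem_insert_self _ _))
      have hg : Z.Gluable m s (X.apex s) := by
        refine ⟨hZdim, (hZb s hs.1).2 ⟨hs, hsS⟩, fun t ht hvt => ?_⟩
        rw [hZ] at ht
        rcases ht with ht | ⟨-, r, hr, htr⟩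
        · exact apex_notMem ht hvt
        · rcases Finset.mem_insert.1 (htr hvt) with h | h
          · exact hsS (X.apex_injective h ▸ hr)
          · exact apex_notMem (mem_bdry.1 (hS (Finset.mem_insert_of_mem hr))).1 h
      refine ⟨Z.glue s (X.apex s), ?_, hstep Z s _ hg hs.1 (fun t ht => apex_notMem ht) hP,
        hg.card_le_glue, ?_⟩
      · ext t
        change t ∈ Z.faces ∨ t.Nonempty ∧ t ⊆ insert (X.apex s) s ↔ t ∈ X.faces ∨
          t.Nonempty ∧ ∃ r ∈ insert s S, t ⊆ insert (X.apex r) r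
        rw [hZ, Finset.exists_mem_insert]
        change (t ∈ X.faces ∨ t.Nonempty ∧ ∃ r ∈ S, t ⊆ insert (X.apex r) r) ∨ _ ↔ _
        constructor
        · rintro ((h | ⟨h, r, hr, htr⟩) | ⟨h, hts⟩)
          exacts [Or.inl h, Or.inr ⟨h, Or.inr ⟨r, hr, htr⟩⟩, Or.inr ⟨h, Or.inl hts⟩]
        · rintro (h | ⟨h, hts | ⟨r, hr, htr⟩⟩)
          exacts [Or.inl (Or.inl h), Or.inr ⟨h, hts⟩, Or.inl (Or.inr ⟨h, r, hr, htr⟩)]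
      · intro r hr
        rw [hg.isBoundaryFace_iff, hZb r hr, Finset.mem_insert, not_or]
        have : r ∉ newFacets s (X.apex s) := fun h => apex_notMem hr (hg.mem_of_mem_newFacets h)
        tauto
  obtain ⟨Z, hZ, hP, hd, hb⟩ := main (X.bdry m) subset_rfl
  obtain rfl : Z = X.glueAll m := ext_faces (by rw [hZ]; simp only [mem_bdry]; rfl)
  exact ⟨hP, hd, fun s hs h => ((hb s hs).1 h).2 (mem_bdry.2 ((hb s hs).1 h).1)⟩

/-! ### Stellar subdivision of a top-dimensional simplex -/

/-- `Z` has dimension at most `m`, `σ` is an `m`-simplex of `Z` and `w` is not a vertex of `Z`. -/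
structure Subdividable (Z : FiniteComplex ℕ) (m : ℕ) (σ : Finset ℕ) (w : ℕ) : Prop where
  card_le : ∀ t ∈ Z.faces, t.card ≤ m + 1
  mem : σ ∈ Z.faces
  card_eq : σ.card = m + 1
  fresh : ∀ t ∈ Z.faces, w ∉ t

theorem innerSimplexes_eq (X : FiniteComplex ℕ) (m c : ℕ) :
    X.innerSimplexes m c = (X.cells (m + 1)).filter (c ∈ ·) := by
  ext t
  simp [innerSimplexes, and_assoc]

namespace Subdividable

variable {Z : FiniteComplex ℕ} {m : ℕ} {σ : Finset ℕ} {w : ℕ} (h : Z.Subdividable m σ w)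
include h

theorem notMem : w ∉ σ := h.fresh σ h.mem

theorem ne_of_mem {u : ℕ} (hu : u ∈ σ) : u ≠ w := fun e => h.notMem (e ▸ hu)

theorem eq_of_subset {t : Finset ℕ} (ht : t ∈ Z.faces) (hσ : σ ⊆ t) : t = σ :=
  (Finset.eq_of_subset_of_card_le hσ (by rw [h.card_eq]; exact h.card_le t ht)).symm

theorem insert_erase {u : ℕ} (hu : u ∈ σ) : insert w (σ.erase u) = (insert w σ).erase u :=
  (Finset.erase_insert_of_ne (h.ne_of_mem hu).symm).symm

theorem mem_stellarAt_of_notMem {t : Finset ℕ} (hw : w ∉ t) :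
    t ∈ (Z.stellarAt σ w).faces ↔ t ∈ Z.faces ∧ t ≠ σ := by
  constructor
  · rintro (⟨ht, hσ⟩ | ⟨hne, u, hu, hsub⟩)
    · exact ⟨ht, fun e => hσ e.ge⟩
    · have hsub' := (Finset.subset_insert_iff_of_notMem hw).1 hsub
      refine ⟨face_subset h.mem (hsub'.trans (Finset.erase_subset _ _)) hne, ?_⟩
      rintro rfl
      exact Finset.notMem_erase u t (hsub' hu)
  · rintro ⟨ht, hne⟩
    exact Or.inl ⟨ht, fun hσ => hne (h.eq_of_subset ht hσ)⟩

theorem mem_stellarAt_of_mem {t : Finset ℕ} (hw : w ∈ t) :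
    t ∈ (Z.stellarAt σ w).faces ↔ ∃ u ∈ σ, t ⊆ (insert w σ).erase u := by
  constructor
  · rintro (⟨ht, -⟩ | ⟨-, u, hu, hsub⟩)
    · exact absurd hw (h.fresh t ht)
    · exact ⟨u, hu, h.insert_erase hu ▸ hsub⟩
  · rintro ⟨u, hu, hsub⟩
    exact Or.inr ⟨⟨w, hw⟩, u, hu, (h.insert_erase hu).symm ▸ hsub⟩

theorem mem_of_mem_newFacets {t : Finset ℕ} (ht : t ∈ newFacets σ w) : w ∈ t := by
  obtain ⟨u, hu, rfl⟩ := Finset.mem_image.1 ht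
  exact Finset.mem_erase.2 ⟨(h.ne_of_mem hu).symm, Finset.mem_insert_self _ _⟩

theorem card_insert_erase {u : ℕ} (hu : u ∈ σ) : ((insert w σ).erase u).card = m + 1 := by
  rw [Finset.card_erase_of_mem (Finset.mem_insert_of_mem hu),
    Finset.card_insert_of_notMem h.notMem, h.card_eq]
  rfl

theorem cells_top : (Z.stellarAt σ w).cells (m + 1) =
    (Z.cells (m + 1)).erase σ ∪ newFacets σ w := by
  ext t
  rw [Finset.mem_union, Finset.mem_erase, mem_cells, mem_cells]
  by_cases hw : w ∈ t
  · rw [h.mem_stellarAt_of_mem hw]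
    constructor
    · rintro ⟨⟨u, hu, hsub⟩, hc⟩
      right
      refine Finset.mem_image.2 ⟨u, hu, ?_⟩
      exact (Finset.eq_of_subset_of_card_le hsub (by rw [h.card_insert_erase hu, hc])).symm
    · rintro (⟨-, ht, -⟩ | ht)
      · exact absurd hw (h.fresh t ht)
      · obtain ⟨u, hu, rfl⟩ := Finset.mem_image.1 ht
        exact ⟨⟨u, hu, subset_rfl⟩, h.card_insert_erase hu⟩
  · rw [h.mem_stellarAt_of_notMem hw]
    have : t ∉ newFacets σ w := fun ht => hw (h.mem_of_mem_newFacets ht)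
    tauto

theorem insert_erase_mem_cells {u : ℕ} (hu : u ∈ σ) :
    (insert w σ).erase u ∈ (Z.stellarAt σ w).cells (m + 1) := by
  rw [h.cells_top]
  exact Finset.mem_union_right _ (Finset.mem_image_of_mem _ hu)

theorem disjoint_newFacets : Disjoint ((Z.cells (m + 1)).erase σ) (newFacets σ w) :=
  Finset.disjoint_left.2 fun t ht ht' =>
    h.fresh t (mem_cells.1 (Finset.mem_of_mem_erase ht)).1 (h.mem_of_mem_newFacets ht')

theorem mem_cells_top : σ ∈ Z.cells (m + 1) := mem_cells.2 ⟨h.mem, h.card_eq⟩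

theorem sum_cells_top {M : Type*} [AddCommGroup M] (f : Finset ℕ → M) :
    ∑ t ∈ (Z.stellarAt σ w).cells (m + 1), f t =
      ∑ t ∈ Z.cells (m + 1), f t - f σ + ∑ u ∈ σ, f ((insert w σ).erase u) := by
  rw [h.cells_top, Finset.sum_union h.disjoint_newFacets, sum_newFacets,
    Finset.sum_erase_eq_sub h.mem_cells_top]

theorem card_le_stellarAt : ∀ t ∈ (Z.stellarAt σ w).faces, t.card ≤ m + 1 := by
  intro t ht
  by_cases hw : w ∈ t
  · obtain ⟨u, hu, hsub⟩ := (h.mem_stellarAt_of_mem hw).1 ht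
    exact (Finset.card_le_card hsub).trans (h.card_insert_erase hu).le
  · exact h.card_le t ((h.mem_stellarAt_of_notMem hw).1 ht).1

theorem mem_cells_facets {r : Finset ℕ} (hr : r ∈ (Z.stellarAt σ w).cells m) (hw : w ∉ r) :
    r ∈ Z.cells m := by
  rw [mem_cells] at hr ⊢
  exact ⟨((h.mem_stellarAt_of_notMem hw).1 hr.1).1, hr.2⟩

theorem acyclic_stellarAt (hac : Z.Acyclic (ZMod 2) m) :
    (Z.stellarAt σ w).Acyclic (ZMod 2) m := by
  classical
  intro φ hφ
  let ψ₁ : Finset ℕ → ZMod 2 := fun q => if w ∉ q then φ (insert w q) else 0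
  let θ : Finset ℕ → ZMod 2 := fun r => φ r - cobd ψ₁ r
  have hθw : ∀ r, w ∈ r → θ r = 0 := by
    intro r hw
    have : cobd ψ₁ r = φ r := by
      rw [cobd_eq_single hw, faceSign_zmod_two, one_mul]
      · simp only [ψ₁]
        rw [if_pos (Finset.notMem_erase _ _), Finset.insert_erase hw]
      · intro u _ huw
        exact if_neg (not_not.2 (Finset.mem_erase.2 ⟨huw.symm, hw⟩))
    simp only [θ, this, sub_self]
  have hθ : ∀ t ∈ (Z.stellarAt σ w).cells (m + 1), cobd θ t = 0 := fun t ht => by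
    rw [cobd_sub, cobd_cobd, hφ t ht, sub_zero]
  have hθσ : ∀ u ∈ σ, θ (σ.erase u) = 0 := by
    intro u hu
    have h1 := hθ _ (h.insert_erase_mem_cells hu)
    have hw : w ∈ (insert w σ).erase u :=
      h.mem_of_mem_newFacets (Finset.mem_image_of_mem _ hu)
    rw [cobd_eq_single hw, faceSign_zmod_two, one_mul, Finset.erase_right_comm,
      Finset.erase_insert h.notMem] at h1
    · exact h1
    · intro x _ hxw
      exact hθw _ (Finset.mem_erase.2 ⟨hxw.symm, hw⟩)
  obtain ⟨ψ₂, hψ₂⟩ := hac θ (by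
    intro t ht
    by_cases htσ : t = σ
    · subst htσ
      exact cobd_eq_zero hθσ
    · refine hθ t ?_
      rw [h.cells_top]
      exact Finset.mem_union_left _ (Finset.mem_erase.2 ⟨htσ, ht⟩))
  obtain ⟨v, hv⟩ := face_nonempty h.mem
  -- The pullback of `ψ₂` under the simplicial map that sends `w` to `v`.
  let ψ₃ : Finset ℕ → ZMod 2 := fun q =>
    if w ∉ q then ψ₂ q else if v ∈ q then 0 else ψ₂ (insert v (q.erase w))
  have hψ₃ : ∀ q, w ∉ q → ψ₃ q = ψ₂ q := fun q hq => if_pos hq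
  refine ⟨fun q => ψ₁ q + ψ₃ q, fun r hr => ?_⟩
  suffices hsuff : cobd ψ₃ r = θ r by
    rw [cobd_add, hsuff]
    simp only [θ]
    ring
  by_cases hw : w ∈ r
  · rw [hθw r hw]
    obtain ⟨u, hu, hsub⟩ := (h.mem_stellarAt_of_mem hw).1 (mem_cells.1 hr).1
    have hrc := (mem_cells.1 hr).2
    obtain ⟨ρ, hwρ, rfl⟩ : ∃ ρ, w ∉ ρ ∧ insert w ρ = r :=
      ⟨r.erase w, Finset.notMem_erase _ _, Finset.insert_erase hw⟩
    rw [Finset.card_insert_of_notMem hwρ] at hrc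
    have hρσ : ρ ⊆ σ := fun x hx => by
      have := Finset.mem_of_mem_erase (hsub (Finset.mem_insert_of_mem hx))
      exact (Finset.mem_insert.1 this).resolve_left fun e => hwρ (e ▸ hx)
    have hterm : ∀ x ∈ ρ, ψ₃ (insert w (ρ.erase x)) =
        if v ∈ ρ.erase x then 0 else ψ₂ (insert v (ρ.erase x)) := by
      intro x _
      have h1 : v ∈ insert w (ρ.erase x) ↔ v ∈ ρ.erase x := by
        rw [Finset.mem_insert, or_iff_right (h.ne_of_mem hv)]
      have h2 : (insert w (ρ.erase x)).erase w = ρ.erase x :=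
        Finset.erase_insert fun hx => hwρ (Finset.mem_of_mem_erase hx)
      simp only [ψ₃, h1, h2]
      rw [if_neg (not_not.2 (Finset.mem_insert_self _ _))]
    rw [cobd_insert _ hwρ]
    simp only [faceSign_zmod_two, one_mul]
    rw [hψ₃ ρ hwρ, Finset.sum_congr rfl hterm]
    by_cases hvρ : v ∈ ρ
    · rw [Finset.sum_eq_single_of_mem v hvρ, if_neg (Finset.notMem_erase _ _),
        Finset.insert_erase hvρ, CharTwo.add_self_eq_zero]
      intro x _ hxv
      exact if_pos (Finset.mem_erase.2 ⟨hxv.symm, hvρ⟩)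
    · have h1 : ∀ x ∈ ρ, (if v ∈ ρ.erase x then 0 else ψ₂ (insert v (ρ.erase x))) =
          ψ₂ (insert v (ρ.erase x)) := fun x _ =>
        if_neg fun hx => hvρ (Finset.mem_of_mem_erase hx)
      rw [Finset.sum_congr rfl h1]
      have h2 := cobd_insert ψ₂ hvρ
      simp only [faceSign_zmod_two, one_mul] at h2
      rw [← h2]
      have hcard : (insert v ρ).card = m := by rw [Finset.card_insert_of_notMem hvρ, hrc]
      have hsubσ : insert v ρ ⊆ σ := Finset.insert_subset hv hρσ
      rw [hψ₂ _ (mem_cells.2 ⟨face_subset h.mem hsubσ (Finset.insert_nonempty _ _), hcard⟩)]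
      obtain ⟨x, hx, hxρ⟩ : ∃ x ∈ σ, x ∉ insert v ρ := by
        by_contra! hcon
        have := Finset.card_le_card (show σ ⊆ insert v ρ from hcon)
        rw [h.card_eq, hcard] at this
        omega
      have : insert v ρ = σ.erase x := by
        refine Finset.eq_of_subset_of_card_le (fun y hy => Finset.mem_erase.2
          ⟨fun e => hxρ (e ▸ hy), hsubσ hy⟩) ?_
        rw [Finset.card_erase_of_mem hx, h.card_eq, hcard]; rfl
      rw [this]
      exact hθσ x hx
  · rw [← hψ₂ r (h.mem_cells_facets hr hw)]
    exact cobd_congr fun x _ => hψ₃ _ fun hx => hw (Finset.mem_of_mem_erase hx)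

variable {F : Type*} [CommRing F]

/-- A chain with values `± 1` can be changed by the boundary of `σ ∪ {w}` to a chain with values
`± 1` on the subdivision, without changing its boundary. -/
theorem exists_chain {z : Finset ℕ → F} (hz : ∀ t ∈ Z.cells (m + 1), z t ^ 2 = 1) :
    ∃ z' : Finset ℕ → F, (∀ t ∈ (Z.stellarAt σ w).cells (m + 1), z' t ^ 2 = 1) ∧
      ∀ s, (Z.stellarAt σ w).bd (m + 1) z' s = Z.bd (m + 1) z s := by
  set T := insert w σ with hT
  let z' : Finset ℕ → F := fun τ =>
    if w ∉ τ then z τ else -(z σ * faceSign F w T * incidence F τ T)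
  have hold : ∀ t ∈ Z.cells (m + 1), z' t = z t := fun t ht =>
    if_pos (h.fresh t (mem_cells.1 ht).1)
  have hnew : ∀ u ∈ σ, z' (T.erase u) = -(z σ * faceSign F w T * faceSign F u T) := by
    intro u hu
    have hw : w ∈ T.erase u := h.mem_of_mem_newFacets (Finset.mem_image_of_mem _ hu)
    rw [← incidence_erase (Finset.mem_insert_of_mem hu)]
    exact if_neg (not_not.2 hw)
  refine ⟨z', ?_, fun s => ?_⟩
  · intro t ht
    rw [h.cells_top, Finset.mem_union] at ht
    rcases ht with ht | ht
    · have ht' := Finset.mem_of_mem_erase ht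
      rw [hold t ht', hz t ht']
    · obtain ⟨u, hu, rfl⟩ := Finset.mem_image.1 ht
      rw [hnew u hu, neg_sq, mul_pow, mul_pow, faceSign_sq, faceSign_sq, hz σ h.mem_cells_top]
      ring
  · rw [bd, h.sum_cells_top, bd, hold σ h.mem_cells_top,
      Finset.sum_congr rfl fun t ht => by rw [hold t ht]]
    have h0 : ∑ v ∈ T, faceSign F v T * incidence F s (T.erase v) = 0 :=
      cobd_cobd (fun r => if r = s then 1 else 0) T
    rw [hT, Finset.sum_insert h.notMem, Finset.erase_insert h.notMem, ← hT] at h0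
    have h1 : ∑ u ∈ σ, incidence F s (T.erase u) * z' (T.erase u) =
        -(z σ * faceSign F w T) * ∑ u ∈ σ, faceSign F u T * incidence F s (T.erase u) := by
      rw [Finset.mul_sum]
      exact Finset.sum_congr rfl fun u hu => by rw [hnew u hu]; ring
    rw [← hT, h1]
    linear_combination -(z σ * faceSign F w T) * h0 +
      z σ * incidence F s σ * faceSign_mul_self (F := F) w T

/-- A filling in `Z` that vanishes on the faces with the vertex `c` of `σ` becomes a filling in
the subdivision; the part `(σ \ {c}) ∪ {w}` takes the place of `σ`. -/
theorem fills_of_fills {c : ℕ} (hc : c ∈ σ) {φ : Finset ℕ → F} {t : Finset ℕ}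
    (hφ : Z.Fills m φ t) (hφc : ∀ s, c ∈ s → φ s = 0) (ht : t ∈ Z.cells (m + 1)) :
    ∃ φ' : Finset ℕ → F,
      (Z.stellarAt σ w).Fills m φ' (if t = σ then (insert w σ).erase c else t) ∧
      (∀ s, c ∈ s → φ' s = 0) ∧ ((Z.stellarAt σ w).supp m φ').card ≤ (Z.supp m φ).card := by
  let φ' : Finset ℕ → F := fun q => if w ∉ q then φ q else 0
  have hφ'w : ∀ q, w ∈ q → φ' q = 0 := fun q hq => if_neg (not_not.2 hq)
  have hold : ∀ τ ∈ Z.cells (m + 1), cobd φ' τ = cobd φ τ := fun τ hτ =>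
    cobd_congr fun x _ => if_pos fun hx =>
      h.fresh τ (mem_cells.1 hτ).1 (Finset.mem_of_mem_erase hx)
  have hnew : ∀ u ∈ σ, cobd φ' ((insert w σ).erase u) =
      faceSign F w ((insert w σ).erase u) * φ (σ.erase u) := by
    intro u hu
    have hw : w ∈ (insert w σ).erase u :=
      h.mem_of_mem_newFacets (Finset.mem_image_of_mem _ hu)
    rw [cobd_eq_single hw, Finset.erase_right_comm, Finset.erase_insert h.notMem]
    · congr 1
      exact if_pos fun hx => h.notMem (Finset.mem_of_mem_erase hx)
    · intro x _ hxw
      exact hφ'w _ (Finset.mem_erase.2 ⟨hxw.symm, hw⟩)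
  have hnew0 : ∀ u ∈ σ, u ≠ c → cobd φ' ((insert w σ).erase u) = 0 := fun u hu huc => by
    rw [hnew u hu, hφc _ (Finset.mem_erase.2 ⟨huc.symm, hc⟩), mul_zero]
  have hσ : cobd φ σ = faceSign F c σ * φ (σ.erase c) :=
    cobd_eq_single hc fun u _ huc => hφc _ (Finset.mem_erase.2 ⟨huc.symm, hc⟩)
  refine ⟨φ', ⟨?_, ?_⟩, ?_, ?_⟩
  · split_ifs with htσ
    · subst htσ
      have h1 := hφ.1
      rw [hσ, mul_pow, faceSign_sq] at h1
      rw [hnew c hc, mul_pow, faceSign_sq, h1]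
    · rw [hold t ht, hφ.1]
  · intro τ hτ hne
    rw [h.cells_top, Finset.mem_union] at hτ
    rcases hτ with hτ | hτ
    · obtain ⟨hτσ, hτ⟩ := Finset.mem_erase.1 hτ
      rw [hold τ hτ]
      refine hφ.2 τ hτ ?_
      rintro rfl
      exact hne (if_neg hτσ).symm
    · obtain ⟨u, hu, rfl⟩ := Finset.mem_image.1 hτ
      by_cases huc : u = c
      · subst huc
        have htσ : σ ≠ t := fun e => hne (if_pos e.symm).symm
        have h0 := hφ.2 σ h.mem_cells_top htσ
        rw [hσ] at h0
        have h1 : φ (σ.erase u) = 0 := by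
          linear_combination faceSign F u σ * h0 -
            φ (σ.erase u) * faceSign_mul_self (F := F) u σ
        rw [hnew u hu, h1, mul_zero]
      · exact hnew0 u hu huc
  · intro s hs
    simp only [φ', hφc s hs, ite_self]
  · refine Finset.card_le_card fun s hs => ?_
    rw [mem_supp] at hs ⊢
    have hw : w ∉ s := fun hw => hs.2 (hφ'w s hw)
    exact ⟨h.mem_cells_facets hs.1 hw, by rw [← show φ' s = φ s from if_pos hw]; exact hs.2⟩

/-- Suppose that every `m`-simplex of `Z` has a filling that vanishes on the faces with the vertex
`c`, of size at most `k + 1`, and at most `k` for the simplexes that belong to `Y` or do not contain `c`.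
Then this also holds after the subdivision of a simplex `σ` of `Y` with the vertex `c`: a new
simplex that contains `c` is adjacent to `(σ \ {c}) ∪ {w}`, which inherits the filling of `σ`. -/
theorem fills_stellarAt {Y : FiniteComplex ℕ} {k c : ℕ} (hYw : ∀ t ∈ Y.faces, w ∉ t)
    (hσY : σ ∈ Y.faces) (hc : c ∈ σ)
    (hfill : ∀ t ∈ Z.cells (m + 1), ∃ φ : Finset ℕ → F, Z.Fills m φ t ∧
      (∀ s, c ∈ s → φ s = 0) ∧ ((c ∈ t → t ∈ Y.faces) → (Z.supp m φ).card ≤ k) ∧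
      (Z.supp m φ).card ≤ k + 1) :
    ∀ t ∈ (Z.stellarAt σ w).cells (m + 1), ∃ φ : Finset ℕ → F, (Z.stellarAt σ w).Fills m φ t ∧
      (∀ s, c ∈ s → φ s = 0) ∧
      ((c ∈ t → t ∈ Y.faces) → ((Z.stellarAt σ w).supp m φ).card ≤ k) ∧
      ((Z.stellarAt σ w).supp m φ).card ≤ k + 1 := by
  classical
  set T := insert w σ with hT
  have hcT : c ∈ T := Finset.mem_insert_of_mem hc
  obtain ⟨φc, hφc, hφc0, hφck⟩ : ∃ φ : Finset ℕ → F, (Z.stellarAt σ w).Fills m φ (T.erase c) ∧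
      (∀ s, c ∈ s → φ s = 0) ∧ ((Z.stellarAt σ w).supp m φ).card ≤ k := by
    obtain ⟨φ, hφ, hφ0, hk, -⟩ := hfill σ h.mem_cells_top
    obtain ⟨φ', h1, h2, h3⟩ := h.fills_of_fills hc hφ hφ0 h.mem_cells_top
    rw [if_pos rfl] at h1
    exact ⟨φ', h1, h2, h3.trans (hk fun _ => hσY)⟩
  intro t ht
  have ht0 := ht
  rw [h.cells_top, Finset.mem_union] at ht
  rcases ht with ht | ht
  · obtain ⟨htσ, ht⟩ := Finset.mem_erase.1 ht
    obtain ⟨φ, hφ, hφ0, hk, hk1⟩ := hfill t ht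
    obtain ⟨φ', h1, h2, h3⟩ := h.fills_of_fills hc hφ hφ0 ht
    rw [if_neg htσ] at h1
    exact ⟨φ', h1, h2, fun hY => h3.trans (hk hY), h3.trans hk1⟩
  · have hwt := h.mem_of_mem_newFacets ht
    obtain ⟨u, hu, rfl⟩ := Finset.mem_image.1 ht
    rw [← hT] at hwt ht0 ⊢
    by_cases huc : u = c
    · subst huc
      exact ⟨φc, hφc, hφc0, fun _ => hφck, hφck.trans (Nat.le_succ k)⟩
    -- The face opposite to `c` is shared with `T \ {c}`, for which a filling is known.
    · have hct : c ∈ T.erase u := Finset.mem_erase.2 ⟨Ne.symm huc, hcT⟩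
      have huct : u ∈ T.erase c := Finset.mem_erase.2 ⟨huc, Finset.mem_insert_of_mem hu⟩
      set r := (T.erase u).erase c with hr
      have hr' : r = (T.erase c).erase u := Finset.erase_right_comm
      have hwr : w ∈ r := Finset.mem_erase.2 ⟨(h.ne_of_mem hc).symm, hwt⟩
      let e : Finset ℕ → F := fun q => if q = r then 1 else 0
      let x : F := cobd φc (T.erase c) * incidence F r (T.erase c)
      have hxc : cobd (fun q => e q - x * φc q) (T.erase c) = 0 := by
        rw [cobd_sub, cobd_mul_left]
        change incidence F r (T.erase c) - _ = 0
        simp only [x]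
        linear_combination -(incidence F r (T.erase c)) * hφc.1
      refine ⟨fun q => e q - x * φc q, ⟨?_, ?_⟩, ?_, ?_, ?_⟩
      · rw [cobd_sub, cobd_mul_left, hφc.2 _ ht0, mul_zero, sub_zero]
        · exact incidence_erase_sq hct
        · intro e
          rw [e] at hct
          exact Finset.notMem_erase _ _ hct
      · intro τ hτ hne
        by_cases hτc : τ = T.erase c
        · rw [hτc, hxc]
        · rw [cobd_sub, cobd_mul_left, hφc.2 τ hτ hτc, mul_zero, sub_zero]
          refine incidence_eq_zero_of_not_subset fun hsub => ?_
          rw [h.cells_top, Finset.mem_union] at hτ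
          rcases hτ with hτ | hτ
          · exact h.fresh τ (mem_cells.1 (Finset.mem_of_mem_erase hτ)).1 (hsub hwr)
          · obtain ⟨u', hu', rfl⟩ := Finset.mem_image.1 hτ
            have h1 : u' ≠ u := by rintro rfl; exact hne rfl
            have h2 : u' ≠ c := by rintro rfl; exact hτc rfl
            exact Finset.notMem_erase u' T (hsub (Finset.mem_erase.2
              ⟨h2, Finset.mem_erase.2 ⟨h1, Finset.mem_insert_of_mem hu'⟩⟩))
      · intro s hs
        have : s ≠ r := by rintro rfl; exact Finset.notMem_erase _ _ hs
        simp only [e, if_neg this, hφc0 s hs, mul_zero, sub_zero]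
      · intro hY
        exact absurd hwt (hYw _ (hY hct))
      · refine (Finset.card_le_card (t := insert r ((Z.stellarAt σ w).supp m φc))
          fun s hs => ?_).trans ((Finset.card_insert_le _ _).trans (Nat.succ_le_succ hφck))
        rw [Finset.mem_insert, mem_supp]
        rw [mem_supp] at hs
        by_contra! hcon
        refine hs.2 ?_
        simp only [e, if_neg hcon.1, hcon.2 hs.1, mul_zero, sub_zero]

theorem codegree_stellarAt
    (hcod : ∀ r : Finset ℕ, r.card = m → ((Z.cells (m + 1)).filter (r ⊆ ·)).card ≤ 2)
    (r : Finset ℕ) (hr : r.card = m) :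
    (((Z.stellarAt σ w).cells (m + 1)).filter (r ⊆ ·)).card ≤ 2 := by
  by_cases hw : w ∈ r
  · by_cases hrσ : r.erase w ⊆ σ
    · refine (Finset.card_le_card (t := (σ \ r.erase w).image fun u => (insert w σ).erase u)
        fun t ht => ?_).trans (Finset.card_image_le.trans ?_)
      · obtain ⟨ht, hrt⟩ := Finset.mem_filter.1 ht
        rw [h.cells_top, Finset.mem_union] at ht
        rcases ht with ht | ht
        · exact absurd (hrt hw) (h.fresh t (mem_cells.1 (Finset.mem_of_mem_erase ht)).1)
        · obtain ⟨u, hu, rfl⟩ := Finset.mem_image.1 ht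
          exact Finset.mem_image_of_mem _ (Finset.mem_sdiff.2 ⟨hu, fun hur =>
            Finset.notMem_erase _ _ (hrt (Finset.mem_of_mem_erase hur))⟩)
      · have h1 := Finset.card_sdiff_add_card_eq_card hrσ
        have h2 := Finset.card_erase_add_one hw
        rw [h.card_eq] at h1
        omega
    · rw [Finset.card_eq_zero.2]
      · exact Nat.zero_le _
      · refine Finset.filter_eq_empty_iff.2 fun t ht hrt => hrσ fun x hx => ?_
        rw [h.cells_top, Finset.mem_union] at ht
        rcases ht with ht | ht
        · exact absurd (hrt hw) (h.fresh t (mem_cells.1 (Finset.mem_of_mem_erase ht)).1)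
        · obtain ⟨u, hu, rfl⟩ := Finset.mem_image.1 ht
          obtain ⟨hxw, hxr⟩ := Finset.mem_erase.1 hx
          exact (Finset.mem_insert.1 (Finset.mem_of_mem_erase (hrt hxr))).resolve_left hxw
  -- At most one of the new simplexes contains `r`, and then `σ` does as well.
  · refine le_trans (Finset.card_le_card_of_injOn (fun t => if w ∈ t then σ else t) ?_ ?_)
      (hcod r hr)
    · intro t ht
      obtain ⟨ht, hrt⟩ := Finset.mem_filter.1 (Finset.mem_coe.1 ht)
      rw [h.cells_top, Finset.mem_union] at ht
      rw [Finset.mem_coe, Finset.mem_filter]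
      beta_reduce
      rcases ht with ht | ht
      · have ht' := Finset.mem_of_mem_erase ht
        rw [if_neg (h.fresh t (mem_cells.1 ht').1)]
        exact ⟨ht', hrt⟩
      · rw [if_pos (h.mem_of_mem_newFacets ht)]
        refine ⟨h.mem_cells_top, fun x hx => ?_⟩
        obtain ⟨u, hu, rfl⟩ := Finset.mem_image.1 ht
        exact (Finset.mem_insert.1 (Finset.mem_of_mem_erase (hrt hx))).resolve_left
          fun e => hw (e ▸ hx)
    · intro t ht t' ht' heq
      obtain ⟨ht, hrt⟩ := Finset.mem_filter.1 (Finset.mem_coe.1 ht)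
      obtain ⟨ht', hrt'⟩ := Finset.mem_filter.1 (Finset.mem_coe.1 ht')
      rw [h.cells_top, Finset.mem_union] at ht ht'
      simp only at heq
      rcases ht with ht | ht <;> rcases ht' with ht' | ht'
      · rwa [if_neg (h.fresh t (mem_cells.1 (Finset.mem_of_mem_erase ht)).1),
          if_neg (h.fresh t' (mem_cells.1 (Finset.mem_of_mem_erase ht')).1)] at heq
      · rw [if_neg (h.fresh t (mem_cells.1 (Finset.mem_of_mem_erase ht)).1),
          if_pos (h.mem_of_mem_newFacets ht')] at heq
        exact absurd heq (Finset.ne_of_mem_erase ht)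
      · rw [if_neg (h.fresh t' (mem_cells.1 (Finset.mem_of_mem_erase ht')).1),
          if_pos (h.mem_of_mem_newFacets ht)] at heq
        exact absurd heq.symm (Finset.ne_of_mem_erase ht')
      · obtain ⟨u, hu, rfl⟩ := Finset.mem_image.1 ht
        obtain ⟨u', hu', rfl⟩ := Finset.mem_image.1 ht'
        by_contra hne
        have huu' : u' ≠ u := by rintro rfl; exact hne rfl
        have hsub : r ⊆ (σ.erase u).erase u' := fun x hx => by
          refine Finset.mem_erase.2 ⟨fun e => ?_, Finset.mem_erase.2 ⟨fun e => ?_, ?_⟩⟩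
          · exact Finset.notMem_erase u' _ (e ▸ hrt' hx)
          · exact Finset.notMem_erase u _ (e ▸ hrt hx)
          · exact (Finset.mem_insert.1 (Finset.mem_of_mem_erase (hrt hx))).resolve_left
              fun e => hw (e ▸ hx)
        have h1 := Finset.card_le_card hsub
        have h2 := Finset.card_erase_add_one hu
        have h3 := Finset.card_erase_add_one (Finset.mem_erase.2 ⟨huu', hu'⟩)
        rw [h.card_eq] at h2
        omega

theorem card_innerSimplexes_stellarAt {c : ℕ} (hc : c ∈ σ) :
    ((Z.stellarAt σ w).innerSimplexes m c).card + 1 = (Z.innerSimplexes m c).card + m := by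
  have hcw := h.ne_of_mem hc
  have hsum : ∀ X : FiniteComplex ℕ, ((X.innerSimplexes m c).card : ℤ) =
      ∑ t ∈ X.cells (m + 1), if c ∈ t then 1 else 0 := fun X => by
    rw [innerSimplexes_eq, Finset.card_filter]
    push_cast
    rfl
  have h1 : ∑ u ∈ σ, (if c ∈ (insert w σ).erase u then (1 : ℤ) else 0) = m := by
    have h2 : ∀ u ∈ σ, (if c ∈ (insert w σ).erase u then (1 : ℤ) else 0) =
        1 - if c = u then 1 else 0 := fun u _ => by
      simp only [Finset.mem_erase, Finset.mem_insert_of_mem hc, and_true]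
      split_ifs <;> simp_all
    rw [Finset.sum_congr rfl h2, Finset.sum_sub_distrib, Finset.sum_ite_eq, if_pos hc,
      Finset.sum_const, h.card_eq]
    simp
  have h3 := hsum (Z.stellarAt σ w)
  rw [h.sum_cells_top, h1, ← hsum Z, if_pos hc] at h3
  omega

end Subdividable

/-- A property that is preserved by the subdivision of an `m`-simplex of `Y` with the vertex `c`, at
a new vertex, passes from `Y` to the subdivision along all `m`-simplexes with the vertex `c`. The
first argument of the property counts the subdivisions. None of the `m`-simplexes in question is
left at the end. -/
theorem stellarList_induction {Y : FiniteComplex ℕ} {m c : ℕ} (hm : 0 < m)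
    (hdim : ∀ t ∈ Y.faces, t.card ≤ m + 1) {P : ℕ → FiniteComplex ℕ → Prop} (h0 : P 0 Y)
    (hstep : ∀ (i : ℕ) (Z : FiniteComplex ℕ) (σ : Finset ℕ) (w : ℕ), Z.Subdividable m σ w →
      σ ∈ Y.faces → c ∈ σ → (∀ t ∈ Y.faces, w ∉ t) → P i Z → P (i + 1) (Z.stellarAt σ w)) :
    P (Y.innerSimplexes m c).card (Y.stellarList (Y.innerSimplexes m c).toList) ∧
      (∀ t ∈ (Y.stellarList (Y.innerSimplexes m c).toList).faces, t.card ≤ m + 1) ∧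
      ∀ t ∈ (Y.stellarList (Y.innerSimplexes m c).toList).faces, t.card = m + 1 → c ∈ t →
        t ∉ Y.faces := by
  have hmem : ∀ t, t ∈ (Y.innerSimplexes m c).toList ↔ t ∈ Y.faces ∧ t.card = m + 1 ∧ c ∈ t :=
    fun t => by simp [innerSimplexes]
  have main : ∀ l : List (Finset ℕ), l.Nodup → (∀ t ∈ l, t ∈ (Y.innerSimplexes m c).toList) →
      P l.length (Y.stellarList l) ∧ (∀ t ∈ (Y.stellarList l).faces, t.card ≤ m + 1) ∧
      (∀ x : ℕ, {x} ∈ Y.faces → {x} ∈ (Y.stellarList l).faces) ∧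
      ∀ t ∈ Y.faces, t.card = m + 1 → (t ∈ (Y.stellarList l).faces ↔ t ∉ l) := by
    intro l
    induction l with
    | nil => exact fun _ _ => ⟨h0, hdim, fun _ h => h, fun t ht _ => by simpa [stellarList]⟩
    | cons σ l ih =>
      intro hnd hl
      obtain ⟨hσl, hnd⟩ := List.nodup_cons.1 hnd
      obtain ⟨hP, hd, hx, ht⟩ := ih hnd fun t h => hl t (List.mem_cons_of_mem _ h)
      obtain ⟨hσY, hσc, hcσ⟩ := (hmem σ).1 (hl σ List.mem_cons_self)
      set Z := Y.stellarList l
      have hfr : ∀ t ∈ Z.faces, Z.fresh ∉ t := fun t ht => fresh_notMem ht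
      have hs : Z.Subdividable m σ Z.fresh := ⟨hd, (ht σ hσY hσc).2 hσl, hσc, hfr⟩
      have hYw : ∀ t ∈ Y.faces, Z.fresh ∉ t := fun t ht hw =>
        hfr _ (hx _ (face_subset ht (Finset.singleton_subset_iff.2 hw)
          (Finset.singleton_nonempty _))) (Finset.mem_singleton_self _)
      change P (l.length + 1) (Z.stellarAt σ Z.fresh) ∧
        (∀ t ∈ (Z.stellarAt σ Z.fresh).faces, t.card ≤ m + 1) ∧
        (∀ x : ℕ, {x} ∈ Y.faces → {x} ∈ (Z.stellarAt σ Z.fresh).faces) ∧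
        ∀ t ∈ Y.faces, t.card = m + 1 → (t ∈ (Z.stellarAt σ Z.fresh).faces ↔ t ∉ σ :: l)
      refine ⟨hstep _ Z σ _ hs hσY hcσ hYw hP, hs.card_le_stellarAt, fun x hxY => ?_,
        fun t htY htc => ?_⟩
      · refine (hs.mem_stellarAt_of_notMem (hYw _ hxY)).2 ⟨hx x hxY, fun e => ?_⟩
        rw [← e, Finset.card_singleton] at hσc
        omega
      · rw [hs.mem_stellarAt_of_notMem (hYw t htY), ht t htY htc, List.mem_cons, not_or, and_comm]
  obtain ⟨hP, hd, -, ht⟩ := main _ (Finset.nodup_toList _) fun _ h => h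
  rw [Finset.length_toList] at hP
  refine ⟨hP, hd, fun t htf htc hct htY => ?_⟩
  exact (ht t htY htc).1 htf ((hmem t).2 ⟨htY, htc, hct⟩)

/-! ### Homeomorphisms of geometric realizations -/

section Realization

variable {V : Type*}

theorem inf'_add_const {s : Finset V} (hs : s.Nonempty) {x y : V → ℝ} {c : ℝ}
    (h : ∀ i ∈ s, y i = x i + c) : s.inf' hs y = s.inf' hs x + c := by
  refine le_antisymm ?_ (Finset.le_inf' _ _ fun i hi => ?_)
  · obtain ⟨i, hi, he⟩ := s.exists_mem_eq_inf' hs x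
    rw [he, ← h i hi]
    exact Finset.inf'_le _ hi
  · rw [h i hi]
    exact add_le_add_left (Finset.inf'_le _ hi) c

theorem inf'_eq_zero {s : Finset V} (hs : s.Nonempty) {x : V → ℝ} (h0 : ∀ i, 0 ≤ x i) {i : V}
    (hi : i ∈ s) (hxi : x i = 0) : s.inf' hs x = 0 :=
  le_antisymm (hxi ▸ Finset.inf'_le x hi) (Finset.le_inf' _ _ fun j _ => h0 j)

theorem continuous_inf' {s : Finset V} (hs : s.Nonempty) :
    Continuous fun x : V → ℝ => s.inf' hs x :=
  Continuous.finset_inf'_apply hs fun i _ => continuous_apply i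

variable [DecidableEq V]

theorem sum_insert_insert_eq_one {s τ : Finset V} {u v : V} (hus : u ∉ s) (hvs : v ∉ s)
    (huv : u ≠ v) {x : V → ℝ} (hτ : τ ⊆ insert v (insert u s)) (h0 : ∀ i, i ∉ τ → x i = 0)
    (h1 : ∑ i ∈ τ, x i = 1) : x v + (x u + ∑ i ∈ s, x i) = 1 := by
  rw [← Finset.sum_insert hus, ← Finset.sum_insert (by simp [hvs, huv.symm]), ← h1]
  exact (Finset.sum_subset hτ fun i _ hi => h0 i hi).symm

/-- The piecewise linear map that pushes the simplex `s ∪ {v}` into the adjacent simplex `s ∪ {u}`: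
with `b` the barycenter of `s`, it sends `v` to `b` and `b` to the midpoint of `b` and `u`, and is
affine on the simplexes of the subdivision at `b`. In barycentric coordinates, `b` has the
coefficient `|s| * min_{i ∈ s} x i`. -/
noncomputable def pushIn (s : Finset V) (hs : s.Nonempty) (u v : V) (x : V → ℝ) (i : V) : ℝ :=
  if i ∈ s then x i - s.inf' hs x / 2 + x v / s.card
  else if i = u then x u + s.card * s.inf' hs x / 2
  else if i = v then 0 else x i

/-- The inverse of `pushIn`. -/
noncomputable def pushOut (s : Finset V) (hs : s.Nonempty) (u v : V) (y : V → ℝ) (i : V) : ℝ :=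
  if i ∈ s then y i - s.inf' hs y + 2 * min (s.card * s.inf' hs y) (y u) / s.card
  else if i = u then max (y u - s.card * s.inf' hs y) 0
  else if i = v then max (s.card * s.inf' hs y - y u) 0 else y i

theorem continuous_pushIn (s : Finset V) (hs : s.Nonempty) (u v : V) :
    Continuous (pushIn s hs u v) := by
  have h := continuous_inf' hs
  refine continuous_pi fun i => ?_
  by_cases h1 : i ∈ s
  · simp only [pushIn, if_pos h1]; fun_prop
  by_cases h2 : i = u
  · simp only [pushIn, if_neg h1, if_pos h2]; fun_prop
  by_cases h3 : i = v
  · simp only [pushIn, if_neg h1, if_neg h2, if_pos h3]; fun_prop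
  · simp only [pushIn, if_neg h1, if_neg h2, if_neg h3]; fun_prop

theorem continuous_pushOut (s : Finset V) (hs : s.Nonempty) (u v : V) :
    Continuous (pushOut s hs u v) := by
  have h := continuous_inf' hs
  refine continuous_pi fun i => ?_
  by_cases h1 : i ∈ s
  · simp only [pushOut, if_pos h1]; fun_prop
  by_cases h2 : i = u
  · simp only [pushOut, if_neg h1, if_pos h2]; fun_prop
  by_cases h3 : i = v
  · simp only [pushOut, if_neg h1, if_neg h2, if_pos h3]; fun_prop
  · simp only [pushOut, if_neg h1, if_neg h2, if_neg h3]; fun_prop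

section Push

variable {s : Finset V} {hs : s.Nonempty} {u v : V}

theorem pushIn_of_mem {i : V} (hi : i ∈ s) (x : V → ℝ) :
    pushIn s hs u v x i = x i - s.inf' hs x / 2 + x v / s.card := if_pos hi

theorem pushIn_left (hu : u ∉ s) (x : V → ℝ) :
    pushIn s hs u v x u = x u + s.card * s.inf' hs x / 2 := by
  rw [pushIn, if_neg hu, if_pos rfl]

theorem pushIn_right (hv : v ∉ s) (huv : u ≠ v) (x : V → ℝ) : pushIn s hs u v x v = 0 := by
  rw [pushIn, if_neg hv, if_neg huv.symm, if_pos rfl]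

theorem pushIn_of_notMem {i : V} (hi : i ∉ s) (hu : i ≠ u) (hv : i ≠ v) (x : V → ℝ) :
    pushIn s hs u v x i = x i := by
  rw [pushIn, if_neg hi, if_neg hu, if_neg hv]

theorem pushOut_of_mem {i : V} (hi : i ∈ s) (y : V → ℝ) : pushOut s hs u v y i =
    y i - s.inf' hs y + 2 * min (s.card * s.inf' hs y) (y u) / s.card := if_pos hi

theorem pushOut_left (hu : u ∉ s) (y : V → ℝ) :
    pushOut s hs u v y u = max (y u - s.card * s.inf' hs y) 0 := by
  rw [pushOut, if_neg hu, if_pos rfl]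

theorem pushOut_right (hv : v ∉ s) (huv : u ≠ v) (y : V → ℝ) :
    pushOut s hs u v y v = max (s.card * s.inf' hs y - y u) 0 := by
  rw [pushOut, if_neg hv, if_neg huv.symm, if_pos rfl]

theorem pushOut_of_notMem {i : V} (hi : i ∉ s) (hu : i ≠ u) (hv : i ≠ v) (y : V → ℝ) :
    pushOut s hs u v y i = y i := by
  rw [pushOut, if_neg hi, if_neg hu, if_neg hv]

theorem pushIn_eq_self {x : V → ℝ} (hμ : s.inf' hs x = 0) (hxv : x v = 0) :
    pushIn s hs u v x = x := by
  funext i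
  simp only [pushIn, hμ, hxv]
  split_ifs with h1 h2 h3
  · simp
  · simp [h2]
  · rw [h3, hxv]
  · rfl

theorem pushOut_eq_self {y : V → ℝ} (hμ : s.inf' hs y = 0) (hyu : 0 ≤ y u) (hyv : y v = 0) :
    pushOut s hs u v y = y := by
  funext i
  simp only [pushOut, hμ]
  split_ifs with h1 h2 h3
  · simp [min_eq_left hyu]
  · simp [h2, max_eq_left hyu]
  · simp [h3, hyv, hyu]
  · rfl

theorem pushOut_pushIn (hu : u ∉ s) (hv : v ∉ s) (huv : u ≠ v) {x : V → ℝ} (hxu : 0 ≤ x u)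
    (hxv : 0 ≤ x v) (h : x u = 0 ∨ x v = 0) :
    pushOut s hs u v (pushIn s hs u v x) = x := by
  have hm : (s.card : ℝ) ≠ 0 := Nat.cast_ne_zero.2 (Finset.card_pos.2 hs).ne'
  have hμ : s.inf' hs (pushIn s hs u v x) = s.inf' hs x + (x v / s.card - s.inf' hs x / 2) :=
    inf'_add_const hs fun i hi => by rw [pushIn_of_mem hi]; ring
  set μ := s.inf' hs x
  have e1 : s.card * (μ + (x v / s.card - μ / 2)) = x v + s.card * μ / 2 := by
    field_simp; ring
  funext i
  by_cases h1 : i ∈ s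
  · have hmin : min (x v + s.card * μ / 2) (x u + s.card * μ / 2) = s.card * μ / 2 := by
      rw [min_add_add_right]
      rcases h with h | h
      · rw [h, min_eq_right hxv, zero_add]
      · rw [h, min_eq_left hxu, zero_add]
    rw [pushOut_of_mem h1, hμ, e1, pushIn_of_mem h1, pushIn_left hu, hmin]
    field_simp
    ring
  by_cases h2 : i = u
  · subst h2
    rw [pushOut_left hu, hμ, e1, pushIn_left hu, add_sub_add_right_eq_sub]
    rcases h with h | h
    · rw [h, max_eq_right (by linarith)]
    · rw [h, sub_zero, max_eq_left hxu]
  by_cases h3 : i = v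
  · subst h3
    rw [pushOut_right hv huv, hμ, e1, pushIn_left hu, add_sub_add_right_eq_sub]
    rcases h with h | h
    · rw [h, sub_zero, max_eq_left hxv]
    · rw [h, max_eq_right (by linarith)]
  · rw [pushOut_of_notMem h1 h2 h3, pushIn_of_notMem h1 h2 h3]

theorem pushIn_pushOut (hu : u ∉ s) (hv : v ∉ s) (huv : u ≠ v) {y : V → ℝ} (hyv : y v = 0) :
    pushIn s hs u v (pushOut s hs u v y) = y := by
  have hm : (s.card : ℝ) ≠ 0 := Nat.cast_ne_zero.2 (Finset.card_pos.2 hs).ne'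
  set ν := s.inf' hs y with hνdef
  have hν : s.inf' hs (pushOut s hs u v y) = 2 * min (s.card * ν) (y u) / s.card := by
    rw [inf'_add_const hs (c := 2 * min (s.card * ν) (y u) / s.card - ν) fun i hi => by
      rw [pushOut_of_mem hi]; ring]
    ring
  funext i
  by_cases h1 : i ∈ s
  · rw [pushIn_of_mem h1, hν, pushOut_of_mem h1, pushOut_right hv huv, ← hνdef]
    rcases le_total (s.card * ν) (y u) with h | h
    · rw [min_eq_left h, max_eq_right (by linarith)]
      field_simp
      ring
    · rw [min_eq_right h, max_eq_left (by linarith)]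
      field_simp
      ring
  by_cases h2 : i = u
  · subst h2
    rw [pushIn_left hu, hν, pushOut_left hu, ← hνdef]
    rcases le_total (s.card * ν) (y i) with h | h
    · rw [min_eq_left h, max_eq_left (by linarith)]
      field_simp
      ring
    · rw [min_eq_right h, max_eq_right (by linarith)]
      field_simp
      ring
  by_cases h3 : i = v
  · subst h3
    rw [pushIn_right hv huv, hyv]
  · rw [pushIn_of_notMem h1 h2 h3, pushOut_of_notMem h1 h2 h3]

end Push

end Realization

namespace Gluable

variable {V : Type*} [LinearOrder V] {Z : FiniteComplex V} {m : ℕ} {s : Finset V} {v : V}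

/-- The simplex that is glued to a boundary face can be pushed into the simplex on the other side
of this face. -/
theorem nonempty_homeomorph (h : Z.Gluable m s v) :
    Nonempty ((Z.glue s v).realization ≃ₜ Z.realization) := by
  have hs := face_nonempty h.boundary.1
  obtain ⟨t, ⟨ht, htc, hst⟩, huniq⟩ := h.boundary.2.2
  obtain ⟨u, hu, rfl⟩ : ∃ u, u ∉ s ∧ insert u s = t := by
    obtain ⟨u, hu⟩ := Finset.card_eq_one.1 (show (t \ s).card = 1 by
      have := Finset.card_sdiff_add_card_eq_card hst
      rw [h.card_eq] at this
      omega)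
    refine ⟨u, fun hus => ?_, ?_⟩
    · have : u ∈ t \ s := hu ▸ Finset.mem_singleton_self u
      exact (Finset.mem_sdiff.1 this).2 hus
    · rw [← Finset.sdiff_union_of_subset hst, hu]; rfl
  have hv := h.notMem
  have huv : u ≠ v := fun e => h.fresh _ ht (e ▸ Finset.mem_insert_self _ _)
  have hmax : ∀ τ ∈ Z.faces, s ⊆ τ → τ ⊆ insert u s := by
    intro τ hτ hsτ
    rcases (h.card_le τ hτ).lt_or_eq with hlt | heq
    · rw [← Finset.eq_of_subset_of_card_le hsτ (by rw [h.card_eq]; omega)]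
      exact Finset.subset_insert _ _
    · exact (huniq τ ⟨hτ, heq, hsτ⟩).le
  have hm : (0 : ℝ) < s.card := Nat.cast_pos.2 (Finset.card_pos.2 hs)
  have hsumc : ∀ c : ℝ, ∑ _i ∈ s, c = s.card * c := fun c => by
    rw [Finset.sum_const, nsmul_eq_mul]
  have hF : ∀ x ∈ (Z.glue s v).realization, pushIn s hs u v x ∈ Z.realization := by
    rintro x ⟨τ, hτ, h0, hoff, h1⟩
    by_cases hcase : τ ∈ Z.faces ∧ ¬ s ⊆ τ
    · obtain ⟨i, hi, hiτ⟩ := Finset.not_subset.1 hcase.2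
      rw [pushIn_eq_self (inf'_eq_zero hs h0 hi (hoff i hiτ)) (hoff v (h.fresh τ hcase.1))]
      exact ⟨τ, hcase.1, h0, hoff, h1⟩
    · have hsub : τ ⊆ insert v (insert u s) := by
        rcases hτ with hτ | ⟨-, hτ⟩
        · exact (hmax τ hτ (not_not.1 fun hn => hcase ⟨hτ, hn⟩)).trans (Finset.subset_insert _ _)
        · exact hτ.trans (Finset.insert_subset_insert _ (Finset.subset_insert _ _))
      have hsum := sum_insert_insert_eq_one hu hv huv hsub hoff h1
      have hμ0 : 0 ≤ s.inf' hs x := Finset.le_inf' _ _ fun i _ => h0 i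
      refine ⟨insert u s, ht, fun i => ?_, fun i hi => ?_, ?_⟩
      · by_cases h1 : i ∈ s
        · rw [pushIn_of_mem h1]
          have := Finset.inf'_le x h1
          have := div_nonneg (h0 v) hm.le
          linarith
        by_cases h2 : i = u
        · subst h2
          rw [pushIn_left hu]
          have := h0 i
          positivity
        by_cases h3 : i = v
        · subst h3
          rw [pushIn_right hv huv]
        · rw [pushIn_of_notMem h1 h2 h3]
          exact h0 i
      · rw [Finset.mem_insert, not_or] at hi
        by_cases h3 : i = v
        · subst h3
          exact pushIn_right hv huv x
        · rw [pushIn_of_notMem hi.2 hi.1 h3]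
          exact hoff i fun hiτ => by
            have := hsub hiτ
            simp [hi, h3] at this
      · rw [Finset.sum_insert hu, pushIn_left hu, Finset.sum_congr rfl fun i hi =>
          pushIn_of_mem hi x, Finset.sum_add_distrib, Finset.sum_sub_distrib, hsumc, hsumc,
          mul_div_cancel₀ _ hm.ne']
        linarith
  have hG : ∀ y ∈ Z.realization, pushOut s hs u v y ∈ (Z.glue s v).realization := by
    rintro y ⟨τ, hτ, h0, hoff, h1⟩
    by_cases hsτ : s ⊆ τ
    · have hyv : y v = 0 := hoff v (h.fresh τ hτ)
      have hsub : τ ⊆ insert v (insert u s) := (hmax τ hτ hsτ).trans (Finset.subset_insert _ _)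
      have hsum := sum_insert_insert_eq_one hu hv huv hsub hoff h1
      rw [hyv, zero_add] at hsum
      have hν0 : 0 ≤ s.inf' hs y := Finset.le_inf' _ _ fun i _ => h0 i
      have hnonneg : ∀ i, 0 ≤ pushOut s hs u v y i := by
        intro i
        by_cases h1 : i ∈ s
        · rw [pushOut_of_mem h1]
          have h2 := Finset.inf'_le y h1
          have h3 : 0 ≤ min (s.card * s.inf' hs y) (y u) := le_min (by positivity) (h0 u)
          have h4 : 0 ≤ 2 * min (s.card * s.inf' hs y) (y u) / s.card := by positivity
          linarith
        by_cases h2 : i = u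
        · subst h2
          rw [pushOut_left hu]
          exact le_max_right _ _
        by_cases h3 : i = v
        · subst h3
          rw [pushOut_right hv huv]
          exact le_max_right _ _
        · rw [pushOut_of_notMem h1 h2 h3]
          exact h0 i
      have hout : ∀ i, i ∉ s → i ≠ u → i ≠ v → pushOut s hs u v y i = 0 := by
        intro i h1 h2 h3
        rw [pushOut_of_notMem h1 h2 h3]
        exact hoff i fun hiτ => by
          have := hsub hiτ
          simp [h1, h2, h3] at this
      rcases le_total (s.card * s.inf' hs y) (y u) with hle | hle
      · refine ⟨insert u s, Or.inl ht, hnonneg, fun i hi => ?_, ?_⟩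
        · rw [Finset.mem_insert, not_or] at hi
          by_cases h3 : i = v
          · subst h3
            rw [pushOut_right hv huv, max_eq_right (by linarith)]
          · exact hout i hi.2 hi.1 h3
        · rw [Finset.sum_insert hu, pushOut_left hu, Finset.sum_congr rfl fun i hi =>
            pushOut_of_mem hi y, Finset.sum_add_distrib, Finset.sum_sub_distrib, hsumc, hsumc,
            mul_div_cancel₀ _ hm.ne', min_eq_left hle, max_eq_left (by linarith)]
          linarith
      · refine ⟨insert v s, Or.inr ⟨Finset.insert_nonempty _ _, subset_rfl⟩, hnonneg,
          fun i hi => ?_, ?_⟩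
        · rw [Finset.mem_insert, not_or] at hi
          by_cases h2 : i = u
          · subst h2
            rw [pushOut_left hu, max_eq_right (by linarith)]
          · exact hout i hi.2 h2 hi.1
        · rw [Finset.sum_insert hv, pushOut_right hv huv, Finset.sum_congr rfl fun i hi =>
            pushOut_of_mem hi y, Finset.sum_add_distrib, Finset.sum_sub_distrib, hsumc, hsumc,
            mul_div_cancel₀ _ hm.ne', min_eq_right hle, max_eq_left (by linarith)]
          linarith
    · obtain ⟨i, hi, hiτ⟩ := Finset.not_subset.1 hsτ
      rw [pushOut_eq_self (inf'_eq_zero hs h0 hi (hoff i hiτ)) (h0 u) (hoff v (h.fresh τ hτ))]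
      exact ⟨τ, Or.inl hτ, h0, hoff, h1⟩
  refine ⟨{
    toFun := fun x => ⟨_, hF x.1 x.2⟩
    invFun := fun y => ⟨_, hG y.1 y.2⟩
    left_inv := fun x => Subtype.ext ?_
    right_inv := fun y => Subtype.ext ?_
    continuous_toFun := ((continuous_pushIn s hs u v).comp continuous_subtype_val).subtype_mk _
    continuous_invFun := ((continuous_pushOut s hs u v).comp continuous_subtype_val).subtype_mk _ }⟩
  · obtain ⟨τ, hτ, h0, hoff, -⟩ := x.2
    refine pushOut_pushIn hu hv huv (h0 u) (h0 v) ?_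
    rcases hτ with hτ | ⟨-, hτ⟩
    · exact Or.inr (hoff v (h.fresh τ hτ))
    · refine Or.inl (hoff u fun huτ => ?_)
      have := hτ huτ
      simp [hu, huv] at this
  · obtain ⟨τ, hτ, -, hoff, -⟩ := y.2
    exact pushIn_pushOut hu hv huv (hoff v (h.fresh τ hτ))

end Gluable

namespace Subdividable

variable {Z : FiniteComplex ℕ} {m : ℕ} {σ : Finset ℕ} {w : ℕ}

/-- Sending the new vertex `w` to the barycenter of `σ` identifies the realizations of a complex and
of its stellar subdivision. -/
theorem nonempty_homeomorph (h : Z.Subdividable m σ w) :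
    Nonempty ((Z.stellarAt σ w).realization ≃ₜ Z.realization) := by
  have hσ := face_nonempty h.mem
  have hw := h.notMem
  have hm : (0 : ℝ) < σ.card := Nat.cast_pos.2 (Finset.card_pos.2 hσ)
  have hsumc : ∀ c : ℝ, ∑ _i ∈ σ, c = σ.card * c := fun c => by
    rw [Finset.sum_const, nsmul_eq_mul]
  let F : (ℕ → ℝ) → ℕ → ℝ := fun x i =>
    if i ∈ σ then x i + x w / σ.card else if i = w then 0 else x i
  let G : (ℕ → ℝ) → ℕ → ℝ := fun y i =>
    if i ∈ σ then y i - σ.inf' hσ y else if i = w then σ.card * σ.inf' hσ y else y i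
  have hFc : Continuous F := by
    refine continuous_pi fun i => ?_
    simp only [F]
    split_ifs <;> fun_prop
  have hGc : Continuous G := by
    have := continuous_inf' hσ
    refine continuous_pi fun i => ?_
    simp only [G]
    split_ifs <;> fun_prop
  have hFσ : ∀ x, ∀ i ∈ σ, F x i = x i + x w / σ.card := fun x i hi => if_pos hi
  have hFw : ∀ x, F x w = 0 := fun x => (if_neg hw).trans (if_pos rfl)
  have hFo : ∀ x i, i ∉ σ → i ≠ w → F x i = x i := fun x i h1 h2 => by
    simp only [F]; rw [if_neg h1, if_neg h2]
  have hGσ : ∀ y, ∀ i ∈ σ, G y i = y i - σ.inf' hσ y := fun y i hi => if_pos hi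
  have hGw : ∀ y, G y w = σ.card * σ.inf' hσ y := fun y =>
    (if_neg hw).trans (if_pos rfl)
  have hGo : ∀ y i, i ∉ σ → i ≠ w → G y i = y i := fun y i h1 h2 => by
    simp only [G]; rw [if_neg h1, if_neg h2]
  have hF : ∀ x ∈ (Z.stellarAt σ w).realization, F x ∈ Z.realization := by
    rintro x ⟨τ, hτ, h0, hoff, h1⟩
    by_cases hwτ : w ∈ τ
    · obtain ⟨u, -, hsub⟩ := (h.mem_stellarAt_of_mem hwτ).1 hτ
      have hsub' : τ ⊆ insert w σ := hsub.trans (Finset.erase_subset _ _)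
      have hsum : x w + ∑ i ∈ σ, x i = 1 := by
        rw [← Finset.sum_insert hw, ← h1]
        exact (Finset.sum_subset hsub' fun i _ hi => hoff i hi).symm
      refine ⟨σ, h.mem, fun i => ?_, fun i hi => ?_, ?_⟩
      · by_cases hi : i ∈ σ
        · rw [hFσ x i hi]
          exact add_nonneg (h0 i) (div_nonneg (h0 w) hm.le)
        by_cases hiw : i = w
        · rw [hiw, hFw]
        · rw [hFo x i hi hiw]
          exact h0 i
      · by_cases hiw : i = w
        · rw [hiw, hFw]
        · rw [hFo x i hi hiw]
          exact hoff i fun hiτ => (Finset.mem_insert.1 (hsub' hiτ)).elim hiw hi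
      · rw [Finset.sum_congr rfl (hFσ x), Finset.sum_add_distrib, hsumc,
          mul_div_cancel₀ _ hm.ne']
        linarith
    · have hxw : x w = 0 := hoff w hwτ
      have : F x = x := by
        funext i
        by_cases hi : i ∈ σ
        · rw [hFσ x i hi, hxw, zero_div, add_zero]
        by_cases hiw : i = w
        · rw [hiw, hFw, hxw]
        · exact hFo x i hi hiw
      rw [this]
      exact ⟨τ, ((h.mem_stellarAt_of_notMem hwτ).1 hτ).1, h0, hoff, h1⟩
  have hG : ∀ y ∈ Z.realization, G y ∈ (Z.stellarAt σ w).realization := by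
    rintro y ⟨τ, hτ, h0, hoff, h1⟩
    have hyw : y w = 0 := hoff w (h.fresh τ hτ)
    by_cases hτσ : τ = σ
    · subst hτσ
      obtain ⟨u, hu, hmin⟩ := τ.exists_mem_eq_inf' hσ y
      have hν0 : 0 ≤ τ.inf' hσ y := Finset.le_inf' _ _ fun i _ => h0 i
      refine ⟨(insert w τ).erase u, (mem_cells.1 (h.insert_erase_mem_cells hu)).1, fun i => ?_,
        fun i hi => ?_, ?_⟩
      · by_cases hi : i ∈ τ
        · rw [hGσ y i hi]
          exact sub_nonneg.2 (Finset.inf'_le y hi)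
        by_cases hiw : i = w
        · rw [hiw, hGw]
          positivity
        · rw [hGo y i hi hiw]
          exact h0 i
      · by_cases hiu : i = u
        · rw [hiu, hGσ y u hu, hmin, sub_self]
        · have hi' : i ∉ insert w τ := fun h' => hi (Finset.mem_erase.2 ⟨hiu, h'⟩)
          rw [Finset.mem_insert, not_or] at hi'
          rw [hGo y i hi'.2 hi'.1]
          exact hoff i hi'.2
      · have hGu : G y u = 0 := by rw [hGσ y u hu, hmin, sub_self]
        rw [Finset.sum_erase _ hGu, Finset.sum_insert hw, hGw, Finset.sum_congr rfl (hGσ y),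
          Finset.sum_sub_distrib, hsumc]
        linarith
    · have hnot : ¬ σ ⊆ τ := fun hsub => hτσ (h.eq_of_subset hτ hsub)
      obtain ⟨i₀, hi₀, hi₀τ⟩ := Finset.not_subset.1 hnot
      have hν := inf'_eq_zero hσ h0 hi₀ (hoff i₀ hi₀τ)
      have : G y = y := by
        funext i
        by_cases hi : i ∈ σ
        · rw [hGσ y i hi, hν, sub_zero]
        by_cases hiw : i = w
        · rw [hiw, hGw, hν, mul_zero, hyw]
        · exact hGo y i hi hiw
      rw [this]
      exact ⟨τ, (h.mem_stellarAt_of_notMem (h.fresh τ hτ)).2 ⟨hτ, hτσ⟩, h0, hoff, h1⟩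
  refine ⟨{
    toFun := fun x => ⟨F x.1, hF x.1 x.2⟩
    invFun := fun y => ⟨G y.1, hG y.1 y.2⟩
    left_inv := fun x => Subtype.ext ?_
    right_inv := fun y => Subtype.ext ?_
    continuous_toFun := (hFc.comp continuous_subtype_val).subtype_mk _
    continuous_invFun := (hGc.comp continuous_subtype_val).subtype_mk _ }⟩
  · obtain ⟨x, τ, hτ, h0, hoff, -⟩ := x
    have hν : σ.inf' hσ x = 0 := by
      have hnot : ¬ σ ⊆ τ := by
        intro hsub
        by_cases hwτ : w ∈ τ
        · obtain ⟨u, hu, hsub'⟩ := (h.mem_stellarAt_of_mem hwτ).1 hτ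
          exact Finset.notMem_erase _ _ (hsub' (hsub hu))
        · obtain ⟨hτ', hne⟩ := (h.mem_stellarAt_of_notMem hwτ).1 hτ
          exact hne (h.eq_of_subset hτ' hsub)
      obtain ⟨i, hi, hiτ⟩ := Finset.not_subset.1 hnot
      exact inf'_eq_zero hσ h0 hi (hoff i hiτ)
    have hν' : σ.inf' hσ (F x) = x w / σ.card := by
      rw [inf'_add_const hσ (hFσ x), hν, zero_add]
    funext i
    change G (F x) i = x i
    by_cases hi : i ∈ σ
    · rw [hGσ _ i hi, hν', hFσ x i hi, add_sub_cancel_right]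
    by_cases hiw : i = w
    · rw [hiw, hGw, hν', mul_div_cancel₀ _ hm.ne']
    · rw [hGo _ i hi hiw, hFo x i hi hiw]
  · obtain ⟨y, τ, hτ, h0, hoff, -⟩ := y
    funext i
    change F (G y) i = y i
    by_cases hi : i ∈ σ
    · rw [hFσ _ i hi, hGσ y i hi, hGw, mul_div_cancel_left₀ _ hm.ne', sub_add_cancel]
    by_cases hiw : i = w
    · rw [hiw, hFw, hoff w (h.fresh τ hτ)]
    · rw [hFo _ i hi hiw, hGo y i hi hiw]

end Subdividable

theorem mem_realization_fullSimplex {m : ℕ} {x : ℕ → ℝ} :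
    x ∈ (fullSimplex m).realization ↔ (∀ i, 0 ≤ x i) ∧ (∀ i, i ∉ Finset.range (m + 1) → x i = 0) ∧
      ∑ i ∈ Finset.range (m + 1), x i = 1 := by
  constructor
  · rintro ⟨τ, ⟨-, hτ⟩, h0, hoff, h1⟩
    refine ⟨h0, fun i hi => hoff i fun hiτ => hi (hτ hiτ), ?_⟩
    rw [← h1]
    exact (Finset.sum_subset hτ fun i _ hi => hoff i hi).symm
  · rintro ⟨h0, hoff, h1⟩
    exact ⟨Finset.range (m + 1), ⟨⟨0, by simp⟩, subset_rfl⟩, h0, hoff, h1⟩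

/-- Dropping the last barycentric coordinate identifies the standard simplex with a convex body. -/
theorem nonempty_homeomorph_fullSimplex (m : ℕ) : Nonempty
    ((fullSimplex m).realization ≃ₜ Metric.closedBall (0 : EuclideanSpace ℝ (Fin m)) 1) := by
  let K : Set (EuclideanSpace ℝ (Fin m)) := {y | (∀ i, 0 ≤ y i) ∧ ∑ i, y i ≤ 1}
  have hcont : ∀ i : Fin m, Continuous fun y : EuclideanSpace ℝ (Fin m) => y i := fun i => by
    fun_prop
  have hclosed : IsClosed K := by
    have : K = (⋂ i, {y | 0 ≤ y i}) ∩ {y | ∑ i, y i ≤ 1} := by ext y; simp [K]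
    rw [this]
    refine (isClosed_iInter fun i => isClosed_le continuous_const (hcont i)).inter
      (isClosed_le (continuous_finsetSum _ fun i _ => hcont i) continuous_const)
  have hconv : Convex ℝ K := by
    rintro x ⟨hx, hx1⟩ y ⟨hy, hy1⟩ a b ha hb hab
    refine ⟨fun i => ?_, ?_⟩
    · have h1 := mul_nonneg ha (hx i)
      have h2 := mul_nonneg hb (hy i)
      simpa using add_nonneg h1 h2
    · have : ∑ i, (a • x + b • y) i = a * ∑ i, x i + b * ∑ i, y i := by
        simp [Finset.sum_add_distrib, Finset.mul_sum]
      rw [this]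
      nlinarith
  have hint : (interior K).Nonempty := by
    let U : Set (EuclideanSpace ℝ (Fin m)) := (⋂ i, {y | 0 < y i}) ∩ {y | ∑ i, y i < 1}
    have hU : IsOpen U :=
      (isOpen_iInter_of_finite fun i => isOpen_lt continuous_const (hcont i)).inter
        (isOpen_lt (continuous_finsetSum _ fun i _ => hcont i) continuous_const)
    have hUK : U ⊆ K := fun y hy =>
      ⟨fun i => (Set.mem_iInter.1 hy.1 i : 0 < y i).le, (show ∑ i, y i < 1 from hy.2).le⟩
    refine ⟨WithLp.toLp 2 fun _ => 1 / ((m : ℝ) + 1), interior_maximal hUK hU ⟨?_, ?_⟩⟩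
    · refine Set.mem_iInter.2 fun i => ?_
      change 0 < 1 / ((m : ℝ) + 1)
      positivity
    · change ∑ _i : Fin m, 1 / ((m : ℝ) + 1) < 1
      rw [Finset.sum_const, Finset.card_univ, Fintype.card_fin, nsmul_eq_mul, mul_one_div,
        div_lt_one (by positivity)]
      linarith
  have hbdd : Bornology.IsBounded K := by
    refine (Metric.isBounded_closedBall (x := (0 : EuclideanSpace ℝ (Fin m))) (r := 1)).subset ?_
    rintro y ⟨h0, h1⟩
    rw [mem_closedBall_zero_iff, EuclideanSpace.norm_eq, Real.sqrt_le_one]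
    refine le_trans (Finset.sum_le_sum fun i _ => ?_) h1
    have hle : y i ≤ 1 := (Finset.single_le_sum (fun j _ => h0 j) (Finset.mem_univ i)).trans h1
    rw [Real.norm_of_nonneg (h0 i)]
    nlinarith [h0 i]
  obtain ⟨e, -, he, -⟩ :=
    exists_homeomorph_image_interior_closure_frontier_eq_unitBall hconv hint hbdd
  rw [hclosed.closure_eq] at he
  let A : (ℕ → ℝ) → EuclideanSpace ℝ (Fin m) := fun x => WithLp.toLp 2 fun i => x i
  let B : EuclideanSpace ℝ (Fin m) → ℕ → ℝ := fun y j =>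
    if hj : j < m then y ⟨j, hj⟩ else if j = m then 1 - ∑ i, y i else 0
  have hBlt : ∀ y (i : Fin m), B y i = y i := fun y i => dif_pos i.2
  have hBm : ∀ y, B y m = 1 - ∑ i, y i := fun y =>
    (dif_neg (lt_irrefl m)).trans (if_pos rfl)
  have hBgt : ∀ y j, m < j → B y j = 0 := fun y j hj => by
    simp only [B]; rw [dif_neg (by omega), if_neg (by omega)]
  have hsum : ∀ x : ℕ → ℝ, ∑ i ∈ Finset.range (m + 1), x i = ∑ i : Fin m, x i + x m := fun x => by
    rw [Finset.sum_range_succ, Finset.sum_range]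
  have hA : ∀ x ∈ (fullSimplex m).realization, A x ∈ K := by
    intro x hx
    obtain ⟨h0, -, h1⟩ := mem_realization_fullSimplex.1 hx
    rw [hsum] at h1
    refine ⟨fun i => h0 i, ?_⟩
    change ∑ i : Fin m, x i ≤ 1
    linarith [h0 m]
  have hB : ∀ y ∈ K, B y ∈ (fullSimplex m).realization := by
    rintro y ⟨h0, h1⟩
    refine mem_realization_fullSimplex.2 ⟨fun j => ?_, fun j hj => ?_, ?_⟩
    · rcases lt_trichotomy j m with hj | rfl | hj
      · exact (h0 ⟨j, hj⟩).trans_eq (hBlt y ⟨j, hj⟩).symm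
      · rw [hBm]; linarith
      · rw [hBgt y j hj]
    · exact hBgt y j (by simpa using hj)
    · rw [hsum, hBm, Finset.sum_congr rfl fun i _ => hBlt y i]
      ring
  have hAc : Continuous A := by fun_prop
  have hBc : Continuous B := by
    refine continuous_pi fun j => ?_
    simp only [B]
    split_ifs <;> fun_prop
  let eK : (fullSimplex m).realization ≃ₜ K := {
    toFun := fun x => ⟨A x.1, hA x.1 x.2⟩
    invFun := fun y => ⟨B y.1, hB y.1 y.2⟩
    left_inv := fun x => Subtype.ext (funext fun j => by
      obtain ⟨x, hx⟩ := x
      obtain ⟨-, hoff, h1⟩ := mem_realization_fullSimplex.1 hx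
      rw [hsum] at h1
      change B (A x) j = x j
      rcases lt_trichotomy j m with hj | rfl | hj
      · exact hBlt (A x) ⟨j, hj⟩
      · rw [hBm]
        change 1 - ∑ i : Fin j, x i = x j
        linarith
      · rw [hBgt _ j hj, hoff j (by simpa using hj)])
    right_inv := fun y => Subtype.ext (by
      change A (B y.1) = y.1
      ext i
      exact hBlt y.1 i)
    continuous_toFun := (hAc.comp continuous_subtype_val).subtype_mk _
    continuous_invFun := (hBc.comp continuous_subtype_val).subtype_mk _ }
  exact ⟨eK.trans ((e.image K).trans (Homeomorph.setCongr he))⟩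

/-! ### The full simplex -/

section FullSimplex

variable {m : ℕ}

theorem card_le_fullSimplex : ∀ t ∈ (fullSimplex m).faces, t.card ≤ m + 1 := fun _ ht =>
  (Finset.card_le_card ht.2).trans (Finset.card_range _).le

theorem cells_top_fullSimplex : (fullSimplex m).cells (m + 1) = {Finset.range (m + 1)} := by
  ext t
  rw [mem_cells, Finset.mem_singleton]
  constructor
  · rintro ⟨ht, hc⟩
    exact Finset.eq_of_subset_of_card_le ht.2 (by rw [hc, Finset.card_range])
  · rintro rfl
    exact ⟨⟨⟨0, by simp⟩, subset_rfl⟩, Finset.card_range _⟩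

theorem exists_erase_eq_of_mem_cells {t : Finset ℕ} (ht : t ∈ (fullSimplex m).cells m) :
    ∃ u ∈ Finset.range (m + 1), (Finset.range (m + 1)).erase u = t := by
  obtain ⟨ht, hc⟩ := mem_cells.1 ht
  obtain ⟨u, hu, hut⟩ : ∃ u ∈ Finset.range (m + 1), u ∉ t := by
    by_contra! hcon
    have := Finset.card_le_card (show Finset.range (m + 1) ⊆ t from hcon)
    rw [Finset.card_range, hc] at this
    omega
  refine ⟨u, hu, (Finset.eq_of_subset_of_card_le (fun x hx => ?_) ?_).symm⟩
  · exact Finset.mem_erase.2 ⟨fun e => hut (e ▸ hx), ht.2 hx⟩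
  · rw [Finset.card_erase_of_mem hu, Finset.card_range, hc]; rfl

theorem cells_facets_fullSimplex (hm : 0 < m) : (fullSimplex m).cells m =
    (Finset.range (m + 1)).image fun u => (Finset.range (m + 1)).erase u := by
  ext t
  rw [Finset.mem_image]
  refine ⟨exists_erase_eq_of_mem_cells, ?_⟩
  rintro ⟨u, hu, rfl⟩
  exact erase_mem_cells hm (by rw [cells_top_fullSimplex]; exact Finset.mem_singleton_self _) hu

theorem sum_cells_facets_fullSimplex (hm : 0 < m) {M : Type*} [AddCommMonoid M]
    (f : Finset ℕ → M) : ∑ t ∈ (fullSimplex m).cells m, f t =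
      ∑ u ∈ Finset.range (m + 1), f ((Finset.range (m + 1)).erase u) := by
  rw [cells_facets_fullSimplex hm]
  refine Finset.sum_image fun u _ u' hu' h => ?_
  by_contra hne
  have h1 : u' ∈ (Finset.range (m + 1)).erase u := Finset.mem_erase.2 ⟨Ne.symm hne, hu'⟩
  rw [h] at h1
  exact Finset.notMem_erase _ _ h1

theorem bdry_fullSimplex : (fullSimplex m).bdry m = (fullSimplex m).cells m := by
  ext t
  rw [mem_bdry, mem_cells]
  refine ⟨fun h => ⟨h.1, h.2.1⟩, fun h => ⟨h.1, h.2, Finset.range (m + 1), ?_, ?_⟩⟩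
  · exact ⟨⟨⟨0, by simp⟩, subset_rfl⟩, Finset.card_range _, h.1.2⟩
  · rintro t' ⟨ht', hc', -⟩
    exact Finset.eq_of_subset_of_card_le ht'.2 (by rw [hc', Finset.card_range])

theorem acyclic_fullSimplex (F : Type*) [CommRing F] : (fullSimplex m).Acyclic F m := by
  intro φ hφ
  obtain ⟨χ, hχ, -⟩ := exists_cobd_eq_on_facets (a := 0) (by simp)
    (hφ (Finset.range (m + 1)) (by rw [cells_top_fullSimplex]; exact Finset.mem_singleton_self _))
  refine ⟨χ, fun s hs => ?_⟩
  obtain ⟨u, hu, rfl⟩ := exists_erase_eq_of_mem_cells hs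
  exact hχ u hu

theorem bd_fullSimplex {F : Type*} [CommRing F] (g : Finset ℕ → F) (s : Finset ℕ) :
    (fullSimplex m).bd (m + 1) g s =
      incidence F s (Finset.range (m + 1)) * g (Finset.range (m + 1)) := by
  rw [bd, cells_top_fullSimplex, Finset.sum_singleton]

end FullSimplex

theorem isBall_of_homeomorph {V : Type*} {X : FiniteComplex V} {m : ℕ}
    (hdim : ∀ t ∈ X.faces, t.card ≤ m + 1) (hne : (X.cells (m + 1)).Nonempty)
    (hX : Nonempty (X.realization ≃ₜ Metric.closedBall (0 : EuclideanSpace ℝ (Fin m)) 1)) :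
    X.IsBall m := by
  refine ⟨⟨?_, ⟨fun t => ?_⟩⟩, hX⟩
  · obtain ⟨t, ht⟩ := hne
    exact ⟨⟨t, mem_cells.1 ht⟩⟩
  · have h1 := hdim t.1 t.2.1
    have h2 : t.1.card = m + 1 + 1 := t.2.2
    omega

/-! ### The complexes `X_k` -/

/-- The properties of the complexes `X_k` that are preserved by gluing a simplex to a boundary face.
The constant `(√m - 1)²` is the bottom of the spectrum of the Laplacian of the regular tree of
degree `m + 1`, of which the dual graphs of the `X_k` are balls. -/
structure TreeLike (Z : FiniteComplex ℕ) (m : ℕ) : Prop where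
  ball : Nonempty (Z.realization ≃ₜ Metric.closedBall (0 : EuclideanSpace ℝ (Fin m)) 1)
  acyclic_real : Z.Acyclic ℝ m
  acyclic_two : Z.Acyclic (ZMod 2) m
  energy : ∀ g : Finset ℕ → ℝ, (√m - 1) ^ 2 * ∑ t ∈ Z.cells (m + 1), g t ^ 2 +
    (√m)⁻¹ * ∑ r ∈ Z.bdry m, Z.bd (m + 1) g r ^ 2 ≤ ∑ r ∈ Z.cells m, Z.bd (m + 1) g r ^ 2
  parity : ∀ φ : Finset ℕ → ZMod 2, ∑ t ∈ Z.cells (m + 1), cobd φ t = ∑ r ∈ Z.bdry m, φ r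
  root_mem : Finset.range (m + 1) ∈ Z.cells (m + 1)

/-- The fillings of all `m`-simplexes that run along the tree to a single boundary face. -/
def HasPaths (Z : FiniteComplex ℕ) (m k : ℕ) : Prop :=
  ∀ t ∈ Z.cells (m + 1), ∃ (φ : Finset ℕ → ZMod 2) (r : Finset ℕ), Z.Fills m φ t ∧
    Z.IsBoundaryFace m r ∧ (∀ r', Z.IsBoundaryFace m r' → φ r' ≠ 0 → r' = r) ∧
    (Z.supp m φ).card ≤ k

theorem treeLike_fullSimplex {m : ℕ} (hm : 1 < m) : (fullSimplex m).TreeLike m := by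
  have hm0 : 0 < m := by omega
  refine ⟨nonempty_homeomorph_fullSimplex m, acyclic_fullSimplex ℝ, acyclic_fullSimplex _,
    fun g => ?_, fun φ => ?_, ?_⟩
  · have h1 : ∑ s ∈ (fullSimplex m).cells m, (fullSimplex m).bd (m + 1) g s ^ 2 =
        (m + 1) * g (Finset.range (m + 1)) ^ 2 := by
      rw [sum_cells_facets_fullSimplex hm0, Finset.sum_congr rfl fun u hu => by
        rw [bd_fullSimplex, mul_pow, incidence_erase_sq hu, one_mul], Finset.sum_const,
        Finset.card_range, nsmul_eq_mul]
      push_cast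
      rfl
    rw [bdry_fullSimplex, h1, cells_top_fullSimplex, Finset.sum_singleton]
    have hmR : (1 : ℝ) < m := by exact_mod_cast hm
    set a := √(m : ℝ) with ha
    have ha2 : a ^ 2 = m := Real.sq_sqrt (by linarith)
    have ha0 : 0 < a := Real.sqrt_pos.2 (by linarith)
    have hai : a⁻¹ * a = 1 := inv_mul_cancel₀ ha0.ne'
    have ha1 : 1 ≤ a := by nlinarith
    have hai1 : a⁻¹ ≤ a := (inv_le_one_of_one_le₀ ha1).trans ha1
    have key : (a - 1) ^ 2 + a⁻¹ * (m + 1) ≤ m + 1 := by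
      have : a⁻¹ * (m + 1) = a + a⁻¹ := by linear_combination a * hai - a⁻¹ * ha2
      rw [this]
      nlinarith
    nlinarith [mul_le_mul_of_nonneg_right key (sq_nonneg (g (Finset.range (m + 1))))]
  · rw [bdry_fullSimplex, cells_top_fullSimplex, Finset.sum_singleton,
      sum_cells_facets_fullSimplex hm0, cobd_zmod_two]
  · rw [cells_top_fullSimplex]
    exact Finset.mem_singleton_self _

theorem hasPaths_fullSimplex {m : ℕ} (hm : 0 < m) : (fullSimplex m).HasPaths m 1 := by
  classical
  intro t ht
  rw [cells_top_fullSimplex, Finset.mem_singleton] at ht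
  subst ht
  have h0 : 0 ∈ Finset.range (m + 1) := by simp
  set r := (Finset.range (m + 1)).erase 0 with hr
  refine ⟨fun s => if s = r then 1 else 0, r, ⟨incidence_erase_sq h0, fun τ hτ hne => ?_⟩, ?_,
    fun r' _ hr' => ?_, ?_⟩
  · rw [cells_top_fullSimplex, Finset.mem_singleton] at hτ
    exact absurd hτ hne
  · rw [← mem_bdry, bdry_fullSimplex]
    exact erase_mem_cells hm (by rw [cells_top_fullSimplex]; exact Finset.mem_singleton_self _) h0
  · by_contra hne
    exact hr' (if_neg hne)
  · refine Finset.card_le_one.2 fun a ha b hb => ?_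
    simp only [mem_supp, ne_eq, ite_eq_right_iff, not_forall] at ha hb
    rw [ha.2.choose, hb.2.choose]

theorem TreeLike.glue {Z : FiniteComplex ℕ} {m : ℕ} {s : Finset ℕ} {v : ℕ} (h : Z.Gluable m s v)
    (hZ : Z.TreeLike m) : (Z.glue s v).TreeLike m := by
  have hm : (0 : ℝ) < m := Nat.cast_pos.2 h.pos
  obtain ⟨e⟩ := hZ.ball
  obtain ⟨e'⟩ := h.nonempty_homeomorph
  exact ⟨⟨e'.trans e⟩, h.acyclic_glue hZ.acyclic_real, h.acyclic_glue hZ.acyclic_two,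
    h.energy_glue (Real.sqrt_pos.2 hm) (Real.sq_sqrt hm.le) hZ.energy, h.parity_glue hZ.parity,
    by rw [h.cells_top]; exact Finset.mem_insert_of_mem hZ.root_mem⟩

theorem HasPaths.glueAll {X : FiniteComplex ℕ} {m k : ℕ} (hdim : ∀ t ∈ X.faces, t.card ≤ m + 1)
    (hX : X.HasPaths m k) : (X.glueAll m).HasPaths m (k + 1) := by
  have := (glueAll_induction (m := m) hdim (P := fun Z => ∀ t ∈ Z.cells (m + 1),
    ∃ (φ : Finset ℕ → ZMod 2) (r : Finset ℕ), Z.Fills m φ t ∧ Z.IsBoundaryFace m r ∧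
      (∀ r', Z.IsBoundaryFace m r' → φ r' ≠ 0 → r' = r) ∧
      (r ∈ X.faces → (Z.supp m φ).card ≤ k) ∧ (Z.supp m φ).card ≤ k + 1) ?_ ?_).1
  · intro t ht
    obtain ⟨φ, r, h1, h2, h3, -, h4⟩ := this t ht
    exact ⟨φ, r, h1, h2, h3, h4⟩
  · intro t ht
    obtain ⟨φ, r, h1, h2, h3, h4⟩ := hX t ht
    exact ⟨φ, r, h1, h2, h3, fun _ => h4, h4.trans (Nat.le_succ k)⟩
  · exact fun Z s v h hs hv hfill => h.fills_glue hv hs hfill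

theorem familyX_succ {m k : ℕ} (hk : 1 ≤ k) :
    familyX m (k + 1) = (familyX m k).glueAll m := by
  obtain ⟨j, rfl⟩ := Nat.exists_eq_add_of_le' hk
  rfl

/-- Fillings of the initial simplex reach the boundary of every `X_j`, `j ≤ k`: the number of
boundary faces of `X_j` in the support is odd. These boundaries are disjoint. -/
theorem familyX_spec {m : ℕ} (hm : 1 < m) {k : ℕ} (hk : 1 ≤ k) :
    (familyX m k).TreeLike m ∧ (∀ t ∈ (familyX m k).faces, t.card ≤ m + 1) ∧
      (familyX m k).HasPaths m k ∧
      ∀ φ : Finset ℕ → ZMod 2, (familyX m k).Fills m φ (Finset.range (m + 1)) →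
        k ≤ ((familyX m k).supp m φ).card := by
  have hroot : ∀ {X : FiniteComplex ℕ}, X.TreeLike m → ∀ φ : Finset ℕ → ZMod 2,
      X.Fills m φ (Finset.range (m + 1)) → ∃ r, X.IsBoundaryFace m r ∧ φ r ≠ 0 := by
    intro X hX φ hφ
    have h := hX.parity φ
    rw [Finset.sum_eq_single_of_mem _ hX.root_mem hφ.2, zmod_two_eq_one_of_sq hφ.1] at h
    obtain ⟨r, hr, h0⟩ := Finset.exists_ne_zero_of_sum_ne_zero (h ▸ one_ne_zero)
    exact ⟨r, mem_bdry.1 hr, h0⟩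
  induction k, hk using Nat.le_induction with
  | base =>
    refine ⟨treeLike_fullSimplex hm, card_le_fullSimplex, hasPaths_fullSimplex (by omega), ?_⟩
    intro φ hφ
    obtain ⟨r, hr, h0⟩ := hroot (treeLike_fullSimplex hm) φ hφ
    exact Finset.card_pos.2 ⟨r, mem_supp.2 ⟨mem_cells.2 ⟨hr.1, hr.2.1⟩, h0⟩⟩
  | succ k hk ih =>
    obtain ⟨hT, hdim, hP, hlow⟩ := ih
    rw [familyX_succ hk]
    set X := familyX m k
    obtain ⟨hT', hdim', hbdry⟩ := glueAll_induction hdim (P := fun Z => Z.TreeLike m) hT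
      fun Z s v h _ _ hZ => hZ.glue h
    refine ⟨hT', hdim', hP.glueAll hdim, fun φ hφ => ?_⟩
    have hsub : ∀ j, X.cells j ⊆ (X.glueAll m).cells j := fun j t ht =>
      mem_cells.2 ⟨Or.inl (mem_cells.1 ht).1, (mem_cells.1 ht).2⟩
    obtain ⟨r, hr, h0⟩ := hroot hT' φ hφ
    have hlt : X.supp m φ ⊂ (X.glueAll m).supp m φ := by
      refine Finset.ssubset_iff_subset_ne.2 ⟨fun s hs => ?_, fun e => ?_⟩
      · exact mem_supp.2 ⟨hsub m (mem_supp.1 hs).1, (mem_supp.1 hs).2⟩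
      · have hmem : r ∈ X.supp m φ := by
          rw [e]
          exact mem_supp.2 ⟨mem_cells.2 ⟨hr.1, hr.2.1⟩, h0⟩
        exact hbdry r (mem_cells.1 (mem_supp.1 hmem).1).1 hr
    exact (hlow φ ⟨hφ.1, fun τ hτ => hφ.2 τ (hsub _ hτ)⟩).trans_lt (Finset.card_lt_card hlt)

/-! ### The complexes `Y_k` -/

/-- The properties of the complexes `Y_k` that are preserved by stellar subdivision of
an `m`-simplex. The chain `z` is a fundamental class, whose boundary lives on the boundary of the
simplex with the vertices `0, …, m`. -/
structure SubdividedSimplex (Z : FiniteComplex ℕ) (m : ℕ) : Prop where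
  ball : Nonempty (Z.realization ≃ₜ Metric.closedBall (0 : EuclideanSpace ℝ (Fin m)) 1)
  acyclic_two : Z.Acyclic (ZMod 2) m
  codegree_le : ∀ r : Finset ℕ, r.card = m → ((Z.cells (m + 1)).filter (r ⊆ ·)).card ≤ 2
  exists_chain : ∃ z : Finset ℕ → ℝ, (∀ t ∈ Z.cells (m + 1), z t ^ 2 = 1) ∧
    ∀ s, Z.bd (m + 1) z s = incidence ℝ s (Finset.range (m + 1))

theorem subdividedSimplex_fullSimplex (m : ℕ) : (fullSimplex m).SubdividedSimplex m := by
  refine ⟨nonempty_homeomorph_fullSimplex m, acyclic_fullSimplex _, fun r _ => ?_, fun _ => 1,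
    fun _ _ => one_pow 2, fun s => by rw [bd_fullSimplex, mul_one]⟩
  refine (Finset.card_filter_le _ _).trans ?_
  rw [cells_top_fullSimplex, Finset.card_singleton]
  exact one_le_two

theorem SubdividedSimplex.stellarAt {Z : FiniteComplex ℕ} {m : ℕ} {σ : Finset ℕ} {w : ℕ}
    (h : Z.Subdividable m σ w) (hZ : Z.SubdividedSimplex m) :
    (Z.stellarAt σ w).SubdividedSimplex m := by
  obtain ⟨e⟩ := hZ.ball
  obtain ⟨e'⟩ := h.nonempty_homeomorph
  obtain ⟨z, hz, hbd⟩ := hZ.exists_chain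
  obtain ⟨z', hz', hbd'⟩ := h.exists_chain hz
  exact ⟨⟨e'.trans e⟩, h.acyclic_stellarAt hZ.acyclic_two, h.codegree_stellarAt hZ.codegree_le,
    z', hz', fun s => (hbd' s).trans (hbd s)⟩

/-- Every `m`-simplex has a filling of size at most `k` that vanishes on the faces with the
vertex `c`. -/
def HasOuterFillings (F : Type*) [CommRing F] (Z : FiniteComplex ℕ) (m c k : ℕ) : Prop :=
  ∀ t ∈ Z.cells (m + 1), ∃ φ : Finset ℕ → F, Z.Fills m φ t ∧ (∀ s, c ∈ s → φ s = 0) ∧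
    (Z.supp m φ).card ≤ k

theorem HasOuterFillings.stellarList {F : Type*} [CommRing F] {Y : FiniteComplex ℕ} {m c k : ℕ}
    (hm : 0 < m) (hdim : ∀ t ∈ Y.faces, t.card ≤ m + 1) (hY : Y.HasOuterFillings F m c k) :
    (Y.stellarList (Y.innerSimplexes m c).toList).HasOuterFillings F m c (k + 1) := by
  have := (stellarList_induction (m := m) (c := c) hm hdim
    (P := fun _ Z => ∀ t ∈ Z.cells (m + 1), ∃ φ : Finset ℕ → F, Z.Fills m φ t ∧
      (∀ s, c ∈ s → φ s = 0) ∧ ((c ∈ t → t ∈ Y.faces) → (Z.supp m φ).card ≤ k) ∧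
      (Z.supp m φ).card ≤ k + 1) ?_ ?_).1
  · intro t ht
    obtain ⟨φ, h1, h2, -, h3⟩ := this t ht
    exact ⟨φ, h1, h2, h3⟩
  · intro t ht
    obtain ⟨φ, h1, h2, h3⟩ := hY t ht
    exact ⟨φ, h1, h2, fun _ => h3, h3.trans (Nat.le_succ k)⟩
  · exact fun _ Z σ w h hσ hc hw hfill => h.fills_stellarAt hw hσ hc hfill

theorem subdividable_fullSimplex (m : ℕ) :
    (fullSimplex m).Subdividable m (Finset.range (m + 1)) (centralVertex m) :=
  ⟨card_le_fullSimplex, ⟨⟨0, by simp⟩, subset_rfl⟩, Finset.card_range _,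
    fun _ ht => fresh_notMem ht⟩

theorem cells_top_familyY_one (m : ℕ) : (familyY m 1).cells (m + 1) =
    newFacets (Finset.range (m + 1)) (centralVertex m) := by
  refine (subdividable_fullSimplex m).cells_top.trans ?_
  rw [cells_top_fullSimplex, Finset.erase_singleton, Finset.empty_union]

theorem hasOuterFillings_familyY_one (F : Type*) [CommRing F] (m : ℕ) :
    (familyY m 1).HasOuterFillings F m (centralVertex m) 1 := by
  classical
  intro t ht
  have h := subdividable_fullSimplex m
  rw [cells_top_familyY_one] at ht
  have hwt := h.mem_of_mem_newFacets ht
  obtain ⟨u, hu, rfl⟩ := Finset.mem_image.1 ht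
  set T := insert (centralVertex m) (Finset.range (m + 1))
  set r := (T.erase u).erase (centralVertex m) with hr
  refine ⟨fun s => if s = r then 1 else 0, ⟨incidence_erase_sq hwt, fun τ hτ hne => ?_⟩,
    fun s hs => if_neg ?_, ?_⟩
  · rw [cells_top_familyY_one] at hτ
    obtain ⟨u', hu', rfl⟩ := Finset.mem_image.1 hτ
    refine incidence_eq_zero_of_not_subset fun hsub => ?_
    have huu' : u' ≠ u := by rintro rfl; exact hne rfl
    exact Finset.notMem_erase u' T (hsub (Finset.mem_erase.2 ⟨h.ne_of_mem hu',
      Finset.mem_erase.2 ⟨huu', Finset.mem_insert_of_mem hu'⟩⟩))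
  · rintro rfl
    exact Finset.notMem_erase _ _ hs
  · refine Finset.card_le_one.2 fun a ha b hb => ?_
    simp only [mem_supp, ne_eq, ite_eq_right_iff, not_forall] at ha hb
    rw [ha.2.choose, hb.2.choose]

theorem familyY_succ {m k : ℕ} (hk : 1 ≤ k) : familyY m (k + 1) = (familyY m k).stellarList
    ((familyY m k).innerSimplexes m (centralVertex m)).toList := by
  obtain ⟨j, rfl⟩ := Nat.exists_eq_add_of_le' hk
  rfl

theorem familyY_spec {m : ℕ} (hm : 0 < m) {k : ℕ} (hk : 1 ≤ k) :
    (familyY m k).SubdividedSimplex m ∧ (∀ t ∈ (familyY m k).faces, t.card ≤ m + 1) ∧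
      (familyY m k).HasOuterFillings (ZMod 2) m (centralVertex m) k ∧
      (familyY m k).HasOuterFillings ℝ m (centralVertex m) k ∧
      ((familyY m k).innerSimplexes m (centralVertex m)).card = (m + 1) * m ^ (k - 1) := by
  induction k, hk using Nat.le_induction with
  | base =>
    have h := subdividable_fullSimplex m
    refine ⟨(subdividedSimplex_fullSimplex m).stellarAt h, h.card_le_stellarAt,
      hasOuterFillings_familyY_one _ m, hasOuterFillings_familyY_one ℝ m, ?_⟩
    rw [innerSimplexes_eq, cells_top_familyY_one,
      Finset.filter_true_of_mem fun t ht => h.mem_of_mem_newFacets ht, Finset.card_eq_sum_ones,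
      sum_newFacets]
    simp
  | succ k hk ih =>
    obtain ⟨hS, hdim, h2, hR, hcard⟩ := ih
    rw [familyY_succ hk]
    set Y := familyY m k
    obtain ⟨⟨hS', hc'⟩, hdim', -⟩ := stellarList_induction (c := centralVertex m) hm hdim
      (P := fun i Z => Z.SubdividedSimplex m ∧ (Z.innerSimplexes m (centralVertex m)).card + i =
        (Y.innerSimplexes m (centralVertex m)).card + i * m)
      ⟨hS, by simp⟩ fun i Z σ w h _ hcσ _ hZ => ⟨hZ.1.stellarAt h, by
        have h1 := h.card_innerSimplexes_stellarAt hcσ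
        have h2 := hZ.2
        rw [add_mul, one_mul]
        omega⟩
    refine ⟨hS', hdim', h2.stellarList hm hdim, hR.stellarList hm hdim, ?_⟩
    rw [add_comm, Nat.add_left_cancel_iff, hcard] at hc'
    rw [hc', Nat.add_sub_cancel]
    obtain ⟨j, rfl⟩ := Nat.exists_eq_add_of_le' hk
    rw [Nat.add_sub_cancel, pow_succ, mul_assoc]

theorem card_cells_familyY {m : ℕ} (hm : 0 < m) {k : ℕ} (hk : 1 ≤ k) :
    (m + 1) * m ^ (k - 1) ≤ ((familyY m k).cells (m + 1)).card := by
  rw [← (familyY_spec hm hk).2.2.2.2, innerSimplexes_eq]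
  exact Finset.card_filter_le _ _

theorem cells_familyY_nonempty {m : ℕ} (hm : 0 < m) {k : ℕ} (hk : 1 ≤ k) :
    ((familyY m k).cells (m + 1)).Nonempty :=
  Finset.card_pos.1 ((by positivity : 0 < (m + 1) * m ^ (k - 1)).trans_le
    (card_cells_familyY hm hk))

theorem SubdividedSimplex.maxCodegree_le {Z : FiniteComplex ℕ} {k : ℕ}
    (hZ : Z.SubdividedSimplex (k + 1)) :
    Z.maxCodegree k ≤ 2 := by
  refine Finset.sup_le fun s _ => le_trans ?_ (hZ.codegree_le s.1 s.2.2)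
  rw [codegree, ← Set.ncard_coe_finset]
  exact Set.ncard_le_ncard_of_injOn (fun t : Z.Simplex (k + 1) => t.1)
    (fun t ht => Finset.mem_coe.2 (Finset.mem_filter.2 ⟨mem_cells.2 t.2, ht⟩))
    Subtype.val_injective.injOn (Finset.finite_toSet _)

theorem one_le_maxCodegree {V : Type*} {X : FiniteComplex V} {k : ℕ}
    (hne : (X.cells (k + 2)).Nonempty) : 1 ≤ X.maxCodegree k := by
  classical
  obtain ⟨t, ht⟩ := hne
  obtain ⟨v, hv⟩ := face_nonempty (mem_cells.1 ht).1
  let s : X.Simplex k := ⟨t.erase v, mem_cells.1 (erase_mem_cells (Nat.succ_pos k) ht hv)⟩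
  refine le_trans ?_ (Finset.le_sup (f := X.codegree k) (Finset.mem_univ s))
  exact (Set.ncard_pos (Set.toFinite _)).2 ⟨⟨t, mem_cells.1 ht⟩, Finset.erase_subset v t⟩

/-! ### Eigenvalues and Cheeger numbers of the two families -/

section Values

variable {n k : ℕ}

theorem familyX_isBall (hk : 1 ≤ k) : (familyX (n + 2) k).IsBall (n + 2) := by
  obtain ⟨hT, hdim, -⟩ := familyX_spec (show 1 < n + 2 by omega) hk
  exact isBall_of_homeomorph hdim ⟨_, hT.root_mem⟩ hT.ball

theorem le_spectralGap_familyX (hk : 1 ≤ k) :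
    (((n + 2 : ℕ) : ℝ) - 1) ^ 2 / (2 * (((n + 2 : ℕ) : ℝ) + 1)) ≤
      (familyX (n + 2) k).spectralGap (n + 1) := by
  obtain ⟨hT, -⟩ := familyX_spec (show 1 < n + 2 by omega) hk
  have hE := hT.energy
  have hmR : (1 : ℝ) < ((n + 2 : ℕ) : ℝ) := by exact_mod_cast (show 1 < n + 2 by omega)
  set M : ℝ := ((n + 2 : ℕ) : ℝ)
  set a := √M
  have ha2 : a ^ 2 = M := Real.sq_sqrt (by linarith)
  have ha0 : 0 < a := Real.sqrt_pos.2 (by linarith)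
  have ha1 : 1 < a := by nlinarith
  refine le_trans ?_ (le_spectralGap (c := (a - 1) ^ 2) (pow_pos (by linarith) 2)
    ⟨_, hT.root_mem⟩ hT.acyclic_real fun g => le_trans ?_ (hE g))
  · rw [div_le_iff₀ (by linarith), ← ha2]
    have : (a ^ 2 - 1) ^ 2 = (a - 1) ^ 2 * (a + 1) ^ 2 := by ring
    rw [this]
    exact mul_le_mul_of_nonneg_left (by nlinarith [sq_nonneg (a - 1)]) (sq_nonneg _)
  · exact le_add_of_nonneg_right
      (mul_nonneg (inv_nonneg.2 ha0.le) (Finset.sum_nonneg fun _ _ => sq_nonneg _))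

theorem cheeger_familyX (hk : 1 ≤ k) : (familyX (n + 2) k).cheeger (n + 1) = 1 / (k : ℝ) := by
  obtain ⟨hT, -, hP, hlow⟩ := familyX_spec (show 1 < n + 2 by omega) hk
  refine le_antisymm (cheeger_le_one_div hk hT.root_mem ?_ hlow)
    (one_div_le_cheeger hk ⟨_, hT.root_mem⟩ hT.acyclic_two fun t ht => ?_)
  · obtain ⟨φ, _, hφ, -⟩ := hP _ hT.root_mem
    exact ⟨φ, hφ⟩
  · obtain ⟨φ, _, hφ, -, -, hc⟩ := hP t ht
    exact ⟨φ, hφ, hc⟩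

theorem familyY_isBall (hk : 1 ≤ k) : (familyY (n + 2) k).IsBall (n + 2) := by
  have hm : 0 < n + 2 := by omega
  obtain ⟨hS, hdim, -⟩ := familyY_spec hm hk
  exact isBall_of_homeomorph hdim (cells_familyY_nonempty hm hk) hS.ball

theorem spectralGap_familyY_le (hk : 1 ≤ k) :
    (familyY (n + 2) k).spectralGap (n + 1) ≤ 1 / ((n + 2 : ℕ) : ℝ) ^ (k - 1) := by
  have hm : 0 < n + 2 := by omega
  obtain ⟨hS, -, -, hR, -⟩ := familyY_spec hm hk
  have hne := cells_familyY_nonempty hm hk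
  have hcard := card_cells_familyY hm hk
  obtain ⟨z, hz, hbd⟩ := hS.exists_chain
  set Y := familyY (n + 2) k
  have hD : ∑ s ∈ Y.cells (n + 2), Y.bd (n + 3) z s ^ 2 ≤ (n + 3 : ℕ) := by
    let B : Finset (Finset ℕ) :=
      (Finset.range (n + 3)).image fun u => (Finset.range (n + 3)).erase u
    have h1 : ∀ s ∈ Y.cells (n + 2), Y.bd (n + 3) z s ^ 2 ≤ if s ∈ B then 1 else 0 := by
      intro s _
      rw [hbd s]
      split_ifs with hs
      · obtain ⟨u, hu, rfl⟩ := Finset.mem_image.1 hs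
        exact (incidence_erase_sq hu).le
      · rw [incidence_eq_zero fun u hu e => hs (Finset.mem_image.2 ⟨u, hu, e⟩)]
        norm_num
    refine (Finset.sum_le_sum h1).trans ?_
    rw [Finset.sum_ite_mem, Finset.sum_const, nsmul_eq_mul, mul_one]
    exact_mod_cast (Finset.card_le_card Finset.inter_subset_right).trans
      (Finset.card_image_le.trans (Finset.card_range _).le)
  refine (spectralGap_le hne (fun t ht => ?_) hz hD).trans ?_
  · obtain ⟨φ, hφ, -⟩ := hR t ht
    exact ⟨φ, hφ⟩
  · rw [div_le_div_iff₀ (Nat.cast_pos.2 (Finset.card_pos.2 hne)) (by positivity), one_mul]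
    exact_mod_cast hcard

theorem one_div_le_cheeger_familyY (hk : 1 ≤ k) :
    1 / (k : ℝ) ≤ (familyY (n + 2) k).cheeger (n + 1) := by
  have hm : 0 < n + 2 := by omega
  obtain ⟨hS, -, h2, -⟩ := familyY_spec hm hk
  refine one_div_le_cheeger hk (cells_familyY_nonempty hm hk) hS.acyclic_two fun t ht => ?_
  obtain ⟨φ, hφ, -, hc⟩ := h2 t ht
  exact ⟨φ, hφ, hc⟩

theorem cheeger_familyY_le_one (hk : 1 ≤ k) : (familyY (n + 2) k).cheeger (n + 1) ≤ 1 := by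
  have hm : 0 < n + 2 := by omega
  obtain ⟨-, -, h2, -⟩ := familyY_spec hm hk
  obtain ⟨t, ht⟩ := cells_familyY_nonempty hm hk
  obtain ⟨φ, hφ, -⟩ := h2 t ht
  refine (cheeger_le_one_div one_pos ht ⟨φ, hφ⟩ fun φ hφ => ?_).trans_eq (by simp)
  by_contra hlt
  have hempty : (familyY (n + 2) k).supp (n + 2) φ = ∅ := Finset.card_eq_zero.1 (by omega)
  have h0 : cobd φ t = 0 := cobd_eq_zero fun v hv => by
    by_contra hne
    have : t.erase v ∈ (familyY (n + 2) k).supp (n + 2) φ :=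
      mem_supp.2 ⟨erase_mem_cells hm ht hv, hne⟩
    rw [hempty] at this
    exact Finset.notMem_empty _ this
  have h1 := hφ.1
  rw [h0] at h1
  exact absurd h1 (by decide)

theorem not_spectralGap_le_cheeger {p C : ℝ} (hp : 0 < p) :
    ¬ ∀ X : FiniteComplex ℕ, X.IsBall (n + 2) →
      X.spectralGap (n + 1) ≤ C * X.cheeger (n + 1) ^ p := by
  intro H
  set c₀ : ℝ := (((n + 2 : ℕ) : ℝ) - 1) ^ 2 / (2 * (((n + 2 : ℕ) : ℝ) + 1)) with hc₀
  have hpos : 0 < c₀ := by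
    have hmR : (1 : ℝ) < ((n + 2 : ℕ) : ℝ) := by exact_mod_cast (show 1 < n + 2 by omega)
    exact div_pos (pow_pos (by linarith) 2) (by linarith)
  have hlim : Tendsto (fun k : ℕ => C * (k : ℝ) ^ (-p)) atTop (𝓝 (C * 0)) :=
    ((tendsto_rpow_neg_atTop hp).comp tendsto_natCast_atTop_atTop).const_mul C
  have hle : c₀ ≤ C * 0 := by
    refine ge_of_tendsto hlim (eventually_atTop.2 ⟨1, fun k hk => ?_⟩)
    refine (le_spectralGap_familyX hk).trans ((H _ (familyX_isBall hk)).trans_eq ?_)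
    rw [cheeger_familyX hk, one_div, Real.inv_rpow (Nat.cast_nonneg k),
      Real.rpow_neg (Nat.cast_nonneg k)]
  linarith

theorem not_cheeger_le_spectralGap {p C : ℝ} (hC : 0 < C) :
    ¬ ∀ X : FiniteComplex ℕ, X.IsBall (n + 2) →
      C * X.cheeger (n + 1) ^ p / (X.maxCodegree (n + 1) : ℝ) ≤ X.spectralGap (n + 1) := by
  intro H
  obtain ⟨N, hN⟩ := exists_nat_ge p
  have hlim : Tendsto (fun k : ℕ => 4 * ((k : ℝ) ^ N / 2 ^ k)) atTop (𝓝 (4 * 0)) :=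
    (tendsto_pow_const_div_const_pow_of_one_lt N one_lt_two).const_mul 4
  have hle : C ≤ 4 * 0 := by
    refine ge_of_tendsto hlim (eventually_atTop.2 ⟨1, fun k hk => ?_⟩)
    have hk0 : (0 : ℝ) < k := Nat.cast_pos.2 hk
    have hm : 0 < n + 2 := by omega
    have hne := cells_familyY_nonempty hm hk
    have hD : ((familyY (n + 2) k).maxCodegree (n + 1) : ℝ) ≤ 2 := by
      exact_mod_cast (familyY_spec hm hk).1.maxCodegree_le
    have hD1 : (1 : ℝ) ≤ (familyY (n + 2) k).maxCodegree (n + 1) := by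
      exact_mod_cast one_le_maxCodegree hne
    have hgap := (H _ (familyY_isBall hk)).trans (spectralGap_familyY_le hk)
    have hh1 := cheeger_familyY_le_one (n := n) hk
    have hhk := one_div_le_cheeger_familyY (n := n) hk
    set h := (familyY (n + 2) k).cheeger (n + 1)
    have hh0 : 0 < h := (by positivity : (0 : ℝ) < 1 / k).trans_le hhk
    -- As `h ≤ 1`, the exponent may be replaced by a larger one, in particular if it is negative.
    have hpow : 1 / (k : ℝ) ^ N ≤ h ^ p := by
      rw [← one_div_pow]
      refine (pow_le_pow_left₀ (by positivity) hhk N).trans ?_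
      rw [← Real.rpow_natCast]
      exact Real.rpow_le_rpow_of_exponent_ge hh0 hh1 hN
    have hm2 : (2 : ℝ) ^ (k - 1) ≤ ((n + 2 : ℕ) : ℝ) ^ (k - 1) :=
      pow_le_pow_left₀ zero_le_two (by exact_mod_cast (show 2 ≤ n + 2 by omega)) _
    have h2k : (2 : ℝ) ^ k = 2 * 2 ^ (k - 1) := by
      rw [← pow_succ', Nat.sub_add_cancel hk]
    have h1 : C * (1 / (k : ℝ) ^ N) / 2 ≤ 1 / 2 ^ (k - 1) := by
      refine le_trans ?_ (hgap.trans (one_div_le_one_div_of_le (by positivity) hm2))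
      exact div_le_div₀ (by positivity) (mul_le_mul_of_nonneg_left hpow hC.le) (by linarith) hD
    rw [mul_one_div, div_div, div_le_div_iff₀ (by positivity) (by positivity)] at h1
    rw [← mul_div_assoc, le_div_iff₀ (by positivity), h2k]
    linarith
  linarith

end Values

end FiniteComplex

theorem proposition2 (m : ℕ) (hm : 1 < m) :
    -- the family `X_k`
    ((∀ k : ℕ, 1 ≤ k → (FiniteComplex.familyX m k).IsBall m) ∧
      (∀ k : ℕ, 1 ≤ k → ((m : ℝ) - 1) ^ 2 / (2 * ((m : ℝ) + 1)) ≤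
        (FiniteComplex.familyX m k).spectralGap (m - 1)) ∧
      (∀ k : ℕ, 1 ≤ k → (FiniteComplex.familyX m k).cheeger (m - 1) = 1 / (k : ℝ)) ∧
      Tendsto (fun k : ℕ => (FiniteComplex.familyX m k).cheeger (m - 1)) atTop (𝓝 0)) ∧
    -- the family `Y_k`
    ((∀ k : ℕ, 1 ≤ k → (FiniteComplex.familyY m k).IsBall m) ∧
      (∀ k : ℕ, 1 ≤ k → (FiniteComplex.familyY m k).spectralGap (m - 1) ≤
        1 / (m : ℝ) ^ (k - 1)) ∧
      (∀ k : ℕ, 1 ≤ k → 1 / (k : ℝ) ≤ (FiniteComplex.familyY m k).cheeger (m - 1))) ∧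
    -- no Cheeger inequality `C (h^{m-1})^p ≥ λ^{m-1}`
    (∀ p C : ℝ, 0 < p → ¬ ∀ X : FiniteComplex ℕ, X.IsBall m →
      X.spectralGap (m - 1) ≤ C * X.cheeger (m - 1) ^ p) ∧
    -- no Cheeger inequality `λ^{m-1} ≥ C (h^{m-1})^p / max d_s`
    (∀ p C : ℝ, 0 < C → ¬ ∀ X : FiniteComplex ℕ, X.IsBall m →
      C * X.cheeger (m - 1) ^ p / (X.maxCodegree (m - 1) : ℝ) ≤ X.spectralGap (m - 1)) := by
  obtain ⟨n, rfl⟩ := Nat.exists_eq_add_of_le' (Nat.succ_le_of_lt hm)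
  refine ⟨⟨fun k hk => FiniteComplex.familyX_isBall hk,
    fun k hk => FiniteComplex.le_spectralGap_familyX hk,
    fun k hk => FiniteComplex.cheeger_familyX hk, ?_⟩,
    ⟨fun k hk => FiniteComplex.familyY_isBall hk,
      fun k hk => FiniteComplex.spectralGap_familyY_le hk,
      fun k hk => FiniteComplex.one_div_le_cheeger_familyY hk⟩,
    fun p C hp => FiniteComplex.not_spectralGap_le_cheeger hp,
    fun p C hC => FiniteComplex.not_cheeger_le_spectralGap hC⟩
  exact tendsto_one_div_atTop_nhds_zero_nat.congr'
    (eventually_atTop.2 ⟨1, fun k hk => (FiniteComplex.cheeger_familyX hk).symm⟩)
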